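/- Let $n\ge 1$ and let $G_1,G_2$ be independent random $n\times n$ matrices, each with i.i.d. standard complex Gaussian entries (density $\pi^{-1}e^{-|z|^2}$ in the plane). Identify the sphere $\mathbb S^2$ with $\mathbb C\cup\{\infty\}$, let $m$ be Lebesgue measure on $\mathbb C$, and put $$d\mu_n(z)=\frac{n}{\pi}\,\frac{dm(z)}{(1+|z|^2)^{n+1}},\qquad \mathbb K(z,w)=(1+z\overline w)^{n-1},$$ where $\mu_n$ is regarded as a measure on $\mathbb C\cup\{\infty\}$ with $\mu_n(\{\infty\})=0$. Let $\mathcal X$ be the collection of zeros of $\det(zG_1-G_2)$ in $\mathbb C\cup\{\infty\}$, counted with multiplicity, where the multiplicity of $\infty$ is $n-\deg_z\det(zG_1-G_2)$. Then: 1. Almost surely $G_1$ is invertible and $\mathcal X$ is the collection of eigenvalues of $G_1^{-1}G_2$, counted with algebraic multiplicity. 2. $\mathcal X$ is a simple point process on $\mathbb C\cup\{\infty\}$, and it is determinantal with kernel $\mathbb K$ with respect to $\mu_n$: for every $k\ge 0$ and all pairwise disjoint Borel sets $B_1,\dots,B_k\subseteq\mathbb C\cup\{\infty\}$, $$\mathbf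 E\Big[\prod_{i=1}^k \#(\mathcal X\cap B_i)\Big]=\int_{B_1\times\cdots\times B_k}\det\big(\mathbb K(z_i,z_j)\big)_{i,j\le k}\,d\mu_n(z_1)\cdots d\mu_n(z_k).$$ The associated Hilbert space is the space of all functions in $L^2(\mathbb C\cup\{\infty\},\mu_n)$ that are analytic on $\mathbb C$. That is, this is a closed subspace of $L^2(\mu_n)$, and $\mathbb K$ is its reproducing kernel. 3. The points of $\mathcal X$ can be listed almost surely as the coordinates of a random vector in $\mathbb C^n$, and for any such listing the vector of points, after being put in uniformly random order, has a joint density with respect to Lebesgue measure on $\mathbb C^n$ that is proportional to $$\prod_{i<j}|z_j-z_i|^2\ \prod_{k=1}^n\frac{1}{(1+|z_k|^2)^{n+1}} .$$ -/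

import Mathlib

open MeasureTheory ProbabilityTheory Polynomial
open scoped ENNReal

noncomputable section

/-! ### The Riemann sphere `ℂ ∪ {∞}` as a Borel space -/

instance riemannSphereMeasurableSpace : MeasurableSpace (OnePoint ℂ) := borel (OnePoint ℂ)

instance riemannSphereBorelSpace : BorelSpace (OnePoint ℂ) := ⟨rfl⟩

/-! ### Gaussian matrices -/

/-- Matrices carry the product Borel structure of their entries. -/
instance complexMatrixMeasurableSpace {n : ℕ} : MeasurableSpace (Matrix (Fin n) (Fin n) ℂ) :=
  inferInstanceAs (MeasurableSpace (Fin n → Fin n → ℂ))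

/-- The standard complex Gaussian law, with density `π⁻¹ exp (-|z|²)` in the plane. -/
def stdComplexGaussian : Measure ℂ :=
  (volume : Measure ℂ).withDensity fun z => ENNReal.ofReal (Real.pi⁻¹ * Real.exp (-‖z‖ ^ 2))

/-- `G` is a random `n × n` matrix with i.i.d. standard complex Gaussian entries. -/
structure IsComplexGaussianMatrix {Ω : Type*} [MeasurableSpace Ω] (P : Measure Ω) {n : ℕ}
    (G : Ω → Matrix (Fin n) (Fin n) ℂ) : Prop where
  measurable_entry : ∀ i j, Measurable fun ω => G ω i j
  law_entry : ∀ i j, P.map (fun ω => G ω i j) = stdComplexGaussian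
  indep_entries : iIndepFun (fun (ij : Fin n × Fin n) (ω : Ω) => G ω ij.1 ij.2) P

/-! ### Point processes and joint intensities -/

section PointProcess

variable {Ω S : Type*} [MeasurableSpace Ω] [MeasurableSpace S]

/-- A simple point process on `S`: a random measure which almost surely is the counting measure of
a set having finitely many points in every compact set. -/
structure IsSimplePointProcess [TopologicalSpace S] (P : Measure Ω) (X : Ω → Measure S) :
    Prop where
  measurable : Measurable X
  simple : ∀ᵐ ω ∂P, ∃ s : Set S, (∀ C : Set S, IsCompact C → (s ∩ C).Finite) ∧
    X ω = Measure.sum fun x : s => Measure.dirac (x : S)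

/-- `ρ` is the `k`-th joint intensity (correlation function) of the point process `X` with respect
to `μ`: for pairwise disjoint measurable `B₁, …, B_k`, the expectation of `X(B₁) ⋯ X(B_k)` is the
integral of `ρ` over `B₁ × ⋯ × B_k` against the `k`-fold product of `μ`. -/
def IsJointIntensity (P : Measure Ω) (X : Ω → Measure S) (μ : Measure S) (k : ℕ)
    (ρ : (Fin k → S) → ℝ≥0∞) : Prop :=
  ∀ B : Fin k → Set S, (∀ i, MeasurableSet (B i)) → (Pairwise fun i j => Disjoint (B i) (B j)) →
    ∫⁻ ω, ∏ i, X ω (B i) ∂P = ∫⁻ x in Set.univ.pi B, ρ x ∂(Measure.pi fun _ => μ)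

/-- `H`, a space of honest functions on `S`, is a closed subspace of `L²(μ)` and `K` is its
reproducing kernel. -/
structure IsReproducingKernel (μ : Measure S) (H : Submodule ℂ (S → ℂ)) (K : S → S → ℂ) :
    Prop where
  memLp : ∀ f ∈ H, MemLp f 2 μ
  closed : IsClosed {g : Lp ℂ 2 μ | ∃ f ∈ H, g =ᵐ[μ] f}
  kernel_mem : ∀ w, (fun z => K z w) ∈ H
  reproducing : ∀ f ∈ H, ∀ w, f w = ∫ z, f z * (starRingEnd ℂ) (K z w) ∂μ

/-- `X` is a determinantal point process on `S` with kernel `K` with respect to the background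
measure `μ`, and `H` is the associated Hilbert space. (The determinants below are real and
nonnegative because `K` is a reproducing kernel.) -/
structure IsDeterminantalPointProcess [TopologicalSpace S] (P : Measure Ω) (X : Ω → Measure S)
    (μ : Measure S) (K : S → S → ℂ) (H : Submodule ℂ (S → ℂ)) : Prop where
  sigmaFinite : SigmaFinite μ
  pointProcess : IsSimplePointProcess P X
  kernel : IsReproducingKernel μ H K
  intensities : ∀ k : ℕ, IsJointIntensity P X μ k fun x =>
    ENNReal.ofReal (Matrix.of fun i j => K (x i) (x j)).det.re

end PointProcess

/-! ### Zeros of `det (z A - B)` on the sphere -/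

/-- The polynomial `det (z A - B)` in the variable `z`. -/
def pencilPoly {n : ℕ} (A B : Matrix (Fin n) (Fin n) ℂ) : ℂ[X] :=
  ((X : ℂ[X]) • A.map C - B.map C).det

theorem pencilPoly_eval {n : ℕ} (A B : Matrix (Fin n) (Fin n) ℂ) (z : ℂ) :
    (pencilPoly A B).eval z = (z • A - B).det := by
  rw [pencilPoly, ← Polynomial.coe_evalRingHom, RingHom.map_det]
  congr 1
  ext i j
  simp
  ring

/-- The zeros of `det (z A - B)` on `ℂ ∪ {∞}`, counted with multiplicity, as a counting measure.
A polynomial of degree `d`, regarded as of formal degree `n`, has a zero of order `n - d` at `∞`.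
(The degenerate case where the determinant vanishes identically gives `n` points at `∞` by
convention.) -/
def pencilZeros {n : ℕ} (A B : Matrix (Fin n) (Fin n) ℂ) : Measure (OnePoint ℂ) :=
  ((pencilPoly A B).roots.map fun z : ℂ => Measure.dirac (z : OnePoint ℂ)).sum
    + (n - (pencilPoly A B).natDegree) • Measure.dirac OnePoint.infty

/-! ### The background measure, the kernel and the Hilbert space -/

/-- The measure `(n / π) (1 + |z|²)^(-n-1) dm(z)`, as a measure on `ℂ ∪ {∞}`. -/
def sphericalMeasure (n : ℕ) : Measure (OnePoint ℂ) :=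
  ((volume : Measure ℂ).withDensity fun z =>
    ENNReal.ofReal (n / Real.pi / (1 + ‖z‖ ^ 2) ^ (n + 1))).map (fun z : ℂ => (z : OnePoint ℂ))

/-- The kernel `(1 + z w̄)^(n-1)`. The point `∞` has zero background measure; there the kernel is
given the value `0`. -/
def sphericalKernel (n : ℕ) (z w : OnePoint ℂ) : ℂ :=
  z.elim 0 fun z => w.elim 0 fun w => (1 + z * (starRingEnd ℂ) w) ^ (n - 1)

/-- The functions in `L²(ℂ ∪ {∞}, μ)` which are analytic on `ℂ`. They are given the value `0`
at `∞`, a point which has zero measure for the measures `μ` of interest. -/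
def analyticL2 (μ : Measure (OnePoint ℂ)) : Submodule ℂ (OnePoint ℂ → ℂ) where
  carrier := {f | f OnePoint.infty = 0 ∧ Differentiable ℂ (fun z : ℂ => f z) ∧ MemLp f 2 μ}
  zero_mem' := ⟨rfl, differentiable_const 0, MemLp.zero⟩
  add_mem' := fun {f g} hf hg =>
    ⟨by simp [hf.1, hg.1], hf.2.1.add hg.2.1, hf.2.2.add hg.2.2⟩
  smul_mem' := fun c f hf =>
    ⟨by simp [hf.1], hf.2.1.const_smul c, hf.2.2.const_smul c⟩

/-! ### Joint density of the points in exchangeable random order -/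

section Enumeration

variable {Ω : Type*} [MeasurableSpace Ω]

/-- The random vector `Z` lists the points of the point process `X`, all of them finite. -/
structure IsEnumeration (P : Measure Ω) (X : Ω → Measure (OnePoint ℂ)) {n : ℕ}
    (Z : Ω → Fin n → ℂ) : Prop where
  measurable : Measurable Z
  lists : ∀ᵐ ω ∂P, X ω = ∑ i, Measure.dirac (Z ω i : OnePoint ℂ)

/-- The law of the random vector `Z` after its coordinates have been put in a uniformly chosen
random order, independent of `Z`. -/
def exchangeableLaw (P : Measure Ω) {n : ℕ} (Z : Ω → Fin n → ℂ) : Measure (Fin n → ℂ) :=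
  (n.factorial : ℝ≥0∞)⁻¹ • ∑ σ : Equiv.Perm (Fin n), P.map fun ω => Z ω ∘ σ

end Enumeration

/-- The function `∏_{i<j} |z_j - z_i|² ∏_k (1 + |z_k|²)^(-n-1)`. -/
def sphericalWeight (n : ℕ) (z : Fin n → ℂ) : ℝ :=
  ‖∏ i, ∏ j ∈ Finset.Ioi i, (z j - z i)‖ ^ 2 * ∏ k, ((1 + ‖z k‖ ^ 2) ^ (n + 1))⁻¹

end

/-! Almost surely `G₁` is invertible. Then `det (z G₁ - G₂)` is `det G₁` times the characteristic
polynomial of `M = G₁⁻¹ G₂`, so the points are the eigenvalues of `M`, all finite. The work is to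
find their joint law and to integrate out coordinates.

Law of `M`. In the joint Gaussian integral substitute `B = A M` for fixed `A`; the Jacobian is `|det
A|^(2n)`. The exponent becomes `-tr A (1 + M Mᴴ) Aᴴ`, and absorbing a square root of `1 + M Mᴴ` into
`A` leaves a density proportional to `det (1 + Mᴴ M)^(-2n)` (`lintegral_inv_mul_gaussWeight`).

Law of the eigenvalues. The size of the matrix is lowered by peeling off one eigenvalue
(`lintegral_peel`), in the affine chart where the eigenvector is `(1, l)`, so no Haar measure on the
unitary group is needed. In a block matrix `[[a, b], [c, D]]` a number `z` outside the spectrum of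
`D` is an eigenvalue iff `a = z - b (z - D)⁻¹ c`. By the area formula for holomorphic functions,
integrating over `a` with each matrix counted once per eigenvalue is integrating over `z` with the
squared modulus of the derivative as weight. The substitutions `c = (z - D) l` and `D = M + l uᵀ`
turn that weight into `|χ_M(z)|²`, where `χ_M` is the characteristic polynomial of `M`, and turn the
matrix into a unipotent conjugate of `[[z, u], [0, M]]`. Since `det (1 + Nᴴ N)` is invariant under
unitary conjugation, a QR decomposition of the unipotent matrix makes the dependence on `l` split
off as a constant factor. The integral over `u` then factors into powers of `1 + |z|²` and `det (1 +
Mᴴ M)`, with the exponent of the latter lowered by one (`lintegral_gramDet_border`). Induction gives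
the Vandermonde factor and the one-point weights (`lintegral_roots_charpoly`). Constants are not
evaluated: total mass one determines them at the end.

Determinantal structure. For `μ_n` the monomials `z^j` with `j < n` are orthogonal with squared
norms `1 / (n-1).choose j`. Hence the kernel reproduces polynomials of degree below `n`, and the
squared Vandermonde is a multiple of `det K(z_i, z_j)`. Integrating one variable out of a
`(k+1)`-point kernel determinant multiplies the `k`-point one by `n - k`
(`lintegral_kernelDensity_cons`), which yields all the intensities. Cauchy's formula on circles
shows that the entire functions in `L²(μ_n)` are exactly these polynomials. -/

noncomputable section

/-! ### Lebesgue measure on complex matrices and linear changes of variables. -/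

instance complexMatrixBorelSpace {n : ℕ} : BorelSpace (Matrix (Fin n) (Fin n) ℂ) :=
  inferInstanceAs (BorelSpace (Fin n → Fin n → ℂ))

instance complexMatrixSecondCountable {n : ℕ} :
    SecondCountableTopology (Matrix (Fin n) (Fin n) ℂ) :=
  inferInstanceAs (SecondCountableTopology (Fin n → Fin n → ℂ))

/-- Lebesgue measure on complex matrices. -/
instance complexMatrixMeasureSpace {n : ℕ} : MeasureSpace (Matrix (Fin n) (Fin n) ℂ) where
  volume := (volume : Measure (Fin n → Fin n → ℂ))

instance complexMatrixSigmaFinite {n : ℕ} :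
    SigmaFinite (volume : Measure (Matrix (Fin n) (Fin n) ℂ)) :=
  inferInstanceAs (SigmaFinite (volume : Measure (Fin n → Fin n → ℂ)))

/-- The real determinant of a complex linear map is the squared modulus of its determinant. -/
theorem det_restrictScalars_real {E : Type*} [AddCommGroup E] [Module ℂ E] [FiniteDimensional ℂ E]
    (L : E →ₗ[ℂ] E) : LinearMap.det (L.restrictScalars ℝ) = ‖LinearMap.det L‖ ^ 2 := by
  rw [LinearMap.det_restrictScalars, Algebra.norm_complex_apply, Complex.normSq_eq_norm_sq]

theorem lintegral_comp_linearMap {E : Type*} [NormedAddCommGroup E] [NormedSpace ℂ E]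
    [FiniteDimensional ℂ E] [MeasurableSpace E] [BorelSpace E] (μ : Measure E) [μ.IsAddHaarMeasure]
    (L : E →ₗ[ℂ] E) (hL : LinearMap.det L ≠ 0) {f : E → ℝ≥0∞} (hf : Measurable f) :
    ENNReal.ofReal (‖LinearMap.det L‖ ^ 2) * ∫⁻ x, f (L x) ∂μ = ∫⁻ x, f x ∂μ := by
  let _ : NormedSpace ℝ E := NormedSpace.restrictScalars ℝ ℂ E
  have : FiniteDimensional ℝ E := FiniteDimensional.trans ℝ ℂ E
  have hpos : 0 < ‖LinearMap.det L‖ ^ 2 := by positivity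
  have hdet : LinearMap.det (L.restrictScalars ℝ) ≠ 0 := by
    rw [det_restrictScalars_real]; exact hpos.ne'
  have hmap := Measure.map_linearMap_addHaar_eq_smul_addHaar μ hdet
  have hLm : Measurable (L.restrictScalars ℝ) :=
    (LinearMap.continuous_of_finiteDimensional _).measurable
  have h := lintegral_map (μ := μ) hf hLm
  rw [hmap, lintegral_smul_measure, det_restrictScalars_real, abs_of_pos (inv_pos.2 hpos),
    ENNReal.ofReal_inv_of_pos hpos] at h
  have h' : ∫⁻ x, f (L x) ∂μ = (ENNReal.ofReal (‖LinearMap.det L‖ ^ 2))⁻¹ * ∫⁻ x, f x ∂μ := h.symm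
  rw [h', ← mul_assoc, ENNReal.mul_inv_cancel (by simpa using hL) ENNReal.ofReal_ne_top, one_mul]

theorem lintegral_comp_mulVec {n : ℕ} (S : Matrix (Fin n) (Fin n) ℂ) (hS : S.det ≠ 0)
    {f : (Fin n → ℂ) → ℝ≥0∞} (hf : Measurable f) :
    ENNReal.ofReal (‖S.det‖ ^ 2) * ∫⁻ x, f (S.mulVec x) = ∫⁻ x, f x := by
  have h : LinearMap.det (Matrix.toLin' S) = S.det := LinearMap.det_toLin' S
  have := lintegral_comp_linearMap volume (Matrix.toLin' S) (h ▸ hS) hf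
  rwa [h] at this

theorem lintegral_comp_vecMul {n : ℕ} (S : Matrix (Fin n) (Fin n) ℂ) (hS : S.det ≠ 0)
    {f : (Fin n → ℂ) → ℝ≥0∞} (hf : Measurable f) :
    ENNReal.ofReal (‖S.det‖ ^ 2) * ∫⁻ x, f (Matrix.vecMul x S) = ∫⁻ x, f x := by
  simpa [Matrix.mulVec_transpose] using
    lintegral_comp_mulVec S.transpose (by rwa [Matrix.det_transpose]) hf

theorem map_vecMul_volume {n : ℕ} (S : Matrix (Fin n) (Fin n) ℂ) (hS : S.det ≠ 0) :
    (volume : Measure (Fin n → ℂ)).map (fun x => Matrix.vecMul x S)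
      = (ENNReal.ofReal (‖S.det‖ ^ 2))⁻¹ • volume := by
  have hm : Measurable fun x : Fin n → ℂ => Matrix.vecMul x S := by
    apply Continuous.measurable; fun_prop
  ext s hs
  have := lintegral_comp_vecMul S hS (measurable_const.indicator hs : Measurable
    (s.indicator fun _ => (1 : ℝ≥0∞)))
  rw [← lintegral_map (measurable_const.indicator hs) hm, lintegral_indicator_const hs,
    lintegral_indicator_const hs, one_mul, one_mul] at this
  rw [Measure.smul_apply, smul_eq_mul, ← this, ← mul_assoc,
    ENNReal.inv_mul_cancel (by simpa using hS) ENNReal.ofReal_ne_top, one_mul]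

/-- Right multiplication acts on the `n` rows separately, each with real Jacobian `|det S|²`. -/
theorem lintegral_comp_mul_right_pi {n : ℕ} (S : Matrix (Fin n) (Fin n) ℂ) (hS : S.det ≠ 0)
    {f : (Fin n → Fin n → ℂ) → ℝ≥0∞} (hf : Measurable f) :
    ENNReal.ofReal (‖S.det‖ ^ 2) ^ n * ∫⁻ M : Fin n → Fin n → ℂ, f (fun i => Matrix.vecMul (M i) S) = ∫⁻ M, f M := by
  have hm : Measurable fun x : Fin n → ℂ => Matrix.vecMul x S := by
    apply Continuous.measurable; fun_prop
  have hd0 : ENNReal.ofReal (‖S.det‖ ^ 2) ≠ 0 := by simpa using hS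
  have hmap : (volume : Measure (Fin n → Fin n → ℂ)).map (fun M i => Matrix.vecMul (M i) S)
      = ((ENNReal.ofReal (‖S.det‖ ^ 2))⁻¹ ^ n) • volume := by
    have : SigmaFinite ((volume : Measure (Fin n → ℂ)).map fun x => Matrix.vecMul x S) := by
      rw [map_vecMul_volume S hS, ← ENNReal.ofReal_inv_of_pos (by positivity)]
      exact inferInstanceAs (SigmaFinite (((‖S.det‖ ^ 2)⁻¹).toNNReal • (volume : Measure (Fin n → ℂ))))
    rw [volume_pi, Measure.pi_map_pi (fun _ => hm.aemeasurable)]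
    refine Measure.pi_eq fun s hs => ?_
    simp only [map_vecMul_volume S hS, Measure.smul_apply, Measure.pi_pi, smul_eq_mul,
      Finset.prod_mul_distrib, Finset.prod_const, Finset.card_univ, Fintype.card_fin]
  have hm' : Measurable fun (M : Fin n → Fin n → ℂ) i => Matrix.vecMul (M i) S :=
    measurable_pi_iff.2 fun i => hm.comp (measurable_pi_apply i)
  have h := lintegral_map (μ := (volume : Measure (Fin n → Fin n → ℂ))) hf hm'
  rw [hmap, lintegral_smul_measure, smul_eq_mul] at h
  rw [← h, ← mul_assoc, ← mul_pow, ENNReal.mul_inv_cancel hd0 ENNReal.ofReal_ne_top, one_pow,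
    one_mul]

theorem lintegral_comp_mul_right {n : ℕ} (S : Matrix (Fin n) (Fin n) ℂ) (hS : S.det ≠ 0)
    {f : Matrix (Fin n) (Fin n) ℂ → ℝ≥0∞} (hf : Measurable f) :
    ENNReal.ofReal (‖S.det‖ ^ 2) ^ n * ∫⁻ M, f (M * S) = ∫⁻ M, f M :=
  lintegral_comp_mul_right_pi S hS hf

instance isAddHaarMeasure_pi_pi {n : ℕ} :
    (volume : Measure (Fin n → Fin n → ℂ)).IsAddHaarMeasure :=
  Measure.pi.isAddHaarMeasure fun _ : Fin n => (volume : Measure (Fin n → ℂ))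

theorem lintegral_comp_transpose {n : ℕ}
    {f : Matrix (Fin n) (Fin n) ℂ → ℝ≥0∞} (hf : Measurable f) :
    ∫⁻ M : Matrix (Fin n) (Fin n) ℂ, f M.transpose = ∫⁻ M, f M := by
  let T : (Fin n → Fin n → ℂ) →ₗ[ℂ] (Fin n → Fin n → ℂ) :=
    { toFun := fun M i j => M j i, map_add' := fun _ _ => rfl, map_smul' := fun _ _ => rfl }
  -- Transposition is an involution, so its determinant has modulus one and no sign has to be
  -- computed.
  have hT : LinearMap.det T * LinearMap.det T = 1 := by
    rw [← LinearMap.det_comp]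
    have : T.comp T = LinearMap.id := rfl
    rw [this, LinearMap.det_id]
  have h0 : LinearMap.det T ≠ 0 := left_ne_zero_of_mul_eq_one hT
  have h1 : ‖LinearMap.det T‖ ^ 2 = 1 := by rw [sq, ← norm_mul, hT, norm_one]
  have := lintegral_comp_linearMap (volume : Measure (Fin n → Fin n → ℂ)) T h0 hf
  rw [h1, ENNReal.ofReal_one, one_mul] at this
  exact this

theorem lintegral_comp_mul_left {n : ℕ} (S : Matrix (Fin n) (Fin n) ℂ) (hS : S.det ≠ 0)
    {f : Matrix (Fin n) (Fin n) ℂ → ℝ≥0∞} (hf : Measurable f) :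
    ENNReal.ofReal (‖S.det‖ ^ 2) ^ n * ∫⁻ M, f (S * M) = ∫⁻ M, f M := by
  have ht : Measurable fun M : Matrix (Fin n) (Fin n) ℂ => M.transpose := by
    apply Continuous.measurable; fun_prop
  have hl : Measurable fun M : Matrix (Fin n) (Fin n) ℂ => S * M := by
    apply Continuous.measurable; fun_prop
  have h := lintegral_comp_mul_right S.transpose (by rwa [Matrix.det_transpose]) (hf.comp ht)
  simp only [Function.comp_def, Matrix.transpose_mul, Matrix.transpose_transpose,
    Matrix.det_transpose] at h
  rwa [lintegral_comp_transpose hf, lintegral_comp_transpose (f := fun M => f (S * M))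
    (hf.comp hl)] at h

theorem lintegral_comp_conj {n : ℕ} (S : Matrix (Fin n) (Fin n) ℂ) (hS : S.det ≠ 0)
    {f : Matrix (Fin n) (Fin n) ℂ → ℝ≥0∞} (hf : Measurable f) :
    ∫⁻ M, f (S * M * S⁻¹) = ∫⁻ M, f M := by
  have hS' : S⁻¹.det ≠ 0 := by
    rw [Matrix.det_nonsing_inv]; simpa [Ring.inverse_eq_inv'] using hS
  have hr : Measurable fun M : Matrix (Fin n) (Fin n) ℂ => M * S⁻¹ := by
    apply Continuous.measurable; fun_prop
  rw [← lintegral_comp_mul_right S⁻¹ hS' hf, ← lintegral_comp_mul_left S hS (f := fun M => f (M * S⁻¹))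
      (hf.comp hr),
    ← mul_assoc, ← mul_pow, ← ENNReal.ofReal_mul (by positivity), ← mul_pow, ← norm_mul,
    ← Matrix.det_mul, Matrix.nonsing_inv_mul _ (isUnit_iff_ne_zero.2 hS)]
  simp

theorem lintegral_matrix_add_right {n : ℕ} (N : Matrix (Fin n) (Fin n) ℂ)
    (f : Matrix (Fin n) (Fin n) ℂ → ℝ≥0∞) :
    ∫⁻ M, f (M + N) = ∫⁻ M, f M :=
  lintegral_add_right_eq_self (μ := (volume : Measure (Fin n → Fin n → ℂ))) f N

/-! ### Null sets by Fubini along rays. -/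

/-- A measurable set meeting almost no point of each ray from `x₀` is null. -/
theorem volume_eq_zero_of_countable_rays {E : Type*} [NormedAddCommGroup E] [NormedSpace ℝ E]
    [FiniteDimensional ℝ E] [MeasurableSpace E] [BorelSpace E] (μ : Measure E)
    [μ.IsAddHaarMeasure] {Z : Set E} (hZ : MeasurableSet Z) (x₀ : E)
    (h : ∀ y : E, {t : ℝ | x₀ + t • y ∈ Z}.Countable) : μ Z = 0 := by
  have hm : MeasurableSet {p : E × ℝ | x₀ + p.2 • p.1 ∉ Z} :=
    (show Measurable fun p : E × ℝ => x₀ + p.2 • p.1 by fun_prop) hZ.compl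
  have h1 : ∀ᵐ y ∂μ, ∀ᵐ t : ℝ, x₀ + t • y ∉ Z := by
    refine Filter.Eventually.of_forall fun y => ?_
    rw [ae_iff]
    simpa using (h y).measure_zero volume
  -- By Fubini some `t ≠ 0` has `x₀ + t • y ∉ Z` for almost every `y`. The exceptional `y` form a
  -- translated and rescaled copy of `Z`, so `Z` is null.
  obtain ⟨t, ht, ht0⟩ := ((Measure.ae_ae_comm hm).1 h1 |>.and
    (Measure.ae_ne volume (0 : ℝ))).exists
  rw [ae_iff] at ht
  simp only [not_not] at ht
  have h2 : {y | x₀ + t • y ∈ Z} = (t • ·) ⁻¹' ((x₀ + ·) ⁻¹' Z) := rfl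
  rw [h2, Measure.addHaar_preimage_smul μ ht0, measure_preimage_add] at ht
  simpa [ht0] using ht

/-! ### Sard's theorem and the area formula for holomorphic functions of one variable. -/

/-- The derivative of a holomorphic function as a real linear map. -/
theorem hasFDerivAt_real_of_hasDerivAt {q : ℂ → ℂ} {d x : ℂ} (h : HasDerivAt q d x) :
    HasFDerivAt q ((ContinuousLinearMap.toSpanSingleton ℂ d).restrictScalars ℝ) x :=
  h.hasFDerivAt.restrictScalars ℝ

theorem det_toSpanSingleton_restrictScalars (d : ℂ) :
    ((ContinuousLinearMap.toSpanSingleton ℂ d).restrictScalars ℝ).det = ‖d‖ ^ 2 := by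
  have h := det_restrictScalars_real (LinearMap.toSpanSingleton ℂ ℂ d)
  have h2 : LinearMap.det (LinearMap.toSpanSingleton ℂ ℂ d) = d := by
    rw [LinearMap.det_ring]; simp
  rw [h2] at h
  exact h

/-- Sard's theorem for a holomorphic function. -/
theorem ae_regular_value {U : Set ℂ} {q q' : ℂ → ℂ}
    (hq : ∀ z ∈ U, HasDerivAt q (q' z) z) :
    ∀ᵐ a : ℂ, ∀ z ∈ U, q z = a → q' z ≠ 0 := by
  have h := addHaar_image_eq_zero_of_det_fderivWithin_eq_zero (volume : Measure ℂ)
    (s := {z ∈ U | q' z = 0}) (f := q)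
    (f' := fun z => (ContinuousLinearMap.toSpanSingleton ℂ (q' z)).restrictScalars ℝ)
    (fun z hz => (hasFDerivAt_real_of_hasDerivAt (hq z hz.1)).hasFDerivWithinAt)
    (fun z hz => by rw [det_toSpanSingleton_restrictScalars, hz.2]; simp)
  filter_upwards [measure_eq_zero_iff_ae_notMem.1 h] with a ha z hz hza h0
  exact ha ⟨z, ⟨hz, h0⟩, hza⟩

/-- Change of variables by a holomorphic function on a set where it is injective. -/
theorem exists_lintegral_eq_of_injOn {s : Set ℂ} (hs : MeasurableSet s) {q q' : ℂ → ℂ}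
    (hq : ∀ z ∈ s, HasDerivAt q (q' z) z) (hinj : Set.InjOn q s)
    {h : ℂ → ℂ → ℝ≥0∞} (hh : Measurable (Function.uncurry h)) :
    ∃ g : ℂ → ℝ≥0∞, Measurable g ∧ (∀ z ∈ s, g (q z) = h (q z) z) ∧ (∀ a ∉ q '' s, g a = 0) ∧
      ∫⁻ a, g a = ∫⁻ z in s, ENNReal.ofReal (‖q' z‖ ^ 2) * h (q z) z := by
  have hc : ContinuousOn q s := fun z hz => (hq z hz).continuousAt.continuousWithinAt
  have he : MeasurableEmbedding (s.domRestrict q) := hc.measurableEmbedding hs hinj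
  -- The integrand is transported along the inverse of `q` on its image and is zero elsewhere.
  let g : ℂ → ℝ≥0∞ := Function.extend (s.domRestrict q) (fun z => h (q z) z) 0
  have hgm : Measurable g := by
    refine he.measurable_extend ?_ measurable_const
    exact hh.comp ((he.measurable).prodMk measurable_subtype_coe)
  have hg1 : ∀ z ∈ s, g (q z) = h (q z) z := fun z hz =>
    he.injective.extend_apply (fun z : s => h (q z) z) 0 ⟨z, hz⟩
  have hg2 : ∀ a ∉ q '' s, g a = 0 := fun a ha =>
    Function.extend_apply' _ _ _ fun ⟨z, hz⟩ => ha ⟨z, z.2, hz⟩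
  refine ⟨g, hgm, hg1, hg2, ?_⟩
  have himg : MeasurableSet (q '' s) := by
    rw [← Set.range_domRestrict]; exact he.measurableSet_range
  have hsupp : ∫⁻ a, g a = ∫⁻ a in q '' s, g a := by
    rw [← lintegral_indicator himg]
    congr 1 with a
    by_cases ha : a ∈ q '' s
    · simp [ha]
    · simp [ha, hg2 a ha]
  rw [hsupp, lintegral_image_eq_lintegral_abs_det_fderiv_mul volume hs
    (fun z hz => (hasFDerivAt_real_of_hasDerivAt (hq z hz)).hasFDerivWithinAt) hinj]
  refine setLIntegral_congr_fun hs fun z hz => ?_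
  simp only [det_toSpanSingleton_restrictScalars, abs_of_nonneg (sq_nonneg ‖q' z‖), hg1 z hz]

/-- A holomorphic function without critical points on `V` is injective on the pieces of a countable
measurable partition of `V`. -/
theorem exists_partition_injOn {V : Set ℂ} {q q' : ℂ → ℂ}
    (hq : ∀ z ∈ V, HasDerivAt q (q' z) z) (h0 : ∀ z ∈ V, q' z ≠ 0) :
    ∃ t : ℕ → Set ℂ, Pairwise (Function.onFun Disjoint t) ∧ (∀ n, MeasurableSet (t n)) ∧
      V ⊆ ⋃ n, t n ∧ ∀ n, Set.InjOn q (V ∩ t n) := by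
  classical
  -- The tolerance is half of `‖B⁻¹‖⁻¹`: a map this close to an invertible linear `B` is injective.
  -- The value `1` for singular maps is a filler, since the derivative of `q` is invertible on `V`.
  let r : (ℂ →L[ℝ] ℂ) → NNReal := fun A =>
    if h : ∃ B : ℂ ≃L[ℝ] ℂ, (B : ℂ →L[ℝ] ℂ) = A then
      ‖((h.choose.symm : ℂ ≃L[ℝ] ℂ) : ℂ →L[ℝ] ℂ)‖₊⁻¹ / 2 else 1
  have hr : ∀ A, r A ≠ 0 := by
    intro A
    by_cases h : ∃ B : ℂ ≃L[ℝ] ℂ, (B : ℂ →L[ℝ] ℂ) = A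
    · simp only [r, dif_pos h]
      have : ‖((h.choose.symm : ℂ ≃L[ℝ] ℂ) : ℂ →L[ℝ] ℂ)‖₊ ≠ 0 :=
        h.choose.nnnorm_symm_pos.ne'
      positivity
    · simp [r, dif_neg h]
  obtain ⟨t, A, hd, hm, hcov, happ, hA⟩ := exists_partition_approximatesLinearOn_of_hasFDerivWithinAt
    q V _ (fun z hz => (hasFDerivAt_real_of_hasDerivAt (hq z hz)).hasFDerivWithinAt) r hr
  refine ⟨t, hd, hm, hcov, fun n => ?_⟩
  rcases V.eq_empty_or_nonempty with rfl | hV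
  · simp
  obtain ⟨y, hy, hAy⟩ := hA hV n
  have hdet : (A n).det ≠ 0 := by
    rw [hAy, det_toSpanSingleton_restrictScalars]
    exact pow_ne_zero _ (norm_ne_zero_iff.2 (h0 y hy))
  have hex : ∃ B : ℂ ≃L[ℝ] ℂ, (B : ℂ →L[ℝ] ℂ) = A n :=
    ⟨(A n).toContinuousLinearEquivOfDetNeZero hdet, by ext; simp⟩
  have hrn : r (A n) = ‖((hex.choose.symm : ℂ ≃L[ℝ] ℂ) : ℂ →L[ℝ] ℂ)‖₊⁻¹ / 2 := dif_pos hex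
  have happ' : ApproximatesLinearOn q ((hex.choose : ℂ ≃L[ℝ] ℂ) : ℂ →L[ℝ] ℂ) (V ∩ t n)
      (‖((hex.choose.symm : ℂ ≃L[ℝ] ℂ) : ℂ →L[ℝ] ℂ)‖₊⁻¹ / 2) := by
    have h1 := happ n
    rw [hrn] at h1
    convert h1 using 1
    exact hex.choose_spec
  refine ApproximatesLinearOn.injOn happ' (Or.inr ?_)
  exact NNReal.half_lt_self (inv_ne_zero hex.choose.nnnorm_symm_pos.ne')

/-- The area formula for a holomorphic function with finite fibres. -/
theorem lintegral_sum_fiber {U : Set ℂ} (hU : MeasurableSet U) {q q' : ℂ → ℂ}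
    (hq : ∀ z ∈ U, HasDerivAt q (q' z) z) (hq' : Measurable q')
    {F : ℂ → Finset ℂ} (hF : ∀ᵐ a : ℂ, ∀ z, z ∈ F a ↔ z ∈ U ∧ q z = a)
    {h : ℂ → ℂ → ℝ≥0∞} (hh : Measurable (Function.uncurry h)) :
    ∫⁻ a, ∑ z ∈ F a, h a z = ∫⁻ z in U, ENNReal.ofReal (‖q' z‖ ^ 2) * h (q z) z := by
  classical
  -- Critical points contribute to neither side: on the right the Jacobian vanishes, on the left
  -- critical values are null by Sard.
  set V : Set ℂ := U ∩ {z | q' z ≠ 0} with hVdef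
  have hV : MeasurableSet V := hU.inter (hq' (measurableSet_singleton 0)).compl
  obtain ⟨t, hd, hm, hcov, hinj⟩ := exists_partition_injOn (V := V) (q := q) (q' := q')
    (fun z hz => hq z hz.1) (fun z hz => hz.2)
  have hs : ∀ n, MeasurableSet (V ∩ t n) := fun n => hV.inter (hm n)
  choose g hgm hg1 hg2 hgint using fun n => exists_lintegral_eq_of_injOn (hs n)
    (fun z hz => hq z hz.1.1) (hinj n) hh
  have hVU : (⋃ n, V ∩ t n) = V := by
    rw [← Set.inter_iUnion]; exact Set.inter_eq_left.2 hcov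
  have hR : ∫⁻ z in U, ENNReal.ofReal (‖q' z‖ ^ 2) * h (q z) z
      = ∫⁻ z in V, ENNReal.ofReal (‖q' z‖ ^ 2) * h (q z) z := by
    rw [← lintegral_indicator hU, ← lintegral_indicator hV]
    congr 1 with z
    by_cases hz : z ∈ U
    · by_cases h0 : q' z = 0
      · have : z ∉ V := fun hh => hh.2 h0
        simp [hz, this, h0]
      · have : z ∈ V := ⟨hz, h0⟩
        simp [hz, this]
    · have : z ∉ V := fun hh => hz hh.1
      simp [hz, this]
  rw [hR]
  conv_rhs => rw [← hVU]
  rw [lintegral_iUnion hs (fun i j hij => (hd hij).mono Set.inter_subset_right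
    Set.inter_subset_right), ← tsum_congr hgint, ← lintegral_tsum fun n => (hgm n).aemeasurable]
  refine lintegral_congr_ae ?_
  filter_upwards [hF, ae_regular_value hq] with a ha hreg
  -- Since `q` is injective on each piece, at most one point of the fibre over `a` lies in `t n`, so
  -- the right side has at most one nonzero term.
  have hgn : ∀ n, g n a = ∑ z ∈ F a, if z ∈ t n then h a z else 0 := by
    intro n
    by_cases hex : ∃ z ∈ F a, z ∈ t n
    · obtain ⟨z, hzF, hzt⟩ := hex
      obtain ⟨hzU, hza⟩ := (ha z).1 hzF
      have hz : z ∈ V ∩ t n := ⟨⟨hzU, hreg z hzU hza⟩, hzt⟩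
      rw [Finset.sum_eq_single z, if_pos hzt]
      · have := hg1 n z hz
        rwa [hza] at this
      · intro w hwF hwz
        obtain ⟨hwU, hwa⟩ := (ha w).1 hwF
        rw [if_neg]
        intro hwt
        exact hwz (hinj n ⟨⟨hwU, hreg w hwU hwa⟩, hwt⟩ hz (hwa.trans hza.symm))
      · exact fun hn => absurd hzF hn
    · push Not at hex
      rw [Finset.sum_eq_zero fun z hz => if_neg (hex z hz), hg2]
      rintro ⟨z, hz, hza⟩
      exact hex z ((ha z).2 ⟨hz.1.1, hza⟩) hz.2
  simp only [hgn]
  rw [Summable.tsum_finsetSum fun _ _ => ENNReal.summable]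
  refine Finset.sum_congr rfl fun z hz => ?_
  obtain ⟨hzU, hza⟩ := (ha z).1 hz
  obtain ⟨n, hn⟩ := Set.mem_iUnion.1 (hcov ⟨hzU, hreg z hzU hza⟩)
  rw [tsum_eq_single n, if_pos hn]
  intro m hmn
  exact if_neg fun hzm => Set.disjoint_left.1 (hd hmn) hzm hn

/-! ### Measurable enumeration of polynomial roots. -/

/-- Vectors whose coordinates increase in the lexicographic order of `ℂ`. -/
def lexSorted (n : ℕ) : Set (Fin n → ℂ) :=
  {z | Monotone fun i => (toLex ((z i).re, (z i).im) : ℝ ×ₗ ℝ)}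

theorem measurableSet_lexSorted (n : ℕ) : MeasurableSet (lexSorted n) := by
  have : lexSorted n = ⋂ (i : Fin n) (j : Fin n) (_ : i ≤ j),
      {z : Fin n → ℂ | (z i).re < (z j).re ∨ (z i).re = (z j).re ∧ (z i).im ≤ (z j).im} := by
    ext z
    simp only [lexSorted, Monotone, Prod.Lex.toLex_le_toLex, Set.mem_iInter, Set.mem_ofPred_eq]
  rw [this]
  have hre : ∀ i : Fin n, Measurable fun z : Fin n → ℂ => (z i).re := fun i =>
    Complex.measurable_re.comp (measurable_pi_apply i)
  have him : ∀ i : Fin n, Measurable fun z : Fin n → ℂ => (z i).im := fun i =>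
    Complex.measurable_im.comp (measurable_pi_apply i)
  refine MeasurableSet.iInter fun i => MeasurableSet.iInter fun j => MeasurableSet.iInter fun _ => ?_
  exact (measurableSet_lt (hre i) (hre j)).union
    ((measurableSet_eq_fun (hre i) (hre j)).inter (measurableSet_le (him i) (him j)))

theorem toLex_re_im_injective :
    Function.Injective fun z : ℂ => (toLex (z.re, z.im) : ℝ ×ₗ ℝ) := by
  intro z w h
  have h' := toLex.injective h
  exact Complex.ext (congrArg Prod.fst h') (congrArg Prod.snd h')

theorem eq_of_lexSorted {n : ℕ} {z w : Fin n → ℂ} (hz : z ∈ lexSorted n) (hw : w ∈ lexSorted n)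
    (h : Finset.univ.val.map z = Finset.univ.val.map w) : z = w := by
  have hp : (List.ofFn fun i => (toLex ((z i).re, (z i).im) : ℝ ×ₗ ℝ)).Perm
      (List.ofFn fun i => (toLex ((w i).re, (w i).im) : ℝ ×ₗ ℝ)) := by
    have h2 := congrArg (Multiset.map fun z : ℂ => (toLex (z.re, z.im) : ℝ ×ₗ ℝ)) h
    rw [Multiset.map_map, Multiset.map_map, Fin.univ_val_map, Fin.univ_val_map,
      Multiset.coe_eq_coe] at h2
    exact h2
  have h3 := hp.eq_of_pairwise' (List.sortedLE_ofFn_iff.2 hz).pairwise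
    (List.sortedLE_ofFn_iff.2 hw).pairwise
  have h4 := List.ofFn_injective h3
  funext i
  exact toLex_re_im_injective (congrFun h4 i)

theorem exists_lexSorted {n : ℕ} (z : Fin n → ℂ) :
    ∃ w ∈ lexSorted n, Finset.univ.val.map w = Finset.univ.val.map z := by
  refine ⟨z ∘ Tuple.sort fun i => (toLex ((z i).re, (z i).im) : ℝ ×ₗ ℝ), ?_, ?_⟩
  · exact Tuple.monotone_sort fun i => (toLex ((z i).re, (z i).im) : ℝ ×ₗ ℝ)
  · rw [← Multiset.map_map]
    congr 1
    exact congrArg Finset.val (Finset.map_univ_equiv (Tuple.sort _))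

theorem exists_fin_map_eq {α : Type*} {n : ℕ} (s : Multiset α) (hs : s.card = n) :
    ∃ z : Fin n → α, Finset.univ.val.map z = s := by
  subst hs
  induction s using Quotient.inductionOn with
  | h l => exact ⟨l.get, (Fin.univ_val_map l.get).trans (congrArg _ (List.ofFn_get l))⟩

/-- The leading terms cancel, so the difference has degree below `n` and `n` zeros. The values at
`0, …, n - 1` thus serve as coordinates on the monic polynomials of degree `n`. -/
theorem Polynomial.Monic.eq_of_eval_nat {n : ℕ} {p q : ℂ[X]} (hp : p.Monic) (hq : q.Monic)
    (hpn : p.natDegree = n) (hqn : q.natDegree = n)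
    (h : ∀ k : Fin n, p.eval ((k : ℕ) : ℂ) = q.eval ((k : ℕ) : ℂ)) : p = q := by
  by_contra hne
  have hdeg : (p - q).degree < n := by
    have := degree_sub_lt_left (p := p) (q := q)
      (by rw [degree_eq_natDegree hp.ne_zero, degree_eq_natDegree hq.ne_zero, hpn, hqn])
      hp.ne_zero (by rw [hp.leadingCoeff, hq.leadingCoeff])
    rwa [degree_eq_natDegree hp.ne_zero, hpn] at this
  refine hne (sub_eq_zero.1 ?_)
  refine eq_zero_of_degree_lt_of_eval_finset_eq_zero
    (Finset.univ.image fun k : Fin n => ((k : ℕ) : ℂ)) ?_ ?_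
  · rw [Finset.card_image_of_injective _ fun a b hab => Fin.ext (Nat.cast_injective hab)]
    simpa using hdeg
  · intro x hx
    obtain ⟨k, -, rfl⟩ := Finset.mem_image.1 hx
    rw [eval_sub, h k, sub_self]

/-- The roots of monic polynomials of degree `n` can be listed in a measurable way. -/
theorem exists_measurable_rootVec (n : ℕ) : ∃ R : (Fin n → ℂ) → Fin n → ℂ, Measurable R ∧
    ∀ p : ℂ[X], p.Monic → p.natDegree = n →
      Finset.univ.val.map (R fun k => p.eval ((k : ℕ) : ℂ)) = p.roots := by
  let P : (Fin n → ℂ) → ℂ[X] := fun z => ((Finset.univ.val.map z).map fun a => X - C a).prod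
  have hPm : ∀ z, (P z).Monic := fun z => monic_multiset_prod_of_monic _ _ fun a _ => monic_X_sub_C a
  have hPd : ∀ z, (P z).natDegree = n := fun z => by
    simp only [P]
    rw [natDegree_multiset_prod_X_sub_C_eq_card]
    simp
  have hPr : ∀ z, (P z).roots = Finset.univ.val.map z := fun z => roots_multiset_prod_X_sub_C _
  let T : lexSorted n → Fin n → ℂ := fun z k => (P z).eval ((k : ℕ) : ℂ)
  have hT : Measurable T := by
    refine measurable_pi_iff.2 fun k => ?_
    have : (fun z : lexSorted n => T z k) = fun z : lexSorted n =>
        ∏ i, (((k : ℕ) : ℂ) - (z : Fin n → ℂ) i) := by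
      funext z
      simp only [T, P, eval_multiset_prod, Multiset.map_map, Function.comp_def, eval_sub, eval_X,
        eval_C]
      rfl
    rw [this]
    refine Finset.measurable_prod _ fun i _ => ?_
    exact measurable_const.sub ((measurable_pi_apply i).comp measurable_subtype_coe)
  have hinj : Function.Injective T := by
    intro z w h
    have hzw : P z = P w := (hPm z).eq_of_eval_nat (hPm w) (hPd z) (hPd w) fun k => congrFun h k
    have := congrArg roots hzw
    rw [hPr, hPr] at this
    exact Subtype.ext (eq_of_lexSorted z.2 w.2 this)
  have : StandardBorelSpace (lexSorted n) := (measurableSet_lexSorted n).standardBorel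
  -- By the Lusin–Souslin theorem an injective measurable map between standard Borel spaces has a
  -- measurable inverse on its image. This makes the root vector a measurable function of the
  -- values, without continuity of roots.
  have hemb : MeasurableEmbedding T := hT.measurableEmbedding hinj
  refine ⟨Function.extend T (fun z => (z : Fin n → ℂ)) 0,
    hemb.measurable_extend measurable_subtype_coe measurable_const, fun p hp hpn => ?_⟩
  have hcard : p.roots.card = n := by
    rw [← hpn]; exact splits_iff_card_roots.1 (IsAlgClosed.splits p)
  obtain ⟨z, hz⟩ := exists_fin_map_eq p.roots hcard
  obtain ⟨w, hw, hwz⟩ := exists_lexSorted z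
  have hPw : P w = p := by
    have := prod_multiset_X_sub_C_of_monic_of_roots_card_eq hp (hcard.trans hpn.symm)
    rw [← this, ← hz, ← hwz]
  have hTw : (fun k : Fin n => p.eval ((k : ℕ) : ℂ)) = T ⟨w, hw⟩ := by
    funext k; simp only [T, hPw]
  rw [hTw, hemb.injective.extend_apply, ← hPw, hPr]

theorem exists_measurable_roots {α : Type*} [MeasurableSpace α] {n : ℕ} {p : α → ℂ[X]}
    (hp : ∀ a, (p a).Monic) (hn : ∀ a, (p a).natDegree = n)
    (hm : ∀ z : ℂ, Measurable fun a => (p a).eval z) :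
    ∃ Z : α → Fin n → ℂ, Measurable Z ∧ ∀ a, Finset.univ.val.map (Z a) = (p a).roots := by
  obtain ⟨R, hR, h⟩ := exists_measurable_rootVec n
  exact ⟨fun a => R fun k => (p a).eval ((k : ℕ) : ℂ), hR.comp (measurable_pi_iff.2 fun k => hm _),
    fun a => h _ (hp a) (hn a)⟩

/-- By Lagrange interpolation at `0, …, n` a coefficient is a fixed linear combination of values. -/
theorem measurable_coeff_of_measurable_eval {α : Type*} [MeasurableSpace α] {n : ℕ} {p : α → ℂ[X]}
    (hn : ∀ a, (p a).natDegree ≤ n) (hm : ∀ z : ℂ, Measurable fun a => (p a).eval z) (k : ℕ) :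
    Measurable fun a => (p a).coeff k := by
  have hinj : Set.InjOn (fun i : ℕ => (i : ℂ)) (Finset.range (n + 1)) :=
    Nat.cast_injective.injOn
  have : (fun a => (p a).coeff k) = fun a => ∑ i ∈ Finset.range (n + 1),
      (p a).eval (i : ℂ) * (Lagrange.basis (Finset.range (n + 1)) (fun i : ℕ => (i : ℂ)) i).coeff k := by
    funext a
    have h := Lagrange.eq_interpolate (f := p a) hinj (by
      rw [Finset.card_range]
      exact lt_of_le_of_lt degree_le_natDegree (by exact_mod_cast Nat.lt_succ_of_le (hn a)))
    conv_lhs => rw [h]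
    simp [Lagrange.interpolate_apply]
  rw [this]
  exact Finset.measurable_sum _ fun i _ => (hm _).mul_const _

theorem measurable_of_natPartition {α β : Type*} [MeasurableSpace α] [MeasurableSpace β]
    {f : α → β} {N : α → ℕ} (hN : Measurable N)
    (h : ∀ d, ∃ g : α → β, Measurable g ∧ ∀ a, N a = d → f a = g a) : Measurable f := by
  choose g hg hfg using h
  intro s hs
  have : f ⁻¹' s = ⋃ d, (N ⁻¹' {d}) ∩ (g d ⁻¹' s) := by
    ext a
    simp only [Set.mem_preimage, Set.mem_iUnion, Set.mem_inter_iff, Set.mem_singleton_iff]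
    constructor
    · exact fun ha => ⟨N a, rfl, by rwa [← hfg _ a rfl]⟩
    · rintro ⟨d, hd, ha⟩
      rwa [hfg d a hd]
  rw [this]
  exact MeasurableSet.iUnion fun d => (hN (measurableSet_singleton d)).inter (hg d hs)

theorem measurable_natDegree_of_measurable_eval {α : Type*} [MeasurableSpace α] {n : ℕ}
    {p : α → ℂ[X]} (hn : ∀ a, (p a).natDegree ≤ n)
    (hm : ∀ z : ℂ, Measurable fun a => (p a).eval z) : Measurable fun a => (p a).natDegree := by
  refine measurable_of_Iic fun d => ?_
  have : (fun a => (p a).natDegree) ⁻¹' Set.Iic d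
      = ⋂ (k : ℕ) (_ : d < k), {a | (p a).coeff k = 0} := by
    ext a
    simp [natDegree_le_iff_coeff_eq_zero]
  rw [this]
  exact MeasurableSet.iInter fun k => MeasurableSet.iInter fun _ =>
    measurable_coeff_of_measurable_eval hn hm k (measurableSet_singleton 0)

/-- Measurability of the point process is required at every `ω`, also where the degree drops or the
polynomial vanishes. On each level set of the degree the polynomial is made monic and its roots are
listed measurably. -/
theorem measurable_dirac_roots {α S : Type*} [MeasurableSpace α] [MeasurableSpace S] {n : ℕ}
    {p : α → ℂ[X]} (hn : ∀ a, (p a).natDegree ≤ n)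
    (hm : ∀ z : ℂ, Measurable fun a => (p a).eval z) {c : ℂ → S} (hc : Measurable c) :
    Measurable fun a => ((p a).roots.map fun z => Measure.dirac (c z)).sum := by
  classical
  have hN := measurable_natDegree_of_measurable_eval hn hm
  refine measurable_of_natPartition hN fun d => ?_
  -- Degree zero is separate because it includes the zero polynomial, which cannot be made monic;
  -- there `roots` is empty.
  rcases Nat.eq_zero_or_pos d with rfl | hd
  · refine ⟨fun _ => 0, measurable_const, fun a ha => ?_⟩
    rw [eq_C_of_natDegree_eq_zero ha, roots_C]
    simp
  -- Off the level set `X ^ d` is a filler that keeps the family monic of degree `d`.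
  · let q : α → ℂ[X] := fun a =>
      if (p a).natDegree = d then C ((p a).coeff d)⁻¹ * p a else X ^ d
    have hlead : ∀ a, (p a).natDegree = d → (p a).coeff d ≠ 0 := fun a ha => by
      rw [← ha]
      refine leadingCoeff_ne_zero.2 fun h0 => ?_
      rw [h0, natDegree_zero] at ha
      omega
    have hqm : ∀ a, (q a).Monic := by
      intro a
      by_cases ha : (p a).natDegree = d
      · simp only [q, if_pos ha]
        rw [Monic, leadingCoeff_mul, leadingCoeff_C, leadingCoeff, ha]
        exact inv_mul_cancel₀ (hlead a ha)
      · simp only [q, if_neg ha]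
        exact monic_X_pow d
    have hqd : ∀ a, (q a).natDegree = d := by
      intro a
      by_cases ha : (p a).natDegree = d
      · simp only [q, if_pos ha]
        rw [natDegree_C_mul (inv_ne_zero (hlead a ha)), ha]
      · simp only [q, if_neg ha]
        exact natDegree_X_pow d
    have hqe : ∀ z : ℂ, Measurable fun a => (q a).eval z := by
      intro z
      have : (fun a => (q a).eval z) = fun a =>
          if (p a).natDegree = d then ((p a).coeff d)⁻¹ * (p a).eval z else z ^ d := by
        funext a
        by_cases ha : (p a).natDegree = d <;> simp [q, ha]
      rw [this]
      exact Measurable.ite (hN (measurableSet_singleton d))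
        ((measurable_coeff_of_measurable_eval hn hm d).inv.mul (hm z)) measurable_const
    obtain ⟨Z, hZ, hZr⟩ := exists_measurable_roots hqm hqd hqe
    refine ⟨fun a => ∑ i, Measure.dirac (c (Z a i)), ?_, fun a ha => ?_⟩
    · refine Finset.measurable_sum _ fun i _ => ?_
      exact Measure.measurable_dirac.comp (hc.comp ((measurable_pi_apply i).comp hZ))
    · have : (p a).roots = (q a).roots := by
        simp only [q, if_pos ha]
        rw [roots_C_mul _ (inv_ne_zero (hlead a ha))]
      rw [this, ← hZr a, Multiset.map_map]
      rfl

/-! ### Bordered matrices and Schur complements. -/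

section Border

open Matrix

/-- The matrix with block form `[[a, b], [c, D]]`, where `a` is a scalar. -/
def border {R : Type*} {n : ℕ} (a : R) (b c : Fin n → R) (D : Matrix (Fin n) (Fin n) R) :
    Matrix (Fin (n + 1)) (Fin (n + 1)) R :=
  Matrix.of (Fin.cons (Fin.cons a b) fun i => Fin.cons (c i) (D i))

variable {R : Type*} {n : ℕ}

@[simp] theorem border_zero_zero (a : R) (b c : Fin n → R) (D : Matrix (Fin n) (Fin n) R) :
    border a b c D 0 0 = a := rfl

@[simp] theorem border_zero_succ (a : R) (b c : Fin n → R) (D : Matrix (Fin n) (Fin n) R)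
    (j : Fin n) : border a b c D 0 j.succ = b j := rfl

@[simp] theorem border_succ_zero (a : R) (b c : Fin n → R) (D : Matrix (Fin n) (Fin n) R)
    (i : Fin n) : border a b c D i.succ 0 = c i := rfl

@[simp] theorem border_succ_succ (a : R) (b c : Fin n → R) (D : Matrix (Fin n) (Fin n) R)
    (i j : Fin n) : border a b c D i.succ j.succ = D i j := rfl

theorem border_eta (M : Matrix (Fin (n + 1)) (Fin (n + 1)) R) :
    border (M 0 0) (fun j => M 0 j.succ) (fun i => M i.succ 0) (M.submatrix Fin.succ Fin.succ)
      = M := by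
  ext i j
  refine Fin.cases ?_ (fun i => ?_) i <;> refine Fin.cases ?_ (fun j => ?_) j <;> rfl

theorem submatrix_succ_border (a : R) (b c : Fin n → R) (D : Matrix (Fin n) (Fin n) R) :
    (border a b c D).submatrix Fin.succ Fin.succ = D := rfl

theorem border_ext {M N : Matrix (Fin (n + 1)) (Fin (n + 1)) R} (h00 : M 0 0 = N 0 0)
    (h01 : ∀ j : Fin n, M 0 j.succ = N 0 j.succ) (h10 : ∀ i : Fin n, M i.succ 0 = N i.succ 0)
    (h11 : ∀ i j : Fin n, M i.succ j.succ = N i.succ j.succ) : M = N := by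
  ext i j
  refine Fin.cases ?_ (fun i => ?_) i <;> refine Fin.cases ?_ (fun j => ?_) j
  exacts [h00, h01 j, h10 i, h11 i j]

theorem border_one [Zero R] [One R] : border 1 0 0 (1 : Matrix (Fin n) (Fin n) R) = 1 := by
  apply border_ext <;> intros <;> simp [Matrix.one_apply, Fin.succ_ne_zero, (Fin.succ_ne_zero _).symm]

theorem border_add [Add R] (a a' : R) (b b' c c' : Fin n → R) (D D' : Matrix (Fin n) (Fin n) R) :
    border a b c D + border a' b' c' D' = border (a + a') (b + b') (c + c') (D + D') := by
  apply border_ext <;> intros <;> simp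

theorem border_sub [Sub R] (a a' : R) (b b' c c' : Fin n → R) (D D' : Matrix (Fin n) (Fin n) R) :
    border a b c D - border a' b' c' D' = border (a - a') (b - b') (c - c') (D - D') := by
  apply border_ext <;> intros <;> simp

theorem border_mul [CommRing R] (a a' : R) (b b' c c' : Fin n → R)
    (D D' : Matrix (Fin n) (Fin n) R) :
    border a b c D * border a' b' c' D' = border (a * a' + b ⬝ᵥ c') (a • b' + b ᵥ* D')
      (a' • c + D *ᵥ c') (vecMulVec c b' + D * D') := by
  apply border_ext <;> intros <;>
    simp [Matrix.mul_apply, Fin.sum_univ_succ, dotProduct, vecMul, mulVec, vecMulVec, mul_comm]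

theorem border_conjTranspose [Star R] (a : R) (b c : Fin n → R) (D : Matrix (Fin n) (Fin n) R) :
    (border a b c D)ᴴ = border (star a) (star c) (star b) Dᴴ := by
  apply border_ext <;> intros <;> simp [Matrix.conjTranspose_apply]

theorem scalar_border [CommRing R] (z : R) :
    Matrix.scalar (Fin (n + 1)) z = border z 0 0 (Matrix.scalar (Fin n) z) := by
  apply border_ext <;> intros <;> simp [Matrix.diagonal_apply, Fin.succ_ne_zero,
    (Fin.succ_ne_zero _).symm]

theorem det_border_zero_left [CommRing R] (a : R) (b : Fin n → R) (D : Matrix (Fin n) (Fin n) R) :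
    (border a b 0 D).det = a * D.det := by
  rw [Matrix.det_succ_column_zero, Fin.sum_univ_succ]
  simp [Fin.succAbove_zero, submatrix_succ_border]

theorem det_border_zero_right [CommRing R] (a : R) (c : Fin n → R) (D : Matrix (Fin n) (Fin n) R) :
    (border a 0 c D).det = a * D.det := by
  rw [Matrix.det_succ_row_zero, Fin.sum_univ_succ]
  simp [Fin.succAbove_zero, submatrix_succ_border]

/-- Block elimination of the top right block leaves the Schur complement of `D` in the corner. -/
theorem det_border_of_isUnit [CommRing R] (a : R) (b c : Fin n → R)
    (D : Matrix (Fin n) (Fin n) R) (hD : IsUnit D.det) :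
    (border a b c D).det = (a - b ⬝ᵥ (D⁻¹ *ᵥ c)) * D.det := by
  have : border a b c D = border 1 (b ᵥ* D⁻¹) 0 1 * border (a - b ⬝ᵥ (D⁻¹ *ᵥ c)) 0 c D := by
    rw [border_mul, Matrix.vecMul_vecMul, Matrix.nonsing_inv_mul _ hD, ← Matrix.dotProduct_mulVec]
    simp
  rw [this, Matrix.det_mul, det_border_zero_left, det_border_zero_right]
  simp

/-- The determinant of a bordered matrix. -/
theorem det_border (a : ℂ) (b c : Fin n → ℂ) (D : Matrix (Fin n) (Fin n) ℂ) :
    (border a b c D).det = a * D.det - b ⬝ᵥ (D.adjugate *ᵥ c) := by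
  -- Both sides are continuous in `D`. Replacing `D` by `t + D` makes it invertible for all but
  -- finitely many `t`, and density carries the Schur complement formula to `t = 0`. The adjugate
  -- form is needed later for singular `D`.
  have hfin : {t : ℂ | (Matrix.scalar (Fin n) t + D).det = 0}.Finite := by
    refine ((-D).charpoly.roots.toFinset.finite_toSet).subset fun t ht => ?_
    have h : (Matrix.scalar (Fin n) t + D).det = 0 := ht
    simp [Matrix.charpoly_monic _ |>.ne_zero, Matrix.eval_charpoly, sub_neg_eq_add]
    simpa using h
  have hc1 : Continuous fun t : ℂ => (border a b c (Matrix.scalar (Fin n) t + D)).det := by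
    refine Continuous.matrix_det (continuous_matrix fun i j => ?_)
    refine Fin.cases ?_ (fun i => ?_) i <;> refine Fin.cases ?_ (fun j => ?_) j <;>
      simp [Matrix.diagonal_apply] <;> try fun_prop
    split_ifs <;> fun_prop
  have hs : Continuous fun t : ℂ => Matrix.scalar (Fin n) t + D := by
    refine continuous_matrix fun i j => ?_
    simp [Matrix.diagonal_apply]
    split_ifs <;> fun_prop
  have hc2 : Continuous fun t : ℂ => a * (Matrix.scalar (Fin n) t + D).det
      - b ⬝ᵥ ((Matrix.scalar (Fin n) t + D).adjugate *ᵥ c) := by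
    have := hs.matrix_adjugate
    have := hs.matrix_det
    fun_prop
  have heq := hc1.ext_on (hfin.countable.dense_compl ℂ) hc2 fun t ht => by
    have hu : IsUnit (Matrix.scalar (Fin n) t + D).det := isUnit_iff_ne_zero.2 ht
    simp only
    rw [det_border_of_isUnit _ _ _ _ hu, sub_mul, Matrix.inv_def, Ring.inverse_eq_inv',
      Matrix.smul_mulVec, dotProduct_smul, smul_eq_mul]
    have h0 := isUnit_iff_ne_zero.1 hu
    field_simp
  simpa using congrFun heq 0

/-- The bordered matrix `[[1, -b], [l, N]]` is eliminated in two ways: through `N`, and through the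
corner entry `1`. -/
theorem det_add_vecMulVec_of_isUnit [CommRing R] (N : Matrix (Fin n) (Fin n) R)
    (hN : IsUnit N.det) (l b : Fin n → R) :
    (N + vecMulVec l b).det = N.det * (1 + b ⬝ᵥ (N⁻¹ *ᵥ l)) := by
  have h1 := det_border_of_isUnit 1 (-b) l N hN
  have h2 : border 1 (-b) l N = border 1 0 l 1 * border 1 (-b) 0 (N + vecMulVec l b) := by
    rw [border_mul]
    simp [vecMulVec_neg, add_comm]
  rw [h2, Matrix.det_mul, det_border_zero_right, det_border_zero_left] at h1
  simp only [det_one, one_mul, mul_one, neg_dotProduct, sub_neg_eq_add] at h1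
  rw [h1, mul_comm]

theorem charpoly_eval_border (a : ℂ) (b c : Fin n → ℂ) (D : Matrix (Fin n) (Fin n) ℂ) (z : ℂ)
    (hz : (Matrix.scalar (Fin n) z - D).det ≠ 0) :
    (border a b c D).charpoly.eval z
      = (z - b ⬝ᵥ ((Matrix.scalar (Fin n) z - D)⁻¹ *ᵥ c) - a) * D.charpoly.eval z := by
  rw [Matrix.eval_charpoly, scalar_border, border_sub,
    det_border_of_isUnit _ _ _ _ (isUnit_iff_ne_zero.2 hz), Matrix.eval_charpoly]
  simp [Matrix.mulVec_neg]
  ring_nf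
  tauto

theorem charpoly_border_zero_left (a : ℂ) (b : Fin n → ℂ) (D : Matrix (Fin n) (Fin n) ℂ) :
    (border a b 0 D).charpoly = (X - C a) * D.charpoly := by
  refine Polynomial.funext fun z => ?_
  rw [Matrix.eval_charpoly, scalar_border, border_sub, sub_zero, det_border_zero_left,
    eval_mul, Matrix.eval_charpoly]
  simp

end Border

/-! ### Measurability and integration in block coordinates. -/

theorem continuous_border {α : Type*} [TopologicalSpace α] {n : ℕ} {a : α → ℂ} {b c : α → Fin n → ℂ}
    {D : α → Matrix (Fin n) (Fin n) ℂ} (ha : Continuous a) (hb : Continuous b) (hc : Continuous c)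
    (hD : Continuous D) : Continuous fun x => border (a x) (b x) (c x) (D x) := by
  refine continuous_matrix fun i j => ?_
  refine Fin.cases ?_ (fun i => ?_) i <;> refine Fin.cases ?_ (fun j => ?_) j
  · exact ha
  · exact (continuous_apply j).comp hb
  · exact (continuous_apply i).comp hc
  · exact hD.matrix_elem i j

theorem measurable_border {α : Type*} [MeasurableSpace α] {n : ℕ} {a : α → ℂ} {b c : α → Fin n → ℂ}
    {D : α → Matrix (Fin n) (Fin n) ℂ} (ha : Measurable a) (hb : Measurable b) (hc : Measurable c)
    (hD : Measurable D) : Measurable fun x => border (a x) (b x) (c x) (D x) := by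
  refine measurable_pi_iff.2 fun i => measurable_pi_iff.2 fun j => ?_
  refine Fin.cases ?_ (fun i => ?_) i <;> refine Fin.cases ?_ (fun j => ?_) j
  · exact ha
  · exact (measurable_pi_apply j).comp hb
  · exact (measurable_pi_apply i).comp hc
  · exact (measurable_pi_apply j).comp ((measurable_pi_apply i).comp hD)

theorem measurable_matrix_inv {n : ℕ} :
    Measurable fun M : Matrix (Fin n) (Fin n) ℂ => M⁻¹ := by
  have h1 : Measurable fun M : Matrix (Fin n) (Fin n) ℂ => M.det := by
    apply Continuous.measurable; fun_prop
  have h2 : Measurable fun M : Matrix (Fin n) (Fin n) ℂ => M.adjugate :=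
    continuous_id.matrix_adjugate.measurable
  refine measurable_pi_iff.2 fun i => measurable_pi_iff.2 fun j => ?_
  simp only [Matrix.inv_def, Ring.inverse_eq_inv', Matrix.smul_apply, smul_eq_mul]
  exact h1.inv.mul ((measurable_pi_apply j).comp ((measurable_pi_apply i).comp h2))

theorem lintegral_fin_cons {E : Type*} [MeasureSpace E] [SigmaFinite (volume : Measure E)] {n : ℕ}
    {f : (Fin (n + 1) → E) → ℝ≥0∞} (hf : Measurable f) :
    ∫⁻ x, f x = ∫⁻ p : E × (Fin n → E), f (Fin.cons p.1 p.2) := by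
  have h := (volume_preserving_piFinSuccAbove (fun _ : Fin (n + 1) => E) 0).symm
  rw [← h.lintegral_comp hf]
  refine lintegral_congr fun p => ?_
  congr 1
  simp [MeasurableEquiv.piFinSuccAbove]
  rfl

theorem measurePreserving_columns (n : ℕ) :
    MeasurePreserving (fun (p : (Fin n → ℂ) × (Fin n → Fin n → ℂ)) (i : Fin n) =>
      (Fin.cons (p.1 i) (p.2 i) : Fin (n + 1) → ℂ)) := by
  have h1 := (volume_measurePreserving_arrowProdEquivProdArrow ℂ (Fin n → ℂ) (Fin n)).symm
  have h2 := volume_preserving_pi (fun _ : Fin n =>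
    (volume_preserving_piFinSuccAbove (fun _ : Fin (n + 1) => ℂ) 0).symm)
  have h3 := h2.comp h1
  convert h3 using 1
  funext p i
  simp [MeasurableEquiv.piFinSuccAbove, MeasurableEquiv.arrowProdEquivProdArrow,
    Equiv.arrowProdEquivProdArrow]
  rfl

/-- The corner entry is innermost because the eigenvalue substitution acts on it with the other
blocks frozen. -/
theorem lintegral_border {n : ℕ} {f : Matrix (Fin (n + 1)) (Fin (n + 1)) ℂ → ℝ≥0∞}
    (hf : Measurable f) :
    ∫⁻ M, f M = ∫⁻ w : ((Fin n → ℂ) × Matrix (Fin n) (Fin n) ℂ) × (Fin n → ℂ), ∫⁻ a : ℂ,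
      f (border a w.2 w.1.1 w.1.2) := by
  have hb : ∀ {α : Type} [MeasurableSpace α] {a : α → ℂ} {b c : α → Fin n → ℂ}
    {D : α → Matrix (Fin n) (Fin n) ℂ}, Measurable a → Measurable b → Measurable c →
    Measurable D → Measurable fun x => f (border (a x) (b x) (c x) (D x)) :=
    fun ha hb hc hD => hf.comp (measurable_border ha hb hc hD)
  calc ∫⁻ M, f M
      = ∫⁻ p : (Fin (n + 1) → ℂ) × (Fin n → Fin (n + 1) → ℂ), f (Fin.cons p.1 p.2) :=
        lintegral_fin_cons (E := Fin (n + 1) → ℂ) hf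
    _ = ∫⁻ y : Fin n → Fin (n + 1) → ℂ, ∫⁻ x : Fin (n + 1) → ℂ, f (Fin.cons x y) := by
        refine lintegral_prod_symm' (μ := (volume : Measure (Fin (n + 1) → ℂ)))
          (ν := (volume : Measure (Fin n → Fin (n + 1) → ℂ))) _ ?_
        exact hf.comp (measurable_pi_iff.2 fun i => Fin.cases measurable_fst
          (fun i => (measurable_pi_apply i).comp measurable_snd) i)
    _ = ∫⁻ p : (Fin n → ℂ) × Matrix (Fin n) (Fin n) ℂ, ∫⁻ x : Fin (n + 1) → ℂ,
          f (Fin.cons x fun i => Fin.cons (p.1 i) (p.2 i)) := by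
        refine ((measurePreserving_columns n).lintegral_comp ?_).symm
        refine Measurable.lintegral_prod_right' (f := fun p : (Fin n → Fin (n + 1) → ℂ) ×
          (Fin (n + 1) → ℂ) => f (Fin.cons p.2 p.1)) ?_
        exact hf.comp (measurable_pi_iff.2 fun i => Fin.cases measurable_snd
          (fun i => (measurable_pi_apply i).comp measurable_fst) i)
    _ = ∫⁻ p : (Fin n → ℂ) × Matrix (Fin n) (Fin n) ℂ, ∫⁻ q : ℂ × (Fin n → ℂ),
          f (border q.1 q.2 p.1 p.2) := by
        refine lintegral_congr fun p => lintegral_fin_cons ?_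
        exact hf.comp (measurable_pi_iff.2 fun i => Fin.cases measurable_id
          (fun i => measurable_const) i)
    _ = ∫⁻ p : (Fin n → ℂ) × Matrix (Fin n) (Fin n) ℂ, ∫⁻ b : Fin n → ℂ, ∫⁻ a : ℂ,
          f (border a b p.1 p.2) := by
        refine lintegral_congr fun p => ?_
        exact lintegral_prod_symm' (μ := (volume : Measure ℂ))
          (ν := (volume : Measure (Fin n → ℂ))) _
          (hb measurable_fst measurable_snd measurable_const measurable_const)
    _ = _ := by
        refine (lintegral_prod (μ := (volume : Measure ((Fin n → ℂ) × Matrix (Fin n) (Fin n) ℂ)))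
          (ν := (volume : Measure (Fin n → ℂ)))
          (fun w => ∫⁻ a : ℂ, f (border a w.2 w.1.1 w.1.2)) ?_).symm
        refine (Measurable.lintegral_prod_right' (f := fun p : (((Fin n → ℂ) ×
          Matrix (Fin n) (Fin n) ℂ) × (Fin n → ℂ)) × ℂ =>
            f (border p.2 p.1.2 p.1.1.1 p.1.1.2)) ?_).aemeasurable
        exact hb measurable_snd (by fun_prop) (by fun_prop) (by fun_prop)

/-! ### Generic matrices: invertibility and absence of eigenvalues shared with the minor. -/

section Generic

open Matrix

/-- The line `t ↦ A + t Y` of matrices, as a matrix of polynomials. -/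
def matrixLine {n : ℕ} (A Y : Matrix (Fin n) (Fin n) ℂ) : Matrix (Fin n) (Fin n) ℂ[X] :=
  Matrix.of fun i j => C (A i j) + X * C (Y i j)

theorem matrixLine_map_eval {n : ℕ} (A Y : Matrix (Fin n) (Fin n) ℂ) (t : ℂ) :
    (matrixLine A Y).map (evalRingHom t) = A + t • Y := by
  ext i j
  simp [matrixLine]
  ring

theorem countable_real_roots {r : ℂ[X]} (hr : r ≠ 0) : {t : ℝ | r.eval (t : ℂ) = 0}.Countable := by
  have : {t : ℝ | r.eval (t : ℂ) = 0} = (fun t : ℝ => (t : ℂ)) ⁻¹' (r.roots.toFinset : Set ℂ) := by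
    ext t
    simp [hr]
  rw [this]
  exact (r.roots.toFinset.finite_toSet.preimage Complex.ofReal_injective.injOn).countable

/-- On every ray from the identity the determinant is a polynomial in `t` with value `1` at `t = 0`,
so it has finitely many zeros there. -/
theorem ae_det_ne_zero {n : ℕ} : ∀ᵐ A : Matrix (Fin n) (Fin n) ℂ, A.det ≠ 0 := by
  have hm : MeasurableSet {A : Matrix (Fin n) (Fin n) ℂ | A.det = 0} :=
    (show Continuous fun A : Matrix (Fin n) (Fin n) ℂ => A.det by fun_prop).measurable
      (measurableSet_singleton 0)
  have := volume_eq_zero_of_countable_rays (volume : Measure (Fin n → Fin n → ℂ)) hm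
    (1 : Matrix (Fin n) (Fin n) ℂ) fun y => by
      let Y : Matrix (Fin n) (Fin n) ℂ := y
      have hev : ∀ t : ℂ, (matrixLine 1 Y).det.eval t = (1 + t • Y).det := fun t => by
        rw [← matrixLine_map_eval, ← coe_evalRingHom, RingHom.map_det]
        rfl
      have h0 : (matrixLine 1 Y).det ≠ 0 := fun h => by
        have := hev 0
        rw [h] at this
        simp at this
      refine (countable_real_roots h0).mono fun t ht => ?_
      change (matrixLine 1 Y).det.eval (t : ℂ) = 0
      rw [hev]
      exact ht
  exact measure_eq_zero_iff_ae_notMem.1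
    (show (volume : Measure (Matrix (Fin n) (Fin n) ℂ)) {A | A.det = 0} = 0 from this)

theorem resultant_charpoly_eq_zero_iff {n : ℕ} (M : Matrix (Fin (n + 1)) (Fin (n + 1)) ℂ)
    (D : Matrix (Fin n) (Fin n) ℂ) :
    resultant M.charpoly D.charpoly (n + 1) n = 0 ↔
      ∃ z, D.charpoly.eval z = 0 ∧ M.charpoly.eval z = 0 := by
  have h1 : M.charpoly.natDegree = n + 1 := by simp
  have h2 : D.charpoly.natDegree = n := by simp
  have h := resultant_eq_zero_iff (f := M.charpoly) (g := D.charpoly)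
  rw [h1, h2] at h
  rw [h]
  constructor
  · rintro ⟨-, hc⟩
    by_contra! hz
    refine hc (isCoprime_of_dvd _ _ ?_ ?_)
    · exact fun hh => M.charpoly_monic.ne_zero hh.1
    · intro p hp _ hpM hpD
      obtain ⟨z, hz'⟩ := IsAlgClosed.exists_root p (fun hd => hp (isUnit_iff_degree_eq_zero.2 hd))
      exact hz z (eval_eq_zero_of_dvd_of_eval_eq_zero hpD hz')
        (eval_eq_zero_of_dvd_of_eval_eq_zero hpM hz')
  · rintro ⟨z, hzD, hzM⟩
    refine ⟨Or.inl M.charpoly_monic.ne_zero, fun ⟨a, b, hab⟩ => ?_⟩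
    have := congrArg (eval z) hab
    simp [hzD, hzM] at this

/-- The cyclic permutation matrix works: deleting the first row and column leaves a strictly upper
triangular matrix, whose only possible eigenvalue is `0`, while the permutation matrix is
invertible. -/
theorem exists_no_common_eigenvalue (n : ℕ) : ∃ M : Matrix (Fin (n + 1)) (Fin (n + 1)) ℂ,
    ∀ z, (M.submatrix Fin.succ Fin.succ).charpoly.eval z = 0 → M.charpoly.eval z ≠ 0 := by
  refine ⟨(finRotate (n + 1)).permMatrix ℂ, fun z hz => ?_⟩
  have hperm : ∀ i j, (finRotate (n + 1)).permMatrix ℂ i j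
      = if finRotate (n + 1) i = j then 1 else 0 := fun i j => by
    simp [Equiv.Perm.permMatrix, PEquiv.toMatrix_apply, Equiv.toPEquiv_apply, eq_comm]
  have hu : ((((finRotate (n + 1)).permMatrix ℂ).submatrix Fin.succ Fin.succ)).BlockTriangular id := by
    intro i j hij
    have hij' : j < i := hij
    rw [submatrix_apply, hperm, if_neg]
    intro h
    have h' := congrArg Fin.val h
    rw [coe_finRotate] at h'
    split_ifs at h'
    · simp at h'
    · simp at h'
      have : (j : ℕ) < i := hij'
      omega
  have hd : ∀ i : Fin n, ((finRotate (n + 1)).permMatrix ℂ).submatrix Fin.succ Fin.succ i i = 0 := by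
    intro i
    rw [submatrix_apply, hperm, if_neg]
    intro h
    have h' := congrArg Fin.val h
    rw [coe_finRotate] at h'
    split_ifs at h' <;> simp at h'
  have hc : (((finRotate (n + 1)).permMatrix ℂ).submatrix Fin.succ Fin.succ).charpoly = X ^ n := by
    rw [charpoly_of_isUpperTriangular _ hu]
    simp only [hd]
    simp
  rw [hc, eval_pow, eval_X] at hz
  have hz0 : z = 0 := eq_zero_of_pow_eq_zero hz
  rw [hz0, eval_charpoly, map_zero, zero_sub, det_neg, det_permutation]
  rcases Int.units_eq_one_or (Equiv.Perm.sign (finRotate (n + 1))) with h | h <;> rw [h] <;> simp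

/-- A shared eigenvalue means that the resultant of the two characteristic polynomials vanishes. On
a ray from a matrix without shared eigenvalues this resultant is a nonzero polynomial in `t`. -/
theorem ae_no_common_eigenvalue (n : ℕ) : ∀ᵐ M : Matrix (Fin (n + 1)) (Fin (n + 1)) ℂ,
    ∀ z, (M.submatrix Fin.succ Fin.succ).charpoly.eval z = 0 → M.charpoly.eval z ≠ 0 := by
  have hsub : Continuous fun M : Matrix (Fin (n + 1)) (Fin (n + 1)) ℂ =>
      M.submatrix (Fin.succ : Fin n → _) (Fin.succ : Fin n → _) :=
    continuous_id.matrix_submatrix _ _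
  obtain ⟨R, hR, hRr⟩ := exists_measurable_roots (n := n)
    (p := fun M : Matrix (Fin (n + 1)) (Fin (n + 1)) ℂ =>
      (M.submatrix (Fin.succ : Fin n → _) (Fin.succ : Fin n → _)).charpoly)
    (fun M => charpoly_monic _) (fun M => by simp) (fun z => by
      simp only [eval_charpoly]
      exact (continuous_const.sub hsub).matrix_det.measurable)
  -- The exceptional set is written through the measurable list `R` of eigenvalues of the minor,
  -- which makes its measurability evident.
  let Z : Set (Matrix (Fin (n + 1)) (Fin (n + 1)) ℂ) :=
    {M | ∏ i, (Matrix.scalar (Fin (n + 1)) (R M i) - M).det = 0}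
  have hsc : Continuous fun z : ℂ => Matrix.scalar (Fin (n + 1)) z := by
    refine continuous_matrix fun i j => ?_
    simp only [Matrix.scalar_apply, Matrix.diagonal_apply]
    split_ifs <;> fun_prop
  have hZm : MeasurableSet Z := by
    refine Measurable.comp ?_ (Finset.measurable_prod _ fun i _ => ?_) (measurableSet_singleton 0)
      (f := fun M => ∏ i, (Matrix.scalar (Fin (n + 1)) (R M i) - M).det) (g := id)
    · exact measurable_id
    · have hc : Continuous fun p : ℂ × Matrix (Fin (n + 1)) (Fin (n + 1)) ℂ =>
          (Matrix.scalar (Fin (n + 1)) p.1 - p.2).det :=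
        ((hsc.comp continuous_fst).sub continuous_snd).matrix_det
      exact hc.measurable.comp (((measurable_pi_apply i).comp hR).prodMk measurable_id)
  have hmem : ∀ z M, (M.submatrix (Fin.succ : Fin n → _) (Fin.succ : Fin n → _)).charpoly.eval z = 0
      ↔ ∃ i, R M i = z := by
    intro z M
    have := hRr M
    have h2 : z ∈ (M.submatrix (Fin.succ : Fin n → _) (Fin.succ : Fin n → _)).charpoly.roots ↔
        ∃ i, R M i = z := by rw [← this]; simp
    rw [← h2, mem_roots (charpoly_monic _).ne_zero, IsRoot]
  have hZ : ∀ M, M ∈ Z ↔ ∃ z, (M.submatrix (Fin.succ : Fin n → _)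
      (Fin.succ : Fin n → _)).charpoly.eval z = 0 ∧ M.charpoly.eval z = 0 := by
    intro M
    change ∏ i, (Matrix.scalar (Fin (n + 1)) (R M i) - M).det = 0 ↔ _
    simp only [Finset.prod_eq_zero_iff, Finset.mem_univ, true_and]
    constructor
    · rintro ⟨i, hi⟩
      exact ⟨R M i, (hmem _ _).2 ⟨i, rfl⟩, by rwa [eval_charpoly]⟩
    · rintro ⟨z, h1, h2⟩
      obtain ⟨i, rfl⟩ := (hmem _ _).1 h1
      exact ⟨i, by rwa [eval_charpoly] at h2⟩
  obtain ⟨M₀, hM₀⟩ := exists_no_common_eigenvalue n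
  have := volume_eq_zero_of_countable_rays (volume : Measure (Fin (n + 1) → Fin (n + 1) → ℂ)) hZm
    M₀ fun y => by
      let Y : Matrix (Fin (n + 1)) (Fin (n + 1)) ℂ := y
      let r : ℂ[X] := resultant (matrixLine M₀ Y).charpoly
        ((matrixLine M₀ Y).submatrix (Fin.succ : Fin n → _) (Fin.succ : Fin n → _)).charpoly (n + 1) n
      have hev : ∀ t : ℂ, r.eval t = resultant (M₀ + t • Y).charpoly
          ((M₀ + t • Y).submatrix (Fin.succ : Fin n → _) (Fin.succ : Fin n → _)).charpoly
          (n + 1) n := fun t => by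
        have hs : ((matrixLine M₀ Y).map (evalRingHom t)).submatrix (Fin.succ : Fin n → _)
            (Fin.succ : Fin n → _) = ((matrixLine M₀ Y).submatrix (Fin.succ : Fin n → _)
            (Fin.succ : Fin n → _)).map (evalRingHom t) := rfl
        rw [← matrixLine_map_eval, hs, charpoly_map, charpoly_map, resultant_map_map]
        rfl
      have h0 : r ≠ 0 := fun h => by
        have := hev 0
        rw [h, eval_zero, zero_smul, add_zero, eq_comm, resultant_charpoly_eq_zero_iff] at this
        obtain ⟨z, h1, h2⟩ := this
        exact hM₀ z h1 h2
      refine (countable_real_roots h0).mono fun t ht => ?_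
      change r.eval (t : ℂ) = 0
      rw [hev, resultant_charpoly_eq_zero_iff]
      exact (hZ _).1 ht
  have h2 : (volume : Measure (Matrix (Fin (n + 1)) (Fin (n + 1)) ℂ)) Z = 0 := this
  filter_upwards [measure_eq_zero_iff_ae_notMem.1 h2] with M hM z h1 h3
  exact hM ((hZ M).2 ⟨z, h1, h3⟩)

end Generic

/-! ### An eigenvalue as a function of the corner entry. -/

section Peel

open Matrix

theorem continuous_scalar {n : ℕ} : Continuous fun z : ℂ => Matrix.scalar (Fin n) z := by
  refine continuous_matrix fun i j => ?_
  simp only [Matrix.scalar_apply, Matrix.diagonal_apply]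
  split_ifs <;> fun_prop

/-- The diagonal entry `a` for which `z` is an eigenvalue of `[[a, b], [c, D]]`. -/
def schurEntry {n : ℕ} (b c : Fin n → ℂ) (D : Matrix (Fin n) (Fin n) ℂ) (z : ℂ) : ℂ :=
  z - b ⬝ᵥ ((Matrix.scalar (Fin n) z - D)⁻¹ *ᵥ c)

/-- The derivative of `schurEntry` in `z`. -/
def schurEntryDeriv {n : ℕ} (b c : Fin n → ℂ) (D : Matrix (Fin n) (Fin n) ℂ) (z : ℂ) : ℂ :=
  1 + b ⬝ᵥ ((Matrix.scalar (Fin n) z - D)⁻¹ *ᵥ ((Matrix.scalar (Fin n) z - D)⁻¹ *ᵥ c))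

variable {n : ℕ}

theorem hasDerivAt_schurEntry (b c : Fin n → ℂ) (D : Matrix (Fin n) (Fin n) ℂ) {z : ℂ}
    (hz : (Matrix.scalar (Fin n) z - D).det ≠ 0) :
    HasDerivAt (schurEntry b c D) (schurEntryDeriv b c D z) z := by
  have hcN : Continuous fun w : ℂ => Matrix.scalar (Fin n) w - D :=
    continuous_scalar.sub continuous_const
  have hev : ∀ᶠ w in nhds z, (Matrix.scalar (Fin n) w - D).det ≠ 0 :=
    hcN.matrix_det.continuousAt.eventually_ne hz
  have hci : ContinuousAt (fun w : ℂ => (Matrix.scalar (Fin n) w - D)⁻¹) z := by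
    have h1 : ContinuousAt (fun A : Matrix (Fin n) (Fin n) ℂ => A⁻¹)
        (Matrix.scalar (Fin n) z - D) := by
      apply continuousAt_matrix_inv
      rw [Ring.inverse_eq_inv']
      exact continuousAt_inv₀ hz
    exact ContinuousAt.comp (f := fun w : ℂ => Matrix.scalar (Fin n) w - D) h1 hcN.continuousAt
  rw [hasDerivAt_iff_tendsto_slope]
  have hlim : Filter.Tendsto (fun w => 1 + b ⬝ᵥ ((Matrix.scalar (Fin n) w - D)⁻¹ *ᵥ
      ((Matrix.scalar (Fin n) z - D)⁻¹ *ᵥ c))) (nhdsWithin z {z}ᶜ)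
      (nhds (schurEntryDeriv b c D z)) := by
    have h2 : Continuous fun A : Matrix (Fin n) (Fin n) ℂ => 1 + b ⬝ᵥ (A *ᵥ
      ((Matrix.scalar (Fin n) z - D)⁻¹ *ᵥ c)) := by fun_prop
    exact (h2.continuousAt.comp hci).tendsto.mono_left nhdsWithin_le_nhds
  refine hlim.congr' ?_
  filter_upwards [self_mem_nhdsWithin, nhdsWithin_le_nhds hev] with w hwz hw
  have hwz' : w - z ≠ 0 := sub_ne_zero.2 hwz
  set A := Matrix.scalar (Fin n) w - D with hA
  set B := Matrix.scalar (Fin n) z - D with hB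
  -- The resolvent identity gives the difference quotient in closed form, so only continuity of the
  -- inverse is needed in the limit.
  have hAB : A⁻¹ - B⁻¹ = -(w - z) • (A⁻¹ * B⁻¹) := by
    have h1 : A - B = (w - z) • (1 : Matrix (Fin n) (Fin n) ℂ) := by
      rw [hA, hB, sub_sub_sub_cancel_right, ← map_sub, Matrix.scalar_apply, Matrix.smul_one_eq_diagonal]
    have h2 : A⁻¹ * (A - B) * B⁻¹ = B⁻¹ - A⁻¹ := by
      rw [Matrix.mul_sub, Matrix.sub_mul, Matrix.nonsing_inv_mul _ (isUnit_iff_ne_zero.2 hw),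
        Matrix.mul_assoc, Matrix.mul_nonsing_inv _ (isUnit_iff_ne_zero.2 hz)]
      simp
    rw [h1] at h2
    simp only [Matrix.mul_smul, Matrix.smul_mul, Matrix.mul_one] at h2
    rw [neg_smul, h2]
    abel
  have h3 : schurEntry b c D w - schurEntry b c D z
      = (w - z) * (1 + b ⬝ᵥ (A⁻¹ *ᵥ (B⁻¹ *ᵥ c))) := by
    have : b ⬝ᵥ (A⁻¹ *ᵥ c) - b ⬝ᵥ (B⁻¹ *ᵥ c) = -(w - z) * (b ⬝ᵥ (A⁻¹ *ᵥ (B⁻¹ *ᵥ c))) := by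
      rw [← dotProduct_sub, ← Matrix.sub_mulVec, hAB, Matrix.smul_mulVec, dotProduct_smul,
        smul_eq_mul, Matrix.mulVec_mulVec]
    simp only [schurEntry]
    linear_combination -this
  rw [slope_def_field, h3]
  field_simp

/-- For generic `b`, `c`, `D`, integrating over the entry `a` of `[[a, b], [c, D]]` is the same as
integrating over its eigenvalues. -/
theorem lintegral_schurEntry {b c : Fin n → ℂ} {D : Matrix (Fin n) (Fin n) ℂ}
    (hgen : ∀ᵐ a : ℂ, ∀ z, D.charpoly.eval z = 0 → (border a b c D).charpoly.eval z ≠ 0)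
    {Ψ : Matrix (Fin (n + 1)) (Fin (n + 1)) ℂ → ℝ≥0∞} (hΨ : Measurable Ψ) :
    ∫⁻ a : ℂ, ((n + 1 : ℕ) : ℝ≥0∞) * Ψ (border a b c D)
      = ∫⁻ z in {z | (Matrix.scalar (Fin n) z - D).det ≠ 0},
        ENNReal.ofReal (‖schurEntryDeriv b c D z‖ ^ 2) * Ψ (border (schurEntry b c D z) b c D) := by
  have hcN : Continuous fun w : ℂ => Matrix.scalar (Fin n) w - D :=
    continuous_scalar.sub continuous_const
  have hU : MeasurableSet {z | (Matrix.scalar (Fin n) z - D).det ≠ 0} :=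
    (hcN.matrix_det.measurable (measurableSet_singleton 0)).compl
  have hq : ∀ z ∈ {z | (Matrix.scalar (Fin n) z - D).det ≠ 0},
    HasDerivAt (schurEntry b c D) (schurEntryDeriv b c D z) z := fun z hz =>
      hasDerivAt_schurEntry b c D hz
  have hq' : Measurable (schurEntryDeriv b c D) := by
    have h1 : Continuous fun A : Matrix (Fin n) (Fin n) ℂ => 1 + b ⬝ᵥ (A *ᵥ (A *ᵥ c)) := by fun_prop
    exact h1.measurable.comp (measurable_matrix_inv.comp hcN.measurable)
  let F : ℂ → Finset ℂ := fun a => (border a b c D).charpoly.roots.toFinset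
  -- For generic `a` no eigenvalue of the bordered matrix lies in the spectrum of `D`, so the fibre
  -- of `schurEntry` over `a` is exactly the set of eigenvalues.
  have hF : ∀ᵐ a : ℂ, ∀ z, z ∈ F a ↔
      z ∈ {z | (Matrix.scalar (Fin n) z - D).det ≠ 0} ∧ schurEntry b c D z = a := by
    filter_upwards [hgen] with a ha z
    have hmem : z ∈ F a ↔ (border a b c D).charpoly.eval z = 0 := by
      rw [Multiset.mem_toFinset, mem_roots (charpoly_monic _).ne_zero, IsRoot]
    rw [hmem]
    have hcase : D.charpoly.eval z = (Matrix.scalar (Fin n) z - D).det := eval_charpoly _ _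
    constructor
    · intro h
      have hz : (Matrix.scalar (Fin n) z - D).det ≠ 0 := fun h0 => ha z (hcase.trans h0) h
      refine ⟨hz, ?_⟩
      rw [charpoly_eval_border a b c D z hz, hcase] at h
      exact sub_eq_zero.1 ((mul_eq_zero.1 h).resolve_right hz)
    · rintro ⟨hz, h⟩
      rw [charpoly_eval_border a b c D z hz]
      simp only [schurEntry] at h
      rw [h, sub_self, zero_mul]
  have key := lintegral_sum_fiber hU hq hq' hF (h := fun a _ => Ψ (border a b c D)) (by
    exact hΨ.comp (measurable_border measurable_fst measurable_const measurable_const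
      measurable_const))
  rw [← key]
  refine lintegral_congr_ae ?_
  filter_upwards [hF, ae_regular_value hq] with a ha hreg
  rw [Finset.sum_const, nsmul_eq_mul]
  congr 2
  -- At a double root the derivative of `(schurEntry - a) χ_D`, with `χ_D` the characteristic
  -- polynomial of `D`, would vanish. Then `a` would be a critical value of `schurEntry`, which Sard
  -- excludes for almost every `a`. So the fibre has exactly `n + 1` points.
  have hnodup : (border a b c D).charpoly.roots.Nodup := by
    rw [Multiset.nodup_iff_count_le_one]
    intro z
    rw [count_roots]
    by_contra! hlt
    rw [one_lt_rootMultiplicity_iff_isRoot (charpoly_monic _).ne_zero] at hlt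
    obtain ⟨hroot, hder⟩ := hlt
    obtain ⟨hz, hqa⟩ := (ha z).1 (by
      rw [Multiset.mem_toFinset, mem_roots (charpoly_monic _).ne_zero]; exact hroot)
    have h1 : HasDerivAt (fun w => (schurEntry b c D w - a) * D.charpoly.eval w)
        (schurEntryDeriv b c D z * D.charpoly.eval z +
          (schurEntry b c D z - a) * D.charpoly.derivative.eval z) z :=
      ((hq z hz).sub_const a).mul (D.charpoly.hasDerivAt z)
    have h2 : HasDerivAt (fun w => (border a b c D).charpoly.eval w)
        ((border a b c D).charpoly.derivative.eval z) z := (border a b c D).charpoly.hasDerivAt z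
    have hev : (fun w => (schurEntry b c D w - a) * D.charpoly.eval w) =ᶠ[nhds z]
        fun w => (border a b c D).charpoly.eval w := by
      filter_upwards [hcN.matrix_det.continuousAt.eventually_ne hz] with w hw
      exact (charpoly_eval_border a b c D w hw).symm
    have h3 := h1.unique (h2.congr_of_eventuallyEq hev)
    rw [hder.eq_zero, hqa, sub_self, zero_mul, add_zero] at h3
    rcases mul_eq_zero.1 h3 with h4 | h4
    · exact hreg z hz hqa h4
    · exact hz (by rw [← eval_charpoly]; exact h4)
  have hcard : (border a b c D).charpoly.roots.card = n + 1 := by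
    rw [splits_iff_card_roots.1 (IsAlgClosed.splits _), charpoly_natDegree_eq_dim, Fintype.card_fin]
  rw [Multiset.toFinset_card_of_nodup hnodup, hcard]

end Peel

/-! ### Coordinates given by an eigenvalue, its eigenvector and the quotient matrix. -/

section Peel

open Matrix

variable {n : ℕ}

theorem ae_ae_border {p : Matrix (Fin (n + 1)) (Fin (n + 1)) ℂ → Prop} (hp : ∀ᵐ M, p M) :
    ∀ᵐ w : ((Fin n → ℂ) × Matrix (Fin n) (Fin n) ℂ) × (Fin n → ℂ), ∀ᵐ a : ℂ,
      p (border a w.2 w.1.1 w.1.2) := by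
  let N := toMeasurable volume {M | ¬ p M}
  have hN : volume N = 0 := by rw [measure_toMeasurable]; exact hp
  have hNm : MeasurableSet N := measurableSet_toMeasurable _ _
  have hf : Measurable (N.indicator fun _ => (1 : ℝ≥0∞)) := measurable_const.indicator hNm
  have h := lintegral_border hf
  rw [lintegral_indicator_const hNm, hN, mul_zero, eq_comm, lintegral_eq_zero_iff] at h
  · filter_upwards [h] with w hw
    rw [Pi.zero_apply, lintegral_eq_zero_iff] at hw
    · filter_upwards [hw] with a ha
      by_contra hpa
      have : border a w.2 w.1.1 w.1.2 ∈ N := subset_toMeasurable _ _ hpa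
      simp [this] at ha
    · exact hf.comp (measurable_border measurable_id measurable_const measurable_const
        measurable_const)
  · exact Measurable.lintegral_prod_right' (f := fun p : (((Fin n → ℂ) ×
      Matrix (Fin n) (Fin n) ℂ) × (Fin n → ℂ)) × ℂ =>
        N.indicator (fun _ => (1 : ℝ≥0∞)) (border p.2 p.1.2 p.1.1.1 p.1.1.2))
      (hf.comp (measurable_border (by fun_prop) (by fun_prop) (by fun_prop) (by fun_prop)))

/-- The unipotent matrix carries the first basis vector, an eigenvector of the block triangular
matrix for `z`, to `(1, l)`. The right side is the Schur parametrization with `b = u`, `D = M + l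
uᵀ` and `c = (z - D) l`. -/
theorem unipotent_conj_border (z : ℂ) (l u : Fin n → ℂ) (M : Matrix (Fin n) (Fin n) ℂ) :
    border 1 0 l 1 * border z u 0 M * border 1 0 (-l) 1
      = border (z - u ⬝ᵥ l) u ((Matrix.scalar (Fin n) z - (M + vecMulVec l u)) *ᵥ l)
        (M + vecMulVec l u) := by
  rw [border_mul, border_mul]
  have h1 : vecMulVec (z • l + M *ᵥ (0 : Fin n → ℂ)) (0 : Fin n → ℂ) = 0 := by
    ext; simp [vecMulVec]
  congr 1
  · simp [sub_eq_add_neg]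
  · simp
  · have : (Matrix.scalar (Fin n) z) *ᵥ l = z • l := by
      rw [Matrix.scalar_apply, ← Matrix.smul_one_eq_diagonal, Matrix.smul_mulVec, Matrix.one_mulVec]
    rw [Matrix.sub_mulVec, this]
    simp [Matrix.mulVec_neg, sub_eq_add_neg, add_comm]
  · simp [add_comm]

/-- The integrand of `lintegral_schurEntry` after the substitution `c = (z - D) l`. -/
theorem lintegral_schurEntry_substitution (z : ℂ) (b : Fin n → ℂ) (D : Matrix (Fin n) (Fin n) ℂ)
    (hz : (Matrix.scalar (Fin n) z - D).det ≠ 0)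
    {Ψ : Matrix (Fin (n + 1)) (Fin (n + 1)) ℂ → ℝ≥0∞} (hΨ : Measurable Ψ) :
    ∫⁻ c : Fin n → ℂ, ENNReal.ofReal (‖schurEntryDeriv b c D z‖ ^ 2) *
        Ψ (border (schurEntry b c D z) b c D)
      = ∫⁻ l : Fin n → ℂ, ENNReal.ofReal (‖(Matrix.scalar (Fin n) z - D + vecMulVec l b).det‖ ^ 2) *
        Ψ (border (z - b ⬝ᵥ l) b ((Matrix.scalar (Fin n) z - D) *ᵥ l) D) := by
  have hu := isUnit_iff_ne_zero.2 hz
  have hmeas : Measurable fun c : Fin n → ℂ => ENNReal.ofReal (‖schurEntryDeriv b c D z‖ ^ 2) *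
        Ψ (border (schurEntry b c D z) b c D) := by
    refine Measurable.mul ?_ (hΨ.comp (measurable_border ?_ measurable_const measurable_id
      measurable_const))
    · unfold schurEntryDeriv
      fun_prop
    · unfold schurEntry
      fun_prop
  rw [← lintegral_comp_mulVec _ hz hmeas, ← lintegral_const_mul]
  · refine lintegral_congr fun l => ?_
    have hl : (Matrix.scalar (Fin n) z - D)⁻¹ *ᵥ ((Matrix.scalar (Fin n) z - D) *ᵥ l) = l := by
      rw [Matrix.mulVec_mulVec, Matrix.nonsing_inv_mul _ hu, Matrix.one_mulVec]
    -- The Jacobian `|det (z - D)|²` and the squared derivative `|1 + b (z - D)⁻¹ l|²` combine by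
    -- the rank-one determinant formula.
    rw [← mul_assoc, ← ENNReal.ofReal_mul (by positivity), ← mul_pow, ← norm_mul,
      schurEntryDeriv, schurEntry, hl, det_add_vecMulVec_of_isUnit _ hu]
  · exact hmeas.comp (by fun_prop)

theorem ae_det_scalar_sub_ne_zero (z : ℂ) :
    ∀ᵐ D : Matrix (Fin n) (Fin n) ℂ, (Matrix.scalar (Fin n) z - D).det ≠ 0 := by
  let g : Fin n → Fin n → ℂ := Matrix.scalar (Fin n) z
  exact (quasiMeasurePreserving_sub_left (volume : Measure (Fin n → Fin n → ℂ)) g).ae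
    (ae_det_ne_zero (n := n))

/-- The joint integrand of `lintegral_schurEntry`. -/
def schurIntegrand (Ψ : Matrix (Fin (n + 1)) (Fin (n + 1)) ℂ → ℝ≥0∞) (z : ℂ)
    (w : ((Fin n → ℂ) × Matrix (Fin n) (Fin n) ℂ) × (Fin n → ℂ)) : ℝ≥0∞ :=
  {z | (Matrix.scalar (Fin n) z - w.1.2).det ≠ 0}.indicator (fun z =>
    ENNReal.ofReal (‖schurEntryDeriv w.2 w.1.1 w.1.2 z‖ ^ 2) *
      Ψ (border (schurEntry w.2 w.1.1 w.1.2 z) w.2 w.1.1 w.1.2)) z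

theorem measurable_schurIntegrand {Ψ : Matrix (Fin (n + 1)) (Fin (n + 1)) ℂ → ℝ≥0∞}
    (hΨ : Measurable Ψ) : Measurable (Function.uncurry (schurIntegrand Ψ)) := by
  have hcN : Continuous fun p : ℂ × ((Fin n → ℂ) × Matrix (Fin n) (Fin n) ℂ) × (Fin n → ℂ) =>
      Matrix.scalar (Fin n) p.1 - p.2.1.2 :=
    (continuous_scalar.comp continuous_fst).sub (by fun_prop)
  have hset : MeasurableSet {p : ℂ × ((Fin n → ℂ) × Matrix (Fin n) (Fin n) ℂ) × (Fin n → ℂ) |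
      (Matrix.scalar (Fin n) p.1 - p.2.1.2).det ≠ 0} :=
    (hcN.matrix_det.measurable (measurableSet_singleton 0)).compl
  have hinv := measurable_matrix_inv.comp hcN.measurable
  have h1 : Continuous fun q : (ℂ × ((Fin n → ℂ) × Matrix (Fin n) (Fin n) ℂ) × (Fin n → ℂ)) ×
      Matrix (Fin n) (Fin n) ℂ => 1 + q.1.2.2 ⬝ᵥ (q.2 *ᵥ (q.2 *ᵥ q.1.2.1.1)) := by fun_prop
  have h2 : Continuous fun q : (ℂ × ((Fin n → ℂ) × Matrix (Fin n) (Fin n) ℂ) × (Fin n → ℂ)) ×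
      Matrix (Fin n) (Fin n) ℂ => q.1.1 - q.1.2.2 ⬝ᵥ (q.2 *ᵥ q.1.2.1.1) := by fun_prop
  have h3 : Measurable fun p : ℂ × ((Fin n → ℂ) × Matrix (Fin n) (Fin n) ℂ) × (Fin n → ℂ) =>
      ENNReal.ofReal (‖schurEntryDeriv p.2.2 p.2.1.1 p.2.1.2 p.1‖ ^ 2) *
        Ψ (border (schurEntry p.2.2 p.2.1.1 p.2.1.2 p.1) p.2.2 p.2.1.1 p.2.1.2) :=
    (((h1.measurable.comp (measurable_id.prodMk hinv)).norm.pow_const 2).ennreal_ofReal).mul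
      (hΨ.comp (measurable_border (h2.measurable.comp (measurable_id.prodMk hinv))
        (measurable_snd.comp measurable_snd)
        (measurable_fst.comp (measurable_fst.comp measurable_snd))
        (measurable_snd.comp (measurable_fst.comp measurable_snd))))
  exact h3.indicator hset

/-- The integrand of `lintegral_schurEntry_substitution`. -/
def eigenvectorIntegrand (Ψ : Matrix (Fin (n + 1)) (Fin (n + 1)) ℂ → ℝ≥0∞) (z : ℂ)
    (l b : Fin n → ℂ) (D : Matrix (Fin n) (Fin n) ℂ) : ℝ≥0∞ :=
  ENNReal.ofReal (‖(Matrix.scalar (Fin n) z - D + vecMulVec l b).det‖ ^ 2) *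
    Ψ (border (z - b ⬝ᵥ l) b ((Matrix.scalar (Fin n) z - D) *ᵥ l) D)

theorem measurable_eigenvectorIntegrand {Ψ : Matrix (Fin (n + 1)) (Fin (n + 1)) ℂ → ℝ≥0∞}
    (hΨ : Measurable Ψ) (z : ℂ) {α : Type} [MeasurableSpace α] {l b : α → Fin n → ℂ}
    {D : α → Matrix (Fin n) (Fin n) ℂ} (hl : Measurable l) (hb : Measurable b) (hD : Measurable D) :
    Measurable fun x => eigenvectorIntegrand Ψ z (l x) (b x) (D x) := by
  have h1 : Continuous fun p : (Fin n → ℂ) × (Fin n → ℂ) × Matrix (Fin n) (Fin n) ℂ =>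
      (Matrix.scalar (Fin n) z - p.2.2 + vecMulVec p.1 p.2.1).det := by
    refine Continuous.matrix_det (Continuous.add (by fun_prop) ?_)
    exact Continuous.matrix_vecMulVec (by fun_prop) (by fun_prop)
  have h2 : Continuous fun p : (Fin n → ℂ) × (Fin n → ℂ) × Matrix (Fin n) (Fin n) ℂ =>
      z - p.2.1 ⬝ᵥ p.1 := by fun_prop
  have h3 : Continuous fun p : (Fin n → ℂ) × (Fin n → ℂ) × Matrix (Fin n) (Fin n) ℂ =>
      (Matrix.scalar (Fin n) z - p.2.2) *ᵥ p.1 := by fun_prop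
  have hp : Measurable fun x => (l x, b x, D x) := hl.prodMk (hb.prodMk hD)
  have h4 := ((h1.measurable.comp hp).norm.pow_const 2).ennreal_ofReal
  have h5 := measurable_border (h2.measurable.comp hp) hb (h3.measurable.comp hp) hD
  exact h4.mul (hΨ.comp h5)

/-- Tonelli rearrangements: `c` is made innermost to be replaced by `l`, and then `D` is made
innermost so that it can be translated for fixed `l` and `b`. -/
theorem lintegral_schurIntegrand {Ψ : Matrix (Fin (n + 1)) (Fin (n + 1)) ℂ → ℝ≥0∞}
    (hΨ : Measurable Ψ) (z : ℂ) :
    ∫⁻ w, schurIntegrand Ψ z w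
      = ∫⁻ l : Fin n → ℂ, ∫⁻ b : Fin n → ℂ, ∫⁻ D, eigenvectorIntegrand Ψ z l b D := by
  have hGz : Measurable (schurIntegrand Ψ z) :=
    Measurable.of_uncurry_left (measurable_schurIntegrand hΨ)
  calc ∫⁻ w, schurIntegrand Ψ z w
      = ∫⁻ b : Fin n → ℂ, ∫⁻ p : (Fin n → ℂ) × Matrix (Fin n) (Fin n) ℂ,
          schurIntegrand Ψ z (p, b) :=
        lintegral_prod_symm' (μ := (volume : Measure ((Fin n → ℂ) × Matrix (Fin n) (Fin n) ℂ))) _ hGz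
    _ = ∫⁻ b : Fin n → ℂ, ∫⁻ D : Matrix (Fin n) (Fin n) ℂ, ∫⁻ c : Fin n → ℂ,
          schurIntegrand Ψ z ((c, D), b) := by
        refine lintegral_congr fun b => ?_
        exact lintegral_prod_symm' (μ := (volume : Measure (Fin n → ℂ)))
          (fun p : (Fin n → ℂ) × Matrix (Fin n) (Fin n) ℂ => schurIntegrand Ψ z (p, b))
          (hGz.comp measurable_prodMk_right)
    _ = ∫⁻ b : Fin n → ℂ, ∫⁻ D : Matrix (Fin n) (Fin n) ℂ, ∫⁻ l : Fin n → ℂ,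
          eigenvectorIntegrand Ψ z l b D := by
        refine lintegral_congr fun b => lintegral_congr_ae ?_
        filter_upwards [ae_det_scalar_sub_ne_zero z] with D hD
        refine Eq.trans (lintegral_congr fun c => ?_)
          (lintegral_schurEntry_substitution z b D hD hΨ)
        have hD' : z ∈ {z | (Matrix.scalar (Fin n) z - D).det ≠ 0} := hD
        simp only [schurIntegrand]
        rw [Set.indicator_of_mem hD']
    _ = ∫⁻ b : Fin n → ℂ, ∫⁻ l : Fin n → ℂ, ∫⁻ D : Matrix (Fin n) (Fin n) ℂ,
          eigenvectorIntegrand Ψ z l b D := by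
        refine lintegral_congr fun b => lintegral_lintegral_swap ?_
        exact (measurable_eigenvectorIntegrand hΨ z measurable_snd measurable_const
          measurable_fst).aemeasurable
    _ = ∫⁻ l : Fin n → ℂ, ∫⁻ b : Fin n → ℂ, ∫⁻ D : Matrix (Fin n) (Fin n) ℂ,
          eigenvectorIntegrand Ψ z l b D := by
        refine lintegral_lintegral_swap ?_
        refine (Measurable.lintegral_prod_right' (f := fun q : ((Fin n → ℂ) × (Fin n → ℂ)) ×
          Matrix (Fin n) (Fin n) ℂ => eigenvectorIntegrand Ψ z q.1.2 q.1.1 q.2) ?_).aemeasurable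
        exact measurable_eigenvectorIntegrand hΨ z (measurable_snd.comp measurable_fst)
          (measurable_fst.comp measurable_fst) measurable_snd

/-- Peeling off one eigenvalue: an integral over matrices, weighted by the number of eigenvalues,
in the coordinates given by an eigenvalue `z`, its eigenvector `(1, l)` and the quotient matrix. -/
theorem lintegral_peel {Ψ : Matrix (Fin (n + 1)) (Fin (n + 1)) ℂ → ℝ≥0∞} (hΨ : Measurable Ψ) :
    ∫⁻ M, ((n + 1 : ℕ) : ℝ≥0∞) * Ψ M
      = ∫⁻ z : ℂ, ∫⁻ l : Fin n → ℂ, ∫⁻ u : Fin n → ℂ, ∫⁻ M : Matrix (Fin n) (Fin n) ℂ,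
        ENNReal.ofReal (‖M.charpoly.eval z‖ ^ 2) *
          Ψ (border 1 0 l 1 * border z u 0 M * border 1 0 (-l) 1) := by
  rw [lintegral_border (hΨ.const_mul _)]
  calc ∫⁻ w : ((Fin n → ℂ) × Matrix (Fin n) (Fin n) ℂ) × (Fin n → ℂ), ∫⁻ a : ℂ,
        ((n + 1 : ℕ) : ℝ≥0∞) * Ψ (border a w.2 w.1.1 w.1.2)
      = ∫⁻ w, ∫⁻ z, schurIntegrand Ψ z w := by
        refine lintegral_congr_ae ?_
        filter_upwards [ae_ae_border (ae_no_common_eigenvalue n)] with w hw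
        have hc : Continuous fun z : ℂ => Matrix.scalar (Fin n) z - w.1.2 :=
          continuous_scalar.sub continuous_const
        have hS : MeasurableSet {z | (Matrix.scalar (Fin n) z - w.1.2).det ≠ 0} :=
          (hc.matrix_det.measurable (measurableSet_singleton 0)).compl
        rw [lintegral_schurEntry (b := w.2) (c := w.1.1) (D := w.1.2) hw hΨ, ← lintegral_indicator hS]
        rfl
    _ = ∫⁻ z, ∫⁻ w, schurIntegrand Ψ z w :=
        (lintegral_lintegral_swap (measurable_schurIntegrand hΨ).aemeasurable).symm
    _ = _ := by
        refine lintegral_congr fun z => ?_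
        rw [lintegral_schurIntegrand hΨ]
        refine lintegral_congr fun l => lintegral_congr fun u => ?_
        -- The translation `D = M + l uᵀ` turns the rank-one perturbed determinant into the
        -- characteristic polynomial of `M` at `z`.
        rw [← lintegral_matrix_add_right (vecMulVec l u)]
        refine lintegral_congr fun M => ?_
        rw [eigenvectorIntegrand, unipotent_conj_border, eval_charpoly]
        congr 5
        abel

end Peel

/-! ### The Gram determinant of block triangular matrices. -/

section Triangular

open Matrix
open scoped ComplexOrder MatrixOrder

variable {n : ℕ}

/-- The modulus of `det (1 + Mᴴ M)`. -/
def gramDet (M : Matrix (Fin n) (Fin n) ℂ) : ℝ := ‖(1 + Mᴴ * M).det‖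

theorem posDef_one_add_conjTranspose_mul (M : Matrix (Fin n) (Fin n) ℂ) :
    (1 + Mᴴ * M).PosDef :=
  PosDef.one.add_posSemidef (posSemidef_conjTranspose_mul_self M)

theorem gramDet_pos (M : Matrix (Fin n) (Fin n) ℂ) : 0 < gramDet M :=
  norm_pos_iff.2 (posDef_one_add_conjTranspose_mul M).det_pos.ne'

theorem continuous_gramDet : Continuous fun M : Matrix (Fin n) (Fin n) ℂ => gramDet M := by
  unfold gramDet
  fun_prop

theorem gramDet_unitary_conj {U : Matrix (Fin n) (Fin n) ℂ} (hU : Uᴴ * U = 1)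
    (M : Matrix (Fin n) (Fin n) ℂ) : gramDet (U * M * Uᴴ) = gramDet M := by
  have hU' : U * Uᴴ = 1 := mul_eq_one_comm.1 hU
  have h : 1 + (U * M * Uᴴ)ᴴ * (U * M * Uᴴ) = U * (1 + Mᴴ * M) * Uᴴ := by
    rw [conjTranspose_mul, conjTranspose_mul, conjTranspose_conjTranspose, Matrix.mul_add,
      Matrix.add_mul, Matrix.mul_one, hU']
    congr 1
    calc U * (Mᴴ * Uᴴ) * (U * M * Uᴴ) = U * Mᴴ * (Uᴴ * U) * M * Uᴴ := by
          simp only [Matrix.mul_assoc]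
      _ = U * (Mᴴ * M) * Uᴴ := by rw [hU]; simp only [Matrix.mul_assoc, Matrix.mul_one]
  rw [gramDet, h, det_mul_right_comm, hU', Matrix.one_mul, gramDet]

/-- A block QR decomposition: the first column of `U` is `(1, l)` normalized, so `r` has the norm of
`(1, l)`. The unipotent matrix has determinant `1`, which forces `|r| |det S| = 1`. -/
theorem exists_unitary_mul_border (l : Fin n → ℂ) :
    ∃ (U : Matrix (Fin (n + 1)) (Fin (n + 1)) ℂ) (r : ℂ) (t : Fin n → ℂ)
      (S : Matrix (Fin n) (Fin n) ℂ), Uᴴ * U = 1 ∧ border 1 0 l 1 = U * border r t 0 S ∧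
        ‖r‖ ^ 2 = 1 + ∑ i, ‖l i‖ ^ 2 ∧ ‖r‖ ^ 2 * ‖S.det‖ ^ 2 = 1 := by
  let v : EuclideanSpace ℂ (Fin (n + 1)) := WithLp.toLp 2 (Fin.cons 1 l)
  have hv2 : ‖v‖ ^ 2 = 1 + ∑ i, ‖l i‖ ^ 2 := by
    rw [EuclideanSpace.norm_sq_eq, Fin.sum_univ_succ]
    simp [v]
  have hv : ‖v‖ ≠ 0 := by
    intro h
    rw [h] at hv2
    have : 0 ≤ ∑ i, ‖l i‖ ^ 2 := by positivity
    norm_num at hv2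
    linarith
  -- A constant family: only its restriction to the index `0` is required to be orthonormal.
  let e : Fin (n + 1) → EuclideanSpace ℂ (Fin (n + 1)) := fun _ => ((‖v‖ : ℂ)⁻¹) • v
  have he : Orthonormal ℂ (({0} : Set (Fin (n + 1))).domRestrict e) := by
    constructor
    · intro i
      simp [e, norm_smul, hv]
    · intro i j hij
      exact absurd (Subsingleton.elim i j) hij
  obtain ⟨b, hb⟩ := he.exists_orthonormalBasis_extension_of_card_eq (by simp)
  have hb0 : b 0 = ((‖v‖ : ℂ)⁻¹) • v := hb 0 rfl
  let U : Matrix (Fin (n + 1)) (Fin (n + 1)) ℂ := Matrix.of fun i j => b j i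
  have hU : Uᴴ * U = 1 := by
    ext i j
    have h1 := orthonormal_iff_ite.1 b.orthonormal i j
    rw [PiLp.inner_apply] at h1
    rw [Matrix.mul_apply, Matrix.one_apply, ← h1]
    refine Finset.sum_congr rfl fun k _ => ?_
    simp [U, conjTranspose_apply, RCLike.inner_apply, mul_comm]
  have hU' : U * Uᴴ = 1 := mul_eq_one_comm.1 hU
  let R := Uᴴ * border 1 0 l 1
  have hvb : v = (‖v‖ : ℂ) • b 0 := by
    rw [hb0, smul_smul, mul_inv_cancel₀ (by exact_mod_cast hv), one_smul]
  have hR0 : ∀ i, R i 0 = if i = 0 then (‖v‖ : ℂ) else 0 := by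
    intro i
    have h1 : R i 0 = inner ℂ (b i) v := by
      change (Uᴴ * border 1 0 l 1) i 0 = _
      rw [PiLp.inner_apply, Matrix.mul_apply]
      refine Finset.sum_congr rfl fun k _ => ?_
      refine Fin.cases ?_ (fun k => ?_) k <;> simp [U, v, conjTranspose_apply, mul_comm]
    rw [h1]
    conv_lhs => rw [hvb]
    rw [inner_smul_right, orthonormal_iff_ite.1 b.orthonormal i 0]
    simp
  have hRb : R = border (R 0 0) (fun j => R 0 j.succ) 0 (R.submatrix Fin.succ Fin.succ) := by
    conv_lhs => rw [← border_eta R]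
    congr 1
    funext i
    rw [hR0 i.succ, if_neg (Fin.succ_ne_zero i)]
    rfl
  have hH : border 1 0 l 1 = U * R := by
    simp only [R]
    rw [← Matrix.mul_assoc, hU', Matrix.one_mul]
  have hr : ‖R 0 0‖ ^ 2 = ‖v‖ ^ 2 := by rw [hR0 0]; simp
  refine ⟨U, R 0 0, fun j => R 0 j.succ, R.submatrix Fin.succ Fin.succ, hU, ?_, ?_, ?_⟩
  · rw [← hRb]; exact hH
  · rw [hr, hv2]
  · have h1 := congrArg Matrix.det hH
    rw [det_border_zero_right, det_mul, hRb, det_border_zero_left] at h1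
    have h2 := congrArg Matrix.det hU
    rw [det_mul, det_conjTranspose] at h2
    have h3 : ‖U.det‖ ^ 2 = 1 := by
      have := congrArg norm h2
      rw [norm_mul, norm_star, det_one, norm_one] at this
      rw [sq, this]
    have h4 := congrArg norm h1
    rw [det_one, mul_one, norm_one, norm_mul, norm_mul] at h4
    have h5 : (‖U.det‖ * (‖R 0 0‖ * ‖(R.submatrix Fin.succ Fin.succ : Matrix (Fin n) (Fin n) ℂ).det‖)) ^ 2
      = 1 := by
      rw [← h4, one_pow]
    rw [mul_pow, h3, one_mul, mul_pow] at h5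
    exact h5

theorem inv_unipotent (l : Fin n → ℂ) : (border 1 0 l (1 : Matrix (Fin n) (Fin n) ℂ))⁻¹
    = border 1 0 (-l) 1 := by
  apply Matrix.inv_eq_right_inv
  rw [border_mul, ← border_one]
  congr 1
  · simp
  · simp
  · simp
  · ext; simp [vecMulVec]

theorem inv_border_zero_left {r : ℂ} (hr : r ≠ 0) (t : Fin n → ℂ) {S : Matrix (Fin n) (Fin n) ℂ}
    (hS : S.det ≠ 0) : (border r t 0 S)⁻¹ = border r⁻¹ (-(r⁻¹ • (t ᵥ* S⁻¹))) 0 S⁻¹ := by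
  apply Matrix.inv_eq_right_inv
  rw [border_mul, ← border_one, Matrix.mul_nonsing_inv _ (isUnit_iff_ne_zero.2 hS)]
  congr 1
  · simp [hr]
  · rw [smul_neg, smul_smul, mul_inv_cancel₀ hr, one_smul, neg_add_cancel]
  · simp
  · ext; simp [vecMulVec]

/-- The unipotent conjugation can be replaced by a block triangular one. -/
theorem gramDet_unipotent_conj (l : Fin n → ℂ) : ∃ (r : ℂ) (t : Fin n → ℂ)
    (S : Matrix (Fin n) (Fin n) ℂ), ‖r‖ ^ 2 = 1 + ∑ i, ‖l i‖ ^ 2 ∧ ‖r‖ ^ 2 * ‖S.det‖ ^ 2 = 1 ∧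
      ∀ (z : ℂ) (u : Fin n → ℂ) (M : Matrix (Fin n) (Fin n) ℂ),
        gramDet (border 1 0 l 1 * border z u 0 M * border 1 0 (-l) 1)
          = gramDet (border z (u ᵥ* (r • S⁻¹) + (t ᵥ* M - z • t) ᵥ* S⁻¹) 0 (S * M * S⁻¹)) := by
  obtain ⟨U, r, t, S, hU, hH, hr, hrS⟩ := exists_unitary_mul_border l
  refine ⟨r, t, S, hr, hrS, fun z u M => ?_⟩
  have hr0 : r ≠ 0 := by
    rintro rfl
    simp at hrS
  have hS0 : S.det ≠ 0 := by
    intro h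
    rw [h] at hrS
    simp at hrS
  have hUinv : U⁻¹ = Uᴴ := Matrix.inv_eq_left_inv hU
  -- With the unipotent matrix written as `U R`, conjugation by it is conjugation by `R` followed by
  -- a unitary one, which the Gram determinant does not see.
  have h1 : border 1 0 l 1 * border z u 0 M * border 1 0 (-l) 1
      = U * (border r t 0 S * border z u 0 M * (border r t 0 S)⁻¹) * Uᴴ := by
    rw [← inv_unipotent, hH, Matrix.mul_inv_rev, hUinv]
    simp only [Matrix.mul_assoc]
  rw [h1, gramDet_unitary_conj hU, inv_border_zero_left hr0 t hS0, border_mul, border_mul]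
  congr 2
  · simp; field_simp
  · simp only [dotProduct_zero, add_zero]
    rw [Matrix.add_vecMul, Matrix.vecMul_smul, smul_neg, smul_smul, Matrix.sub_vecMul,
      Matrix.smul_vecMul, Matrix.smul_vecMul, mul_right_comm, mul_inv_cancel₀ hr0, one_mul]
    abel
  · simp
  · have : ∀ v : Fin n → ℂ, vecMulVec (0 : Fin n → ℂ) v = 0 := fun v => by ext; simp [vecMulVec]
    simp [this]

theorem exists_conjTranspose_mul_self_eq (M : Matrix (Fin n) (Fin n) ℂ) :
    ∃ L : Matrix (Fin n) (Fin n) ℂ, 1 + Mᴴ * M = Lᴴ * L ∧ ‖L.det‖ ^ 2 = gramDet M := by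
  obtain ⟨L, hL⟩ := CStarAlgebra.nonneg_iff_eq_star_mul_self.1
    (posDef_one_add_conjTranspose_mul M).posSemidef.nonneg
  rw [star_eq_conjTranspose] at hL
  refine ⟨L, hL, ?_⟩
  rw [gramDet, hL, det_mul, det_conjTranspose, norm_mul, norm_star, sq]

theorem det_border_of_ne_zero {a : ℂ} (ha : a ≠ 0) (b c : Fin n → ℂ)
    (D : Matrix (Fin n) (Fin n) ℂ) :
    (border a b c D).det = a * (D - a⁻¹ • vecMulVec c b).det := by
  have h : border a b c D = border 1 0 (a⁻¹ • c) 1 * border a b 0 (D - a⁻¹ • vecMulVec c b) := by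
    rw [border_mul]
    congr 1
    · simp
    · simp
    · simp [smul_smul, ha]
    · simp [smul_vecMulVec]
  rw [h, det_mul, det_border_zero_right, det_border_zero_left]
  simp

/-- For `N = [[z, u], [0, M]]` the corner of `1 + Nᴴ N` is `1 + |z|²`, with Schur complement `1 + Mᴴ
M + (1 + |z|²)⁻¹ u*ᵀ u`, where `u*` is the conjugate of `u`. Writing `u = s x L` with `s² = 1 +
|z|²` pulls `Lᴴ` and `L` out and leaves a factor that depends on `x` alone. -/
theorem gramDet_border (z : ℂ) (x : Fin n → ℂ) {M L : Matrix (Fin n) (Fin n) ℂ}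
    (hL : 1 + Mᴴ * M = Lᴴ * L) (s : ℝ) (hs : s ^ 2 = 1 + ‖z‖ ^ 2) :
    gramDet (border z (x ᵥ* ((s : ℂ) • L)) 0 M)
      = (1 + ‖z‖ ^ 2) * gramDet M * ‖(1 + vecMulVec (star x) x).det‖ := by
  set u := x ᵥ* ((s : ℂ) • L) with hu
  have hz : (1 + star z * z : ℂ) = ((1 + ‖z‖ ^ 2 : ℝ) : ℂ) := by
    rw [Complex.star_def, Complex.conj_mul']; push_cast; rfl
  have hz0 : (1 + star z * z : ℂ) ≠ 0 := by
    rw [hz]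
    have : (0 : ℝ) < 1 + ‖z‖ ^ 2 := by positivity
    exact_mod_cast this.ne'
  have h1 : 1 + (border z u 0 M)ᴴ * border z u 0 M
      = border (1 + star z * z) (star z • u) (z • star u) (Lᴴ * L + vecMulVec (star u) u) := by
    rw [border_conjTranspose, border_mul, ← border_one, border_add, ← hL]
    congr 1
    · simp
    · simp
    · simp
    · rw [add_assoc, add_comm (Mᴴ * M)]
  have h2 : Lᴴ * L + vecMulVec (star u) u
      - (1 + star z * z)⁻¹ • vecMulVec (z • star u) (star z • u)
      = Lᴴ * (1 + vecMulVec (star x) x) * L := by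
    have hsu : vecMulVec (star u) u = (1 + star z * z) • (Lᴴ * vecMulVec (star x) x * L) := by
      have hsu' : star u = (s : ℂ) • (Lᴴ *ᵥ star x) := by
        rw [hu, Matrix.vecMul_smul, star_smul, star_vecMul]
        simp
      have hu' : u = (s : ℂ) • (x ᵥ* L) := by rw [hu, Matrix.vecMul_smul]
      rw [hsu', hu', smul_vecMulVec, vecMulVec_smul, smul_smul, Matrix.mul_vecMulVec,
        Matrix.vecMulVec_mul, hz, ← hs]
      push_cast
      rw [sq]
    rw [smul_vecMulVec, vecMulVec_smul, hsu, smul_smul, smul_smul, smul_smul, add_sub_assoc,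
      ← sub_smul, Matrix.mul_add, Matrix.add_mul, Matrix.mul_one]
    congr 1
    have : (1 + star z * z - (1 + star z * z)⁻¹ * z * star z * (1 + star z * z) : ℂ) = 1 := by
      field_simp
      ring
    rw [this, one_smul]
  rw [gramDet, h1, det_border_of_ne_zero hz0, h2, det_mul, det_mul, hz, det_conjTranspose]
  have h3 : gramDet M = ‖L.det‖ * ‖L.det‖ := by
    rw [gramDet, hL, det_mul, det_conjTranspose, norm_mul, norm_star]
  rw [h3]
  simp only [norm_mul, norm_star, Complex.norm_real, Real.norm_eq_abs]
  rw [abs_of_nonneg (by positivity)]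
  ring

/-- The constant arising from the integration over the off-diagonal block. -/
def offDiagonalConst (n α : ℕ) : ℝ≥0∞ :=
  ∫⁻ x : Fin n → ℂ, ENNReal.ofReal ((‖(1 + vecMulVec (star x) x).det‖ ^ α)⁻¹)

/-- The substitution `u = s x L` has Jacobian `(1 + |z|²)^n gramDet M`. It lowers the exponent `γ +
n + 1` by `n` for `1 + |z|²` and by one for `gramDet M`. So `γ` is unchanged when the size drops, as
the induction needs. -/
theorem lintegral_gramDet_border (γ : ℕ) (z : ℂ) (M : Matrix (Fin n) (Fin n) ℂ) :
    ∫⁻ u : Fin n → ℂ, ENNReal.ofReal ((gramDet (border z u 0 M) ^ (γ + (n + 1)))⁻¹)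
      = ENNReal.ofReal (((1 + ‖z‖ ^ 2) ^ (γ + 1))⁻¹) * ENNReal.ofReal ((gramDet M ^ (γ + n))⁻¹)
        * offDiagonalConst n (γ + (n + 1)) := by
  obtain ⟨L, hL, hLd⟩ := exists_conjTranspose_mul_self_eq M
  have hp : (0 : ℝ) < 1 + ‖z‖ ^ 2 := by positivity
  have hs : Real.sqrt (1 + ‖z‖ ^ 2) ^ 2 = 1 + ‖z‖ ^ 2 := Real.sq_sqrt hp.le
  set s := Real.sqrt (1 + ‖z‖ ^ 2)
  have hg := gramDet_pos M
  have hdet : ‖((s : ℂ) • L).det‖ ^ 2 = (1 + ‖z‖ ^ 2) ^ n * gramDet M := by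
    rw [det_smul, norm_mul, norm_pow, mul_pow, hLd, Fintype.card_fin, ← pow_mul, mul_comm n 2,
      pow_mul, Complex.norm_real, Real.norm_eq_abs, sq_abs, hs]
  have hd0 : ((s : ℂ) • L).det ≠ 0 := by
    intro h
    rw [h] at hdet
    have : 0 < (1 + ‖z‖ ^ 2) ^ n * gramDet M := by positivity
    simp at hdet
    rcases hdet with h | h
    · exact absurd h.1 hp.ne'
    · exact absurd h hg.ne'
  have hm : Measurable fun u : Fin n → ℂ =>
      ENNReal.ofReal ((gramDet (border z u 0 M) ^ (γ + (n + 1)))⁻¹) := by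
    have hb : Continuous fun u : Fin n → ℂ => border z u 0 M :=
      continuous_border continuous_const continuous_id continuous_const continuous_const
    exact (((continuous_gramDet.comp hb).measurable.pow_const _).inv).ennreal_ofReal
  rw [← lintegral_comp_vecMul _ hd0 hm, hdet, offDiagonalConst, ← lintegral_const_mul' _ _
    ENNReal.ofReal_ne_top, ← ENNReal.ofReal_mul (by positivity),
    ← lintegral_const_mul' _ _ ENNReal.ofReal_ne_top]
  refine lintegral_congr fun x => ?_
  rw [gramDet_border z x hL s hs, ← ENNReal.ofReal_mul (by positivity),
    ← ENNReal.ofReal_mul (by positivity)]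
  congr 1
  rw [mul_pow, mul_pow, mul_inv, mul_inv, ← mul_assoc]
  congr 1
  have h1 : (1 + ‖z‖ ^ 2) ^ (γ + (n + 1)) = (1 + ‖z‖ ^ 2) ^ (γ + 1) * (1 + ‖z‖ ^ 2) ^ n := by
    rw [← pow_add]; congr 1; ring
  have h2 : gramDet M ^ (γ + (n + 1)) = gramDet M ^ (γ + n) * gramDet M := by
    rw [← pow_succ]; congr 1
  rw [h1, h2]
  field_simp

end Triangular

/-! ### Eigenvalue density by induction on the size. -/

section Induction

open Matrix

variable {n : ℕ}

/-- The density `det (1 + Mᴴ M)⁻ᵅ`. -/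
def gramDensity (α : ℕ) (M : Matrix (Fin n) (Fin n) ℂ) : ℝ≥0∞ :=
  ENNReal.ofReal ((gramDet M ^ α)⁻¹)

theorem measurable_gramDensity (α : ℕ) :
    Measurable (gramDensity α : Matrix (Fin n) (Fin n) ℂ → ℝ≥0∞) :=
  ((continuous_gramDet.measurable.pow_const _).inv).ennreal_ofReal

theorem measurable_border_zero {α : Type*} [MeasurableSpace α] (z : ℂ) {u : α → Fin n → ℂ}
    {M : α → Matrix (Fin n) (Fin n) ℂ} (hu : Measurable u) (hM : Measurable M) :
    Measurable fun x => border z (u x) 0 (M x) :=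
  measurable_border measurable_const hu measurable_const hM

/-- After passing to the block triangular conjugate, `u` undergoes an affine map with linear part `r
S⁻¹`, and `M` is conjugated by `S`, which preserves Lebesgue measure and `h`. Hence `l` enters only
through the Jacobian. -/
theorem lintegral_gramDensity_unipotent_conj (α : ℕ) (z : ℂ) (l : Fin n → ℂ)
    {h : Matrix (Fin n) (Fin n) ℂ → ℝ≥0∞} (hh : Measurable h)
    (hconj : ∀ S M : Matrix (Fin n) (Fin n) ℂ, S.det ≠ 0 → h (S * M * S⁻¹) = h M) :
    ∫⁻ u : Fin n → ℂ, ∫⁻ M : Matrix (Fin n) (Fin n) ℂ, h M *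
        gramDensity α (border 1 0 l 1 * border z u 0 M * border 1 0 (-l) 1)
      = ENNReal.ofReal (((1 + ∑ i, ‖l i‖ ^ 2) ^ (n + 1))⁻¹) *
        ∫⁻ M, h M * ∫⁻ u : Fin n → ℂ, gramDensity α (border z u 0 M) := by
  obtain ⟨r, t, S, hr, hrS, hg⟩ := gramDet_unipotent_conj l
  have hr0 : r ≠ 0 := by
    rintro rfl
    simp at hrS
  have hS0 : S.det ≠ 0 := by
    intro h
    rw [h] at hrS
    simp at hrS
  have hdet : (r • S⁻¹).det ≠ 0 := by
    rw [det_smul, det_nonsing_inv, Ring.inverse_eq_inv']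
    positivity
  have hrpos : 0 < ‖r‖ := norm_pos_iff.2 hr0
  have hSpos : 0 < ‖S.det‖ := norm_pos_iff.2 hS0
  -- The scalar contributes `|r|^(2n)` and `|det S|⁻² = |r|²` gives one more factor.
  have hdet2 : ‖(r • S⁻¹).det‖ ^ 2 = (1 + ∑ i, ‖l i‖ ^ 2) ^ (n + 1) := by
    rw [det_smul, det_nonsing_inv, Ring.inverse_eq_inv', norm_mul, norm_inv, norm_pow, mul_pow,
      Fintype.card_fin, inv_pow, ← hr, ← inv_eq_of_mul_eq_one_right hrS, inv_inv]
    ring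
  have hlpos : 0 < (1 + ∑ i, ‖l i‖ ^ 2 : ℝ) := by positivity
  have hgm := measurable_gramDensity α (n := n + 1)
  have hmeas : Measurable fun p : (Fin n → ℂ) × Matrix (Fin n) (Fin n) ℂ =>
      h p.2 * gramDensity α (border 1 0 l 1 * border z p.1 0 p.2 * border 1 0 (-l) 1) := by
    have hc : Continuous fun N : Matrix (Fin (n + 1)) (Fin (n + 1)) ℂ =>
      border 1 0 l 1 * N * border 1 0 (-l) 1 := by fun_prop
    exact (hh.comp measurable_snd).mul (hgm.comp (hc.measurable.comp
      (measurable_border_zero z measurable_fst measurable_snd)))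
  have hk : Measurable fun M : Matrix (Fin n) (Fin n) ℂ =>
      ∫⁻ u : Fin n → ℂ, gramDensity α (border z u 0 M) :=
    Measurable.lintegral_prod_right' (f := fun p : Matrix (Fin n) (Fin n) ℂ × (Fin n → ℂ) =>
      gramDensity α (border z p.2 0 p.1))
      (hgm.comp (measurable_border_zero z measurable_snd measurable_fst))
  rw [lintegral_lintegral_swap hmeas.aemeasurable, ← lintegral_comp_conj S hS0
    (f := fun M => h M * ∫⁻ u : Fin n → ℂ, gramDensity α (border z u 0 M)) (hh.mul hk),
    ← lintegral_const_mul' _ _ ENNReal.ofReal_ne_top]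
  refine lintegral_congr fun M => ?_
  have hu : Measurable fun u : Fin n → ℂ => gramDensity α (border z u 0 (S * M * S⁻¹)) :=
    hgm.comp (measurable_border_zero z measurable_id measurable_const)
  have hc : Continuous fun N : Matrix (Fin (n + 1)) (Fin (n + 1)) ℂ =>
      border 1 0 l 1 * N * border 1 0 (-l) 1 := by fun_prop
  have hum : Measurable fun u : Fin n → ℂ =>
      gramDensity α (border 1 0 l 1 * border z u 0 M * border 1 0 (-l) 1) :=
    hgm.comp (hc.measurable.comp (measurable_border_zero z measurable_id measurable_const))
  rw [lintegral_const_mul _ hum, hconj S M hS0,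
    mul_left_comm]
  congr 1
  simp only [gramDensity, hg]
  have h1 : ∫⁻ u : Fin n → ℂ, gramDensity α (border z (u ᵥ* (r • S⁻¹) +
      (t ᵥ* M - z • t) ᵥ* S⁻¹) 0 (S * M * S⁻¹))
      = (ENNReal.ofReal (‖(r • S⁻¹).det‖ ^ 2))⁻¹ *
        ∫⁻ u : Fin n → ℂ, gramDensity α (border z u 0 (S * M * S⁻¹)) := by
    have h2 := lintegral_comp_vecMul (r • S⁻¹) hdet (f := fun u =>
      gramDensity α (border z (u + (t ᵥ* M - z • t) ᵥ* S⁻¹) 0 (S * M * S⁻¹)))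
      (hu.comp (measurable_add_const _))
    rw [lintegral_add_right_eq_self (μ := (volume : Measure (Fin n → ℂ)))
      (fun u => gramDensity α (border z u 0 (S * M * S⁻¹)))] at h2
    rw [← h2, ← mul_assoc, ENNReal.inv_mul_cancel (by simpa using hdet) ENNReal.ofReal_ne_top,
      one_mul]
  rw [hdet2, ← ENNReal.ofReal_inv_of_pos (by positivity)] at h1
  exact h1

/-- The function `|∏_{i<j} (z_j - z_i)|² ∏_k (1 + |z_k|²)^(-γ-1)`. -/
def eigenvalueWeight (γ n : ℕ) (z : Fin n → ℂ) : ℝ :=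
  ‖∏ i, ∏ j ∈ Finset.Ioi i, (z j - z i)‖ ^ 2 * ∏ k, ((1 + ‖z k‖ ^ 2) ^ (γ + 1))⁻¹

theorem continuous_eigenvalueWeight (γ n : ℕ) : Continuous (eigenvalueWeight γ n) := by
  have h : ∀ (z : Fin n → ℂ) k, (1 + ‖z k‖ ^ 2) ^ (γ + 1) ≠ 0 := fun z k => by positivity
  unfold eigenvalueWeight
  refine Continuous.mul (by fun_prop) (continuous_finsetProd _ fun k _ => ?_)
  exact Continuous.inv₀ (by fun_prop) fun z => h z k

theorem eigenvalueWeight_cons (γ n : ℕ) (z : ℂ) (w : Fin n → ℂ) :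
    eigenvalueWeight γ (n + 1) (Fin.cons z w)
      = ((1 + ‖z‖ ^ 2) ^ (γ + 1))⁻¹ * (∏ i, ‖z - w i‖ ^ 2) * eigenvalueWeight γ n w := by
  unfold eigenvalueWeight
  rw [Fin.prod_univ_succ, Fin.prod_univ_succ (f := fun k : Fin (n + 1) =>
    ((1 + ‖(Fin.cons z w : Fin (n + 1) → ℂ) k‖ ^ 2) ^ (γ + 1))⁻¹)]
  simp only [Fin.cons_zero, Fin.cons_succ, norm_mul, mul_pow]
  have h1 : ∏ j ∈ Finset.Ioi (0 : Fin (n + 1)), ((Fin.cons z w : Fin (n + 1) → ℂ) j - z)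
      = ∏ i, (w i - z) := by
    rw [Fin.prod_Ioi_zero]
    simp
  have h2 : ∀ i : Fin n, ∏ j ∈ Finset.Ioi i.succ, ((Fin.cons z w : Fin (n + 1) → ℂ) j - w i)
      = ∏ j ∈ Finset.Ioi i, (w j - w i) := fun i => by
    rw [Fin.prod_Ioi_succ]
    simp
  simp only [h1, h2]
  have h3 : ‖∏ i, (w i - z)‖ ^ 2 = ∏ i, ‖z - w i‖ ^ 2 := by
    rw [norm_prod, ← Finset.prod_pow]
    exact Finset.prod_congr rfl fun i _ => by rw [norm_sub_rev]
  rw [h3]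
  ring

theorem measurable_roots_charpoly {Φ : Multiset ℂ → ℝ≥0∞}
    (hΦ : Measurable fun z : Fin n → ℂ => Φ (Finset.univ.val.map z)) :
    Measurable fun M : Matrix (Fin n) (Fin n) ℂ => Φ M.charpoly.roots := by
  obtain ⟨Z, hZ, hZr⟩ := exists_measurable_roots (n := n)
    (p := fun M : Matrix (Fin n) (Fin n) ℂ => M.charpoly) (fun M => M.charpoly_monic)
    (fun M => by simp) (fun z => by
      simp only [eval_charpoly]
      exact (continuous_const.sub continuous_id).matrix_det.measurable)
  have : (fun M : Matrix (Fin n) (Fin n) ℂ => Φ M.charpoly.roots)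
      = (fun z : Fin n → ℂ => Φ (Finset.univ.val.map z)) ∘ Z := by
    funext M
    simp [← hZr]
  rw [this]
  exact hΦ.comp hZ

theorem charpoly_conj {S : Matrix (Fin n) (Fin n) ℂ} (hS : S.det ≠ 0)
    (M : Matrix (Fin n) (Fin n) ℂ) : (S * M * S⁻¹).charpoly = M.charpoly := by
  rw [Matrix.charpoly_mul_comm, ← Matrix.mul_assoc,
    Matrix.nonsing_inv_mul _ (isUnit_iff_ne_zero.2 hS), Matrix.one_mul]

theorem charpoly_eval_eq_prod_roots (M : Matrix (Fin n) (Fin n) ℂ) (z : ℂ) :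
    M.charpoly.eval z = (M.charpoly.roots.map fun w => z - w).prod := by
  conv_lhs => rw [(IsAlgClosed.splits M.charpoly).eq_prod_roots_of_monic M.charpoly_monic]
  rw [eval_multiset_prod, Multiset.map_map]
  simp

theorem map_fin_cons {α : Type*} (z : α) (w : Fin n → α) :
    Finset.univ.val.map (Fin.cons z w : Fin (n + 1) → α) = z ::ₘ Finset.univ.val.map w := by
  rw [Fin.univ_val_map, Fin.univ_val_map, List.ofFn_succ, Multiset.cons_coe]
  simp

theorem roots_charpoly_unipotent_conj (z : ℂ) (l u : Fin n → ℂ) (M : Matrix (Fin n) (Fin n) ℂ) :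
    (border 1 0 l 1 * border z u 0 M * border 1 0 (-l) 1).charpoly.roots
      = z ::ₘ M.charpoly.roots := by
  have hdet : (border 1 0 l (1 : Matrix (Fin n) (Fin n) ℂ)).det ≠ 0 := by
    rw [det_border_zero_right]; simp
  rw [← inv_unipotent, charpoly_conj hdet, charpoly_border_zero_left,
    roots_mul (mul_ne_zero (X_sub_C_ne_zero z) M.charpoly_monic.ne_zero), roots_X_sub_C,
    Multiset.singleton_add]

/-- The eigenvalues of a matrix with density proportional to `det (1 + Mᴴ M)^(-γ-n)` have density
proportional to `eigenvalueWeight γ n`. -/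
theorem lintegral_roots_charpoly (γ n : ℕ) : ∃ c : ℝ≥0∞, ∀ Φ : Multiset ℂ → ℝ≥0∞,
    Measurable (fun z : Fin n → ℂ => Φ (Finset.univ.val.map z)) →
      ∫⁻ M : Matrix (Fin n) (Fin n) ℂ, Φ M.charpoly.roots * gramDensity (γ + n) M
        = c * ∫⁻ z : Fin n → ℂ, Φ (Finset.univ.val.map z) *
          ENNReal.ofReal (eigenvalueWeight γ n z) := by
  induction n with
  | zero =>
    refine ⟨1, fun Φ _ => ?_⟩
    have h1 : ∀ M : Matrix (Fin 0) (Fin 0) ℂ, Φ M.charpoly.roots * gramDensity (γ + 0) M = Φ 0 := by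
      intro M
      simp [gramDensity, gramDet, charpoly]
    have h2 : ∀ z : Fin 0 → ℂ, Φ (Finset.univ.val.map z) *
        ENNReal.ofReal (eigenvalueWeight γ 0 z) = Φ 0 := by
      intro z
      simp [eigenvalueWeight]
    simp only [h1, h2, one_mul, lintegral_const]
    congr 1
    change (volume : Measure (Fin 0 → Fin 0 → ℂ)) Set.univ = _
    rw [Measure.volume_pi_eq_dirac, Measure.volume_pi_eq_dirac]
    simp
  | succ n ih =>
    obtain ⟨c, hc⟩ := ih
    -- The factor `1 / (n + 1)` undoes the counting of matrices once per eigenvalue; the others are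
    -- the integrals over `l` and over the rescaled `u`, and the constant of the smaller size.
    refine ⟨((n + 1 : ℕ) : ℝ≥0∞)⁻¹ * ((∫⁻ l : Fin n → ℂ,
      ENNReal.ofReal (((1 + ∑ i, ‖l i‖ ^ 2) ^ (n + 1))⁻¹)) *
        (offDiagonalConst n (γ + (n + 1)) * c)), fun Φ hΦ => ?_⟩
    have hΨ : Measurable fun M : Matrix (Fin (n + 1)) (Fin (n + 1)) ℂ =>
        Φ M.charpoly.roots * gramDensity (γ + (n + 1)) M :=
      (measurable_roots_charpoly hΦ).mul (measurable_gramDensity _)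
    have hpeel := lintegral_peel hΨ
    rw [lintegral_const_mul _ hΨ] at hpeel
    -- The factor `|χ_M(z)|²` depends on `M` through its eigenvalues only, so it can be put into the
    -- test function to which the induction hypothesis is applied.
    let Φ' : ℂ → Multiset ℂ → ℝ≥0∞ := fun z s =>
      ENNReal.ofReal (‖(s.map fun w => z - w).prod‖ ^ 2) * Φ (z ::ₘ s)
    have hcons : Measurable fun p : ℂ × (Fin n → ℂ) => (Fin.cons p.1 p.2 : Fin (n + 1) → ℂ) :=
      measurable_pi_iff.2 fun i => Fin.cases measurable_fst
        (fun i => (measurable_pi_apply i).comp measurable_snd) i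
    have hΦ'' : Measurable fun p : ℂ × (Fin n → ℂ) => Φ' p.1 (Finset.univ.val.map p.2) := by
      refine Measurable.mul ?_ ?_
      · simp only [Multiset.map_map, Function.comp_def]
        change Measurable fun p : ℂ × (Fin n → ℂ) => ENNReal.ofReal (‖∏ i, (p.1 - p.2 i)‖ ^ 2)
        fun_prop
      · simp only [← map_fin_cons]
        exact hΦ.comp hcons
    have hΦ' : ∀ z, Measurable fun w : Fin n → ℂ => Φ' z (Finset.univ.val.map w) := fun z =>
      Measurable.of_uncurry_left (f := fun (z : ℂ) (w : Fin n → ℂ) =>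
        Φ' z (Finset.univ.val.map w)) hΦ''
    have hinner : ∀ z : ℂ, (∫⁻ l : Fin n → ℂ, ∫⁻ u : Fin n → ℂ, ∫⁻ M : Matrix (Fin n) (Fin n) ℂ,
        ENNReal.ofReal (‖M.charpoly.eval z‖ ^ 2) *
          (Φ (border 1 0 l 1 * border z u 0 M * border 1 0 (-l) 1).charpoly.roots *
            gramDensity (γ + (n + 1)) (border 1 0 l 1 * border z u 0 M * border 1 0 (-l) 1)))
        = (∫⁻ l : Fin n → ℂ, ENNReal.ofReal (((1 + ∑ i, ‖l i‖ ^ 2) ^ (n + 1))⁻¹)) *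
          (offDiagonalConst n (γ + (n + 1)) * c) *
            ∫⁻ w : Fin n → ℂ, ENNReal.ofReal (((1 + ‖z‖ ^ 2) ^ (γ + 1))⁻¹) *
              (Φ' z (Finset.univ.val.map w) * ENNReal.ofReal (eigenvalueWeight γ n w)) := by
      intro z
      have hh : Measurable fun M : Matrix (Fin n) (Fin n) ℂ => Φ' z M.charpoly.roots :=
        measurable_roots_charpoly (hΦ' z)
      have hrw : ∀ (l u : Fin n → ℂ) (M : Matrix (Fin n) (Fin n) ℂ),
          ENNReal.ofReal (‖M.charpoly.eval z‖ ^ 2) *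
          (Φ (border 1 0 l 1 * border z u 0 M * border 1 0 (-l) 1).charpoly.roots *
            gramDensity (γ + (n + 1)) (border 1 0 l 1 * border z u 0 M * border 1 0 (-l) 1))
          = Φ' z M.charpoly.roots *
            gramDensity (γ + (n + 1)) (border 1 0 l 1 * border z u 0 M * border 1 0 (-l) 1) := by
        intro l u M
        rw [roots_charpoly_unipotent_conj, charpoly_eval_eq_prod_roots, ← mul_assoc]
      have hconj : ∀ S M : Matrix (Fin n) (Fin n) ℂ, S.det ≠ 0 →
          Φ' z (S * M * S⁻¹).charpoly.roots = Φ' z M.charpoly.roots := fun S M hS => by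
        rw [charpoly_conj hS]
      simp only [hrw, lintegral_gramDensity_unipotent_conj _ z _ hh hconj]
      have hlm : Measurable fun l : Fin n → ℂ =>
          ENNReal.ofReal (((1 + ∑ i, ‖l i‖ ^ 2) ^ (n + 1))⁻¹) := by fun_prop
      rw [lintegral_mul_const _ hlm, mul_assoc]
      congr 1
      have hg := fun M : Matrix (Fin n) (Fin n) ℂ => lintegral_gramDet_border γ z M
      simp only [gramDensity, hg]
      have hwm : Measurable fun w : Fin n → ℂ =>
          Φ' z (Finset.univ.val.map w) * ENNReal.ofReal (eigenvalueWeight γ n w) :=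
        (hΦ' z).mul (continuous_eigenvalueWeight γ n).measurable.ennreal_ofReal
      have hhg : Measurable fun M : Matrix (Fin n) (Fin n) ℂ =>
          Φ' z M.charpoly.roots * gramDensity (γ + n) M := hh.mul (measurable_gramDensity _)
      rw [lintegral_const_mul _ hwm, mul_assoc, mul_left_comm c, ← hc _ (hΦ' z), ← mul_assoc,
        ← lintegral_const_mul _ hhg]
      refine lintegral_congr fun M => ?_
      simp only [gramDensity]
      ring
    simp only [hinner] at hpeel
    have hm2 : Measurable fun p : ℂ × (Fin n → ℂ) =>
        ENNReal.ofReal (((1 + ‖p.1‖ ^ 2) ^ (γ + 1))⁻¹) *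
          (Φ' p.1 (Finset.univ.val.map p.2) * ENNReal.ofReal (eigenvalueWeight γ n p.2)) := by
      refine Measurable.mul (by fun_prop) (hΦ''.mul ?_)
      exact ((continuous_eigenvalueWeight γ n).measurable.comp measurable_snd).ennreal_ofReal
    rw [lintegral_const_mul _ (Measurable.lintegral_prod_right' hm2)] at hpeel
    have hfin : ∫⁻ z : Fin (n + 1) → ℂ, Φ (Finset.univ.val.map z) *
        ENNReal.ofReal (eigenvalueWeight γ (n + 1) z)
        = ∫⁻ z : ℂ, ∫⁻ w : Fin n → ℂ, ENNReal.ofReal (((1 + ‖z‖ ^ 2) ^ (γ + 1))⁻¹) *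
          (Φ' z (Finset.univ.val.map w) * ENNReal.ofReal (eigenvalueWeight γ n w)) := by
      have hΦw : Measurable fun z : Fin (n + 1) → ℂ => Φ (Finset.univ.val.map z) *
          ENNReal.ofReal (eigenvalueWeight γ (n + 1) z) :=
        hΦ.mul (continuous_eigenvalueWeight γ (n + 1)).measurable.ennreal_ofReal
      rw [lintegral_fin_cons hΦw, ← lintegral_prod (μ := (volume : Measure ℂ)) (ν := (volume : Measure (Fin n → ℂ)))
        (fun p => ENNReal.ofReal (((1 + ‖p.1‖ ^ 2) ^ (γ + 1))⁻¹) *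
          (Φ' p.1 (Finset.univ.val.map p.2) * ENNReal.ofReal (eigenvalueWeight γ n p.2)))
        hm2.aemeasurable]
      refine lintegral_congr fun p => ?_
      rw [map_fin_cons, eigenvalueWeight_cons, ENNReal.ofReal_mul (by positivity),
        ENNReal.ofReal_mul (by positivity)]
      simp only [Φ', Multiset.map_map, Function.comp_def]
      have : ‖(Finset.univ.val.map fun i => p.1 - p.2 i).prod‖ ^ 2 = ∏ i, ‖p.1 - p.2 i‖ ^ 2 := by
        change ‖∏ i, (p.1 - p.2 i)‖ ^ 2 = _
        rw [norm_prod, Finset.prod_pow]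
      rw [this]
      ring
    rw [hfin, mul_assoc, ← hpeel, ← mul_assoc, ENNReal.inv_mul_cancel (by simp) (by simp), one_mul]

end Induction

/-! ### The law of the quotient of two Gaussian matrices. -/

section GaussianLaw

open Matrix

theorem lintegral_fin_pi_prod {E : Type*} [MeasureSpace E] [SigmaFinite (volume : Measure E)]
    {n : ℕ} {f : Fin n → E → ℝ≥0∞} (hf : ∀ i, Measurable (f i)) :
    ∫⁻ x : Fin n → E, ∏ i, f i (x i) = ∏ i, ∫⁻ y, f i y := by
  induction n with
  | zero =>
    simp only [Finset.univ_eq_empty, Finset.prod_empty, lintegral_one]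
    rw [Measure.volume_pi_eq_dirac]
    simp
  | succ n ih =>
    have hm : Measurable fun x : Fin (n + 1) → E => ∏ i, f i (x i) :=
      Finset.measurable_prod _ fun i _ => (hf i).comp (measurable_pi_apply i)
    rw [lintegral_fin_cons hm, Fin.prod_univ_succ, ← ih fun i => hf i.succ]
    simp only [Fin.prod_univ_succ, Fin.cons_zero, Fin.cons_succ]
    exact lintegral_prod_mul (μ := (volume : Measure E)) (ν := (volume : Measure (Fin n → E)))
      (hf 0).aemeasurable
      (Finset.measurable_prod Finset.univ fun (i : Fin n) _ =>
        (hf i.succ).comp (measurable_pi_apply i)).aemeasurable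

theorem pi_withDensity {E : Type*} [MeasureSpace E] [SigmaFinite (volume : Measure E)]
    {n : ℕ} {f : E → ℝ≥0∞} (hf : Measurable f) [SigmaFinite ((volume : Measure E).withDensity f)] :
    Measure.pi (fun _ : Fin n => (volume : Measure E).withDensity f)
      = (volume : Measure (Fin n → E)).withDensity fun x => ∏ i, f (x i) := by
  refine Measure.pi_eq fun s hs => ?_
  rw [withDensity_apply _ (MeasurableSet.univ_pi hs), ← lintegral_indicator (MeasurableSet.univ_pi hs)]
  have h : ∀ x : Fin n → E, (Set.univ.pi s).indicator (fun x => ∏ i, f (x i)) x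
      = ∏ i, (s i).indicator f (x i) := by
    intro x
    by_cases hx : x ∈ Set.univ.pi s
    · rw [Set.indicator_of_mem hx]
      exact Finset.prod_congr rfl fun i _ => (Set.indicator_of_mem (hx i trivial) _).symm
    · rw [Set.indicator_of_notMem hx]
      simp only [Set.mem_pi, Set.mem_univ, true_implies, not_forall] at hx
      obtain ⟨i, hi⟩ := hx
      exact (Finset.prod_eq_zero (Finset.mem_univ i) (Set.indicator_of_notMem hi _)).symm
  simp only [h]
  rw [lintegral_fin_pi_prod fun i => hf.indicator (hs i)]
  exact Finset.prod_congr rfl fun i _ => by rw [lintegral_indicator (hs i), withDensity_apply _ (hs i)]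

variable {n : ℕ}

/-- The squared Hilbert–Schmidt norm. -/
def hsNormSq (A : Matrix (Fin n) (Fin n) ℂ) : ℝ := ∑ i, ∑ j, ‖A i j‖ ^ 2

theorem hsNormSq_eq_trace (A : Matrix (Fin n) (Fin n) ℂ) :
    hsNormSq A = (A * Aᴴ).trace.re := by
  simp only [hsNormSq, trace, diag_apply, Matrix.mul_apply, conjTranspose_apply, Complex.re_sum]
  refine Finset.sum_congr rfl fun i _ => Finset.sum_congr rfl fun j _ => ?_
  rw [Complex.star_def, Complex.mul_conj, Complex.ofReal_re, Complex.normSq_eq_norm_sq]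

theorem continuous_hsNormSq : Continuous fun A : Matrix (Fin n) (Fin n) ℂ => hsNormSq A := by
  unfold hsNormSq
  fun_prop

theorem map_complexGaussianMatrix {Ω : Type*} [MeasurableSpace Ω] {P : Measure Ω}
    [IsProbabilityMeasure P] (hn : 1 ≤ n) {G : Ω → Matrix (Fin n) (Fin n) ℂ}
    (hG : IsComplexGaussianMatrix P G) :
    Measurable G ∧ P.map G = (volume : Measure (Matrix (Fin n) (Fin n) ℂ)).withDensity fun A =>
      ENNReal.ofReal ((Real.pi⁻¹) ^ (n * n) * Real.exp (-hsNormSq A)) := by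
  have hGm : Measurable G :=
    measurable_pi_iff.2 fun i => measurable_pi_iff.2 fun j => hG.measurable_entry i j
  refine ⟨hGm, ?_⟩
  -- Total mass one is read off from the law of an entry instead of a Gaussian integral; an entry
  -- exists because `1 ≤ n`.
  have hprob : IsProbabilityMeasure stdComplexGaussian := by
    rw [← hG.law_entry ⟨0, hn⟩ ⟨0, hn⟩]
    exact Measure.isProbabilityMeasure_map (hG.measurable_entry _ _).aemeasurable
  let f : ℂ → ℝ≥0∞ := fun z => ENNReal.ofReal (Real.pi⁻¹ * Real.exp (-‖z‖ ^ 2))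
  have hf : Measurable f := by fun_prop
  have h1 : P.map (fun ω (ij : Fin n × Fin n) => G ω ij.1 ij.2)
      = Measure.pi fun _ : Fin n × Fin n => stdComplexGaussian := by
    have h := (iIndepFun_iff_map_fun_eq_pi_map
      (fun ij : Fin n × Fin n => (hG.measurable_entry ij.1 ij.2).aemeasurable)).1 hG.indep_entries
    simp only [hG.law_entry] at h
    exact h
  have h2 := Measure.infinitePi_map_curry (ι := Fin n) (κ := Fin n)
    (fun (_ : Fin n) (_ : Fin n) => stdComplexGaussian)
  simp only [Measure.infinitePi_eq_pi] at h2
  have hpm : Measurable fun ω (ij : Fin n × Fin n) => G ω ij.1 ij.2 :=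
    measurable_pi_iff.2 fun ij => hG.measurable_entry ij.1 ij.2
  rw [← h1, Measure.map_map (MeasurableEquiv.measurable _) hpm] at h2
  have h3 : P.map G = Measure.pi fun _ : Fin n => Measure.pi fun _ : Fin n => stdComplexGaussian :=
    h2
  have : IsProbabilityMeasure ((volume : Measure ℂ).withDensity f) := hprob
  have h4 : (Measure.pi fun _ : Fin n => stdComplexGaussian)
      = (volume : Measure (Fin n → ℂ)).withDensity fun x => ∏ i, f (x i) := pi_withDensity hf
  have : IsProbabilityMeasure ((volume : Measure (Fin n → ℂ)).withDensity fun x => ∏ i, f (x i)) := by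
    rw [← h4]
    infer_instance
  rw [h3]
  simp only [h4]
  have h5 := pi_withDensity (n := n) (f := fun x : Fin n → ℂ => ∏ i, f (x i))
    (Finset.measurable_prod _ fun i _ => hf.comp (measurable_pi_apply i))
  refine h5.trans ?_
  have h6 : (fun x : Fin n → Fin n → ℂ => ∏ i, ∏ j, f (x i j)) = fun A =>
      ENNReal.ofReal ((Real.pi⁻¹) ^ (n * n) * Real.exp (-hsNormSq (Matrix.of A))) := by
    funext A
    have hp : ∀ z : ℂ, 0 ≤ Real.pi⁻¹ * Real.exp (-‖z‖ ^ 2) := fun z => by positivity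
    simp only [f]
    simp_rw [← ENNReal.ofReal_prod_of_nonneg (fun j _ => hp _)]
    rw [← ENNReal.ofReal_prod_of_nonneg (fun i _ => Finset.prod_nonneg fun j _ => hp _)]
    congr 1
    simp only [Finset.prod_mul_distrib, Finset.prod_const, Finset.card_univ, Fintype.card_fin,
      ← Real.exp_sum, hsNormSq, of_apply, Finset.sum_neg_distrib, ← pow_mul]
  rw [h6]
  rfl

theorem gramDet_conjTranspose (M : Matrix (Fin n) (Fin n) ℂ) : gramDet Mᴴ = gramDet M := by
  rw [gramDet, gramDet, conjTranspose_conjTranspose, det_one_add_mul_comm]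

/-- The Gaussian weight `exp (-tr A Aᴴ)` up to a constant. -/
def gaussWeight (K : ℝ) (A : Matrix (Fin n) (Fin n) ℂ) : ℝ≥0∞ :=
  ENNReal.ofReal (K * Real.exp (-hsNormSq A))

theorem measurable_gaussWeight (K : ℝ) :
    Measurable (gaussWeight K : Matrix (Fin n) (Fin n) ℂ → ℝ≥0∞) :=
  ((continuous_hsNormSq.measurable.neg.exp).const_mul K).ennreal_ofReal

theorem measurable_detWeight :
    Measurable fun A : Matrix (Fin n) (Fin n) ℂ => ENNReal.ofReal (‖A.det‖ ^ 2) ^ n := by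
  have : Continuous fun A : Matrix (Fin n) (Fin n) ℂ => ‖A.det‖ ^ 2 := by fun_prop
  exact this.measurable.ennreal_ofReal.pow_const n

/-- The exponents add up to `tr A (1 + M Mᴴ) Aᴴ`, the squared norm of `A Lᴴ`. -/
theorem gaussWeight_mul_gaussWeight {K : ℝ} (hK : 0 ≤ K) (A M : Matrix (Fin n) (Fin n) ℂ)
    {L : Matrix (Fin n) (Fin n) ℂ} (hL : 1 + Mᴴᴴ * Mᴴ = Lᴴ * L) :
    gaussWeight K A * gaussWeight K (A * M) = gaussWeight (K * K) (A * Lᴴ) := by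
  rw [gaussWeight, gaussWeight, gaussWeight, ← ENNReal.ofReal_mul (by positivity)]
  have h : hsNormSq (A * Lᴴ) = hsNormSq A + hsNormSq (A * M) := by
    simp only [hsNormSq_eq_trace]
    rw [← Complex.add_re, ← trace_add]
    congr 2
    rw [conjTranspose_mul, conjTranspose_conjTranspose, Matrix.mul_assoc, ← Matrix.mul_assoc Lᴴ,
      ← hL, conjTranspose_mul, conjTranspose_conjTranspose]
    simp only [Matrix.mul_add, Matrix.add_mul, Matrix.mul_assoc, Matrix.one_mul]
  rw [h, neg_add, Real.exp_add]
  congr 1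
  ring

/-- Replacing `A Lᴴ` by `A` produces `gramDet M` to the power `-n` twice: from the Jacobian and from
the weight `|det A|^(2n)`. -/
theorem lintegral_detWeight_mul_gaussWeight {K : ℝ} (hK : 0 ≤ K) (M : Matrix (Fin n) (Fin n) ℂ) :
    ∫⁻ A : Matrix (Fin n) (Fin n) ℂ, ENNReal.ofReal (‖A.det‖ ^ 2) ^ n *
        (gaussWeight K A * gaussWeight K (A * M))
      = gramDensity (n + n) M * ∫⁻ A : Matrix (Fin n) (Fin n) ℂ,
        ENNReal.ofReal (‖A.det‖ ^ 2) ^ n * gaussWeight (K * K) A := by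
  obtain ⟨L, hL, hLd⟩ := exists_conjTranspose_mul_self_eq Mᴴ
  rw [gramDet_conjTranspose] at hLd
  have hg := gramDet_pos M
  have hdet : ‖(Lᴴ).det‖ ^ 2 = gramDet M := by rw [det_conjTranspose, norm_star, hLd]
  have hd0 : (Lᴴ).det ≠ 0 := by
    intro h
    rw [h] at hdet
    simp at hdet
    exact hg.ne hdet
  have hk : Measurable fun A : Matrix (Fin n) (Fin n) ℂ =>
      ENNReal.ofReal (‖A.det‖ ^ 2) ^ n * gaussWeight (K * K) A :=
    measurable_detWeight.mul (measurable_gaussWeight _)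
  have h1 := lintegral_comp_mul_right Lᴴ hd0 hk
  rw [← h1, hdet]
  have h2 : ∀ A : Matrix (Fin n) (Fin n) ℂ,
      ENNReal.ofReal (‖(A * Lᴴ).det‖ ^ 2) ^ n * gaussWeight (K * K) (A * Lᴴ)
      = ENNReal.ofReal (gramDet M) ^ n * (ENNReal.ofReal (‖A.det‖ ^ 2) ^ n *
        (gaussWeight K A * gaussWeight K (A * M))) := by
    intro A
    rw [gaussWeight_mul_gaussWeight hK A M hL, det_mul, norm_mul, mul_pow, hdet,
      ENNReal.ofReal_mul (by positivity), mul_pow]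
    ring
  simp only [h2]
  have hne : ENNReal.ofReal (gramDet M) ^ n ≠ ⊤ := ENNReal.pow_ne_top ENNReal.ofReal_ne_top
  have h0 : ENNReal.ofReal (gramDet M) ^ n ≠ 0 := by positivity
  rw [lintegral_const_mul' _ _ hne, ← mul_assoc, ← mul_assoc, gramDensity, pow_add,
    ENNReal.ofReal_inv_of_pos (by positivity), ENNReal.ofReal_mul (by positivity),
    ENNReal.ofReal_pow hg.le]
  set x := ENNReal.ofReal (gramDet M) ^ n
  have hy := ENNReal.inv_mul_cancel (mul_ne_zero h0 h0) (ENNReal.mul_ne_top hne hne)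
  generalize (x * x)⁻¹ = y at hy ⊢
  refine (one_mul _).symm.trans ?_
  rw [← hy]
  ring

/-- For fixed invertible `A` put `B = A M`, with Jacobian `|det A|^(2n)`, and then integrate over
`A` first. -/
theorem lintegral_inv_mul_gaussWeight {K : ℝ} (hK : 0 ≤ K) {F : Matrix (Fin n) (Fin n) ℂ → ℝ≥0∞}
    (hF : Measurable F) :
    ∫⁻ A : Matrix (Fin n) (Fin n) ℂ, gaussWeight K A *
        ∫⁻ B : Matrix (Fin n) (Fin n) ℂ, gaussWeight K B * F (A⁻¹ * B)
      = (∫⁻ A : Matrix (Fin n) (Fin n) ℂ, ENNReal.ofReal (‖A.det‖ ^ 2) ^ n *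
          gaussWeight (K * K) A) * ∫⁻ M, F M * gramDensity (n + n) M := by
  have hmul : Continuous fun p : Matrix (Fin n) (Fin n) ℂ × Matrix (Fin n) (Fin n) ℂ =>
      p.1 * p.2 := by fun_prop
  have hmulA : ∀ A : Matrix (Fin n) (Fin n) ℂ, Measurable fun B => A * B := fun A => by
    apply Continuous.measurable
    fun_prop
  have hmulB : ∀ M : Matrix (Fin n) (Fin n) ℂ, Measurable fun A => A * M := fun A => by
    apply Continuous.measurable
    fun_prop
  have hgm := measurable_gaussWeight (n := n) K
  have h3 : Measurable fun p : Matrix (Fin n) (Fin n) ℂ × Matrix (Fin n) (Fin n) ℂ =>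
      F p.2 * (ENNReal.ofReal (‖p.1.det‖ ^ 2) ^ n * (gaussWeight K p.1 *
        gaussWeight K (p.1 * p.2))) :=
    (hF.comp measurable_snd).mul ((measurable_detWeight.comp measurable_fst).mul
      ((hgm.comp measurable_fst).mul (hgm.comp hmul.measurable)))
  calc _ = ∫⁻ A : Matrix (Fin n) (Fin n) ℂ, ∫⁻ M : Matrix (Fin n) (Fin n) ℂ,
        F M * (ENNReal.ofReal (‖A.det‖ ^ 2) ^ n * (gaussWeight K A * gaussWeight K (A * M))) := by
        refine lintegral_congr_ae ?_
        filter_upwards [ae_det_ne_zero (n := n)] with A hA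
        have h1 : Measurable fun B : Matrix (Fin n) (Fin n) ℂ =>
            gaussWeight K B * F (A⁻¹ * B) := hgm.mul (hF.comp (hmulA _))
        have h2 : Measurable fun M : Matrix (Fin n) (Fin n) ℂ =>
            gaussWeight K (A * M) * F (A⁻¹ * (A * M)) := h1.comp (hmulA A)
        rw [← lintegral_comp_mul_left A hA h1, ← lintegral_const_mul _ h2,
          ← lintegral_const_mul _ (h2.const_mul _)]
        refine lintegral_congr fun M => ?_
        rw [← Matrix.mul_assoc, Matrix.nonsing_inv_mul _ (isUnit_iff_ne_zero.2 hA), Matrix.one_mul]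
        ring
    _ = ∫⁻ M : Matrix (Fin n) (Fin n) ℂ, ∫⁻ A : Matrix (Fin n) (Fin n) ℂ,
        F M * (ENNReal.ofReal (‖A.det‖ ^ 2) ^ n * (gaussWeight K A * gaussWeight K (A * M))) :=
        lintegral_lintegral_swap h3.aemeasurable
    _ = _ := by
        have h4 : Measurable fun M : Matrix (Fin n) (Fin n) ℂ => F M * gramDensity (n + n) M :=
          hF.mul (measurable_gramDensity _)
        rw [mul_comm, ← lintegral_mul_const _ h4]
        refine lintegral_congr fun M => ?_
        have hk : Measurable fun A : Matrix (Fin n) (Fin n) ℂ =>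
            ENNReal.ofReal (‖A.det‖ ^ 2) ^ n * (gaussWeight K A * gaussWeight K (A * M)) :=
          measurable_detWeight.mul (hgm.mul (hgm.comp (hmulB M)))
        rw [lintegral_const_mul _ hk, lintegral_detWeight_mul_gaussWeight hK, mul_assoc]

/-- The law of `G₁⁻¹ G₂` for independent Gaussian matrices. -/
theorem lintegral_inv_mul_gaussian {Ω : Type*} [MeasurableSpace Ω] {P : Measure Ω}
    [IsProbabilityMeasure P] (hn : 1 ≤ n) {G₁ G₂ : Ω → Matrix (Fin n) (Fin n) ℂ}
    (hG₁ : IsComplexGaussianMatrix P G₁) (hG₂ : IsComplexGaussianMatrix P G₂)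
    (hindep : IndepFun G₁ G₂ P) : ∃ c : ℝ≥0∞, ∀ F : Matrix (Fin n) (Fin n) ℂ → ℝ≥0∞,
      Measurable F → ∫⁻ ω, F ((G₁ ω)⁻¹ * G₂ ω) ∂P = c * ∫⁻ M, F M * gramDensity (n + n) M := by
  obtain ⟨hm₁, hl₁⟩ := map_complexGaussianMatrix hn hG₁
  obtain ⟨hm₂, hl₂⟩ := map_complexGaussianMatrix hn hG₂
  refine ⟨_, fun F hF => Eq.trans ?_
    (lintegral_inv_mul_gaussWeight (K := (Real.pi⁻¹) ^ (n * n)) (by positivity) hF)⟩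
  have hjoint := (indepFun_iff_map_prod_eq_prod_map_map hm₁.aemeasurable hm₂.aemeasurable).1 hindep
  have hmul : Continuous fun p : Matrix (Fin n) (Fin n) ℂ × Matrix (Fin n) (Fin n) ℂ =>
      p.1 * p.2 := by fun_prop
  have hF' : Measurable fun p : Matrix (Fin n) (Fin n) ℂ × Matrix (Fin n) (Fin n) ℂ =>
      F (p.1⁻¹ * p.2) :=
    hF.comp (hmul.measurable.comp ((measurable_matrix_inv.comp measurable_fst).prodMk
      measurable_snd))
  have h1 := lintegral_map (μ := P) hF' (hm₁.prodMk hm₂)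
  rw [← h1, hjoint]
  have : IsProbabilityMeasure (P.map G₁) := Measure.isProbabilityMeasure_map hm₁.aemeasurable
  have : IsProbabilityMeasure (P.map G₂) := Measure.isProbabilityMeasure_map hm₂.aemeasurable
  rw [lintegral_prod _ hF'.aemeasurable]
  have hgm := measurable_gaussWeight (n := n) ((Real.pi⁻¹) ^ (n * n))
  have hin : Measurable fun A : Matrix (Fin n) (Fin n) ℂ => ∫⁻ B, F (A⁻¹ * B) ∂(P.map G₂) :=
    Measurable.lintegral_prod_right' hF'
  have h5 : ∀ A : Matrix (Fin n) (Fin n) ℂ, ∫⁻ B, F (A⁻¹ * B) ∂(P.map G₂)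
      = ∫⁻ B, gaussWeight ((Real.pi⁻¹) ^ (n * n)) B * F (A⁻¹ * B) := by
    intro A
    have hA : Measurable fun B : Matrix (Fin n) (Fin n) ℂ => F (A⁻¹ * B) :=
      Measurable.of_uncurry_left (f := fun A B : Matrix (Fin n) (Fin n) ℂ => F (A⁻¹ * B)) hF'
    rw [hl₂]
    exact lintegral_withDensity_eq_lintegral_mul _ hgm hA
  calc ∫⁻ A, ∫⁻ B, F (A⁻¹ * B) ∂(P.map G₂) ∂(P.map G₁)
      = ∫⁻ A, gaussWeight ((Real.pi⁻¹) ^ (n * n)) A * ∫⁻ B, F (A⁻¹ * B) ∂(P.map G₂) := by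
        rw [hl₁]
        exact lintegral_withDensity_eq_lintegral_mul _ hgm hin
    _ = _ := by simp only [h5]

/-- The eigenvalues of `G₁⁻¹ G₂` have joint density proportional to the spherical weight. -/
theorem lintegral_roots_inv_mul_gaussian {Ω : Type*} [MeasurableSpace Ω] {P : Measure Ω}
    [IsProbabilityMeasure P] (hn : 1 ≤ n) {G₁ G₂ : Ω → Matrix (Fin n) (Fin n) ℂ}
    (hG₁ : IsComplexGaussianMatrix P G₁) (hG₂ : IsComplexGaussianMatrix P G₂)
    (hindep : IndepFun G₁ G₂ P) : ∃ c : ℝ≥0∞, ∀ Φ : Multiset ℂ → ℝ≥0∞,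
      Measurable (fun z : Fin n → ℂ => Φ (Finset.univ.val.map z)) →
        ∫⁻ ω, Φ ((G₁ ω)⁻¹ * G₂ ω).charpoly.roots ∂P
          = c * ∫⁻ z : Fin n → ℂ, Φ (Finset.univ.val.map z) *
            ENNReal.ofReal (sphericalWeight n z) := by
  obtain ⟨c₁, h₁⟩ := lintegral_inv_mul_gaussian hn hG₁ hG₂ hindep
  -- The exponent `2n` is `γ + n` with `γ = n`, and `eigenvalueWeight n n` is `sphericalWeight n` by
  -- definition.
  obtain ⟨c₂, h₂⟩ := lintegral_roots_charpoly n n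
  refine ⟨c₁ * c₂, fun Φ hΦ => ?_⟩
  rw [h₁ _ (measurable_roots_charpoly hΦ), h₂ Φ hΦ, mul_assoc]
  rfl

end GaussianLaw

/-! ### Zeros of the pencil as a counting measure of eigenvalues. -/

section PencilZeros

open Matrix

variable {n : ℕ}

theorem measurable_coe_onePoint : Measurable fun z : ℂ => (z : OnePoint ℂ) :=
  OnePoint.continuous_coe.measurable

theorem pencilPoly_eq_C_det_mul_charpoly {A : Matrix (Fin n) (Fin n) ℂ} (hA : A.det ≠ 0)
    (B : Matrix (Fin n) (Fin n) ℂ) : pencilPoly A B = C A.det * (A⁻¹ * B).charpoly := by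
  refine Polynomial.funext fun z => ?_
  rw [pencilPoly_eval, eval_mul, eval_C, eval_charpoly, ← det_mul, Matrix.mul_sub,
    ← Matrix.mul_assoc, Matrix.mul_nonsing_inv _ (isUnit_iff_ne_zero.2 hA), Matrix.one_mul]
  congr 2
  ext i j
  simp [mul_comm]

/-- The counting measure on the sphere of a finite configuration of points of the plane. -/
def countingMeasure (s : Multiset ℂ) : Measure (OnePoint ℂ) :=
  (s.map fun z : ℂ => Measure.dirac (z : OnePoint ℂ)).sum

theorem pencilZeros_eq_countingMeasure {A : Matrix (Fin n) (Fin n) ℂ} (hA : A.det ≠ 0)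
    (B : Matrix (Fin n) (Fin n) ℂ) :
    pencilZeros A B = countingMeasure (A⁻¹ * B).charpoly.roots := by
  rw [pencilZeros, pencilPoly_eq_C_det_mul_charpoly hA, roots_C_mul _ hA, natDegree_C_mul hA,
    charpoly_natDegree_eq_dim, Fintype.card_fin, Nat.sub_self, zero_smul, add_zero,
    countingMeasure]

theorem natDegree_pencilPoly_le (A B : Matrix (Fin n) (Fin n) ℂ) :
    (pencilPoly A B).natDegree ≤ n := by
  have h := natDegree_det_X_add_C_le A (-B)
  rw [Fintype.card_fin] at h
  have h2 : pencilPoly A B = det ((X : ℂ[X]) • A.map C + (-B).map C) := by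
    rw [pencilPoly, sub_eq_add_neg]
    congr 2
    ext i j
    simp
  rwa [h2]

theorem measurable_pencilZeros {Ω : Type*} [MeasurableSpace Ω]
    {G₁ G₂ : Ω → Matrix (Fin n) (Fin n) ℂ} (h₁ : Measurable G₁) (h₂ : Measurable G₂) :
    Measurable fun ω => pencilZeros (G₁ ω) (G₂ ω) := by
  have hm : ∀ z : ℂ, Measurable fun ω => (pencilPoly (G₁ ω) (G₂ ω)).eval z := by
    intro z
    simp only [pencilPoly_eval]
    have hc : Continuous fun p : Matrix (Fin n) (Fin n) ℂ × Matrix (Fin n) (Fin n) ℂ =>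
        (z • p.1 - p.2).det := by fun_prop
    exact hc.measurable.comp (h₁.prodMk h₂)
  have hn : ∀ ω, (pencilPoly (G₁ ω) (G₂ ω)).natDegree ≤ n :=
    fun ω => natDegree_pencilPoly_le _ _
  have h3 := measurable_dirac_roots hn hm measurable_coe_onePoint
  have h4 := measurable_natDegree_of_measurable_eval hn hm
  refine h3.add ?_
  exact (measurable_from_nat (f := fun d : ℕ =>
    (n - d) • Measure.dirac (OnePoint.infty : OnePoint ℂ))).comp h4

theorem countingMeasure_apply (s : Multiset ℂ) {B : Set (OnePoint ℂ)} (hB : MeasurableSet B) :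
    countingMeasure s B = (s.map fun z : ℂ => B.indicator 1 (z : OnePoint ℂ)).sum := by
  unfold countingMeasure
  induction s using Multiset.induction_on with
  | empty => simp
  | cons a s ih =>
    rw [Multiset.map_cons, Multiset.sum_cons, Measure.add_apply, ih, Multiset.map_cons,
      Multiset.sum_cons, Measure.dirac_apply' _ hB]

theorem countingMeasure_singleton (s : Multiset ℂ) (w : ℂ) :
    countingMeasure s {(w : OnePoint ℂ)} = s.count w := by
  rw [countingMeasure_apply s (measurableSet_singleton _)]
  induction s using Multiset.induction_on with
  | empty => simp
  | cons a s ih =>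
    rw [Multiset.map_cons, Multiset.sum_cons, ih, Multiset.count_cons]
    by_cases h : w = a
    · simp [h, add_comm]
    · have h' : (a : OnePoint ℂ) ≠ w := fun e => h (OnePoint.coe_injective e).symm
      simp [h, h']

/-- Masses of singletons are multiplicities. Therefore any listing of the points determines the
multiset of eigenvalues. -/
theorem countingMeasure_injective : Function.Injective countingMeasure := by
  intro s t h
  refine Multiset.ext.2 fun w => ?_
  have h1 := countingMeasure_singleton s w
  rw [h, countingMeasure_singleton t w] at h1
  exact_mod_cast h1.symm

theorem countingMeasure_map_univ (z : Fin n → ℂ) :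
    countingMeasure (Finset.univ.val.map z) = ∑ i, Measure.dirac (z i : OnePoint ℂ) := by
  rw [countingMeasure, Multiset.map_map]
  rfl

theorem countingMeasure_eq_sum_of_nodup {s : Multiset ℂ} (hs : s.Nodup) :
    ∃ t : Set (OnePoint ℂ), t.Finite ∧
      countingMeasure s = Measure.sum fun x : t => Measure.dirac (x : OnePoint ℂ) := by
  classical
  let f : ℂ ↪ OnePoint ℂ := ⟨fun z => (z : OnePoint ℂ), OnePoint.coe_injective⟩
  let u : Finset (OnePoint ℂ) := (⟨s, hs⟩ : Finset ℂ).map f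
  refine ⟨u, u.finite_toSet, ?_⟩
  rw [Measure.sum_fintype]
  have h := Finset.sum_coe_sort u fun x => Measure.dirac (x : OnePoint ℂ)
  refine Eq.trans ?_ h.symm
  rw [Finset.sum_map]
  rfl

theorem measurable_inv_mul : Measurable fun p : Matrix (Fin n) (Fin n) ℂ × Matrix (Fin n) (Fin n) ℂ =>
    p.1⁻¹ * p.2 := by
  have hmul : Measurable fun p : Matrix (Fin n) (Fin n) ℂ × Matrix (Fin n) (Fin n) ℂ =>
      p.1 * p.2 := by
    apply Continuous.measurable
    fun_prop
  have hp : Measurable fun p : Matrix (Fin n) (Fin n) ℂ × Matrix (Fin n) (Fin n) ℂ =>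
      (p.1⁻¹, p.2) := (measurable_matrix_inv.comp measurable_fst).prodMk measurable_snd
  exact hmul.comp hp

theorem exists_measurable_charpoly_roots (n : ℕ) :
    ∃ R : Matrix (Fin n) (Fin n) ℂ → Fin n → ℂ, Measurable R ∧
      ∀ M, Finset.univ.val.map (R M) = M.charpoly.roots :=
  exists_measurable_roots (fun M => M.charpoly_monic) (fun M => by simp) fun z => by
    simp only [eval_charpoly]
    exact (continuous_const.sub continuous_id).matrix_det.measurable

section Random

variable {Ω : Type*} [MeasurableSpace Ω] {P : Measure Ω} [IsProbabilityMeasure P]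
  {G₁ G₂ : Ω → Matrix (Fin n) (Fin n) ℂ}

theorem ae_det_gaussian_ne_zero (hn : 1 ≤ n) {G : Ω → Matrix (Fin n) (Fin n) ℂ}
    (hG : IsComplexGaussianMatrix P G) : ∀ᵐ ω ∂P, (G ω).det ≠ 0 := by
  obtain ⟨hm, hl⟩ := map_complexGaussianMatrix hn hG
  have h1 : ∀ᵐ A ∂(P.map G), A.det ≠ 0 := by
    rw [hl]
    exact (withDensity_absolutelyContinuous _ _).ae_le (ae_det_ne_zero (n := n))
  exact ae_of_ae_map hm.aemeasurable h1

theorem ae_pencilZeros_eq (hn : 1 ≤ n) (hG₁ : IsComplexGaussianMatrix P G₁) :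
    ∀ᵐ ω ∂P, pencilZeros (G₁ ω) (G₂ ω) = countingMeasure ((G₁ ω)⁻¹ * G₂ ω).charpoly.roots := by
  filter_upwards [ae_det_gaussian_ne_zero hn hG₁] with ω hω
  exact pencilZeros_eq_countingMeasure hω _

theorem exists_isEnumeration_pencilZeros (hn : 1 ≤ n) (hG₁ : IsComplexGaussianMatrix P G₁)
    (hG₂ : IsComplexGaussianMatrix P G₂) :
    ∃ Z : Ω → Fin n → ℂ, IsEnumeration P (fun ω => pencilZeros (G₁ ω) (G₂ ω)) Z := by
  have hm₁ := (map_complexGaussianMatrix hn hG₁).1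
  have hm₂ := (map_complexGaussianMatrix hn hG₂).1
  obtain ⟨R, hR, hroots⟩ := exists_measurable_charpoly_roots n
  have hp : Measurable fun ω => (G₁ ω, G₂ ω) := hm₁.prodMk hm₂
  have hM : Measurable fun ω => (G₁ ω)⁻¹ * G₂ ω := by
    have h := measurable_inv_mul.comp hp
    simpa only [Function.comp_def] using h
  refine ⟨fun ω => R ((G₁ ω)⁻¹ * G₂ ω), hR.comp hM, ?_⟩
  filter_upwards [ae_pencilZeros_eq hn hG₁] with ω hω
  rw [hω, ← countingMeasure_map_univ, hroots]

theorem IsEnumeration.ae_map_eq_roots (hn : 1 ≤ n) (hG₁ : IsComplexGaussianMatrix P G₁)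
    {Z : Ω → Fin n → ℂ} (hZ : IsEnumeration P (fun ω => pencilZeros (G₁ ω) (G₂ ω)) Z) :
    ∀ᵐ ω ∂P, Finset.univ.val.map (Z ω) = ((G₁ ω)⁻¹ * G₂ ω).charpoly.roots := by
  filter_upwards [ae_pencilZeros_eq (G₂ := G₂) hn hG₁, hZ.lists] with ω h1 h2
  rw [h1, ← countingMeasure_map_univ] at h2
  exact (countingMeasure_injective h2).symm

end Random

end PencilZeros

/-! ### Simplicity of the process and the exchangeable joint density. -/

section JointDensity

open Matrix

variable {n : ℕ}

theorem sphericalWeight_eq_vandermonde (z : Fin n → ℂ) :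
    sphericalWeight n z
      = ‖(vandermonde z).det‖ ^ 2 * ∏ k, ((1 + ‖z k‖ ^ 2) ^ (n + 1))⁻¹ := by
  rw [sphericalWeight, det_vandermonde]

theorem measurable_sphericalWeight : Measurable fun z : Fin n → ℂ => sphericalWeight n z := by
  have : Continuous fun z : Fin n → ℂ => sphericalWeight n z := continuous_eigenvalueWeight n n
  exact this.measurable

theorem sphericalWeight_comp_perm (z : Fin n → ℂ) (σ : Equiv.Perm (Fin n)) :
    sphericalWeight n (z ∘ σ) = sphericalWeight n z := by
  simp only [sphericalWeight_eq_vandermonde]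
  congr 1
  · have h : vandermonde (z ∘ σ) = (vandermonde z).submatrix σ id := rfl
    rw [h, det_permute, norm_mul]
    rcases Int.units_eq_one_or (Equiv.Perm.sign σ) with h | h <;> simp [h]
  · exact Equiv.prod_comp σ fun k => ((1 + ‖z k‖ ^ 2) ^ (n + 1))⁻¹

theorem sphericalWeight_eq_zero {z : Fin n → ℂ} (hz : ¬ Function.Injective z) :
    sphericalWeight n z = 0 := by
  rw [sphericalWeight_eq_vandermonde, not_ne_iff.1 (mt det_vandermonde_ne_zero_iff.1 hz)]
  simp

theorem lintegral_comp_perm {f : (Fin n → ℂ) → ℝ≥0∞} (σ : Equiv.Perm (Fin n)) :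
    ∫⁻ z, f (z ∘ σ) = ∫⁻ z, f z :=
  (volume_preserving_arrowCongr' σ.symm (MeasurableEquiv.refl ℂ)
    (MeasurePreserving.id volume)).lintegral_comp_emb (MeasurableEquiv.measurableEmbedding _) f

/-- Equal multisets give fibres of equal cardinality over each value; bijections between the fibres
glue to a permutation. -/
theorem exists_perm_of_map_univ_eq {α : Type*} {z w : Fin n → α}
    (h : Finset.univ.val.map z = Finset.univ.val.map w) :
    ∃ σ : Equiv.Perm (Fin n), z = w ∘ σ := by
  classical
  have hc : ∀ (v : Fin n → α) (a : α),
      Fintype.card {i // v i = a} = (Finset.univ.val.map v).count a := by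
    intro v a
    rw [Multiset.count_map, Fintype.card_subtype, Finset.card_def, Finset.filter_val]
    simp only [eq_comm]
  let e : ∀ a, {i // z i = a} ≃ {i // w i = a} := fun a =>
    Fintype.equivOfCardEq (by rw [hc, hc, h])
  exact ⟨Equiv.ofFiberEquiv e, funext fun i => (Equiv.ofFiberEquiv_map e i).symm⟩

theorem measurableSet_injective : MeasurableSet {z : Fin n → ℂ | Function.Injective z} := by
  have : {z : Fin n → ℂ | Function.Injective z} = ⋂ i, ⋂ j, ⋂ (_ : i ≠ j), {z | z i ≠ z j} := by
    ext z
    simp only [Set.mem_ofPred_eq, Set.mem_iInter, Function.Injective]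
    exact ⟨fun h i j hij e => hij (h e), fun h i j e => by_contra fun hij => h i j hij e⟩
  rw [this]
  refine MeasurableSet.iInter fun i => MeasurableSet.iInter fun j => MeasurableSet.iInter fun _ =>
    IsOpen.measurableSet (isOpen_ne_fun (continuous_apply i) (continuous_apply j))

section Random

variable {Ω : Type*} [MeasurableSpace Ω] {P : Measure Ω} [IsProbabilityMeasure P]
  {G₁ G₂ : Ω → Matrix (Fin n) (Fin n) ℂ}

theorem exists_lintegral_roots_eq_sphericalWeight (hn : 1 ≤ n)
    (hG₁ : IsComplexGaussianMatrix P G₁) (hG₂ : IsComplexGaussianMatrix P G₂)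
    (hindep : IndepFun G₁ G₂ P) : ∃ c : ℝ, 0 < c ∧ ∀ Φ : Multiset ℂ → ℝ≥0∞,
      Measurable (fun z : Fin n → ℂ => Φ (Finset.univ.val.map z)) →
        ∫⁻ ω, Φ ((G₁ ω)⁻¹ * G₂ ω).charpoly.roots ∂P
          = ∫⁻ z : Fin n → ℂ, Φ (Finset.univ.val.map z) *
            ENNReal.ofReal (c * sphericalWeight n z) := by
  obtain ⟨c, hc⟩ := lintegral_roots_inv_mul_gaussian hn hG₁ hG₂ hindep
  -- Testing with `1` gives `1 = c * ∫ weight`, which excludes `c = 0` and, since `⊤ * x` is `0` or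
  -- `⊤`, also `c = ⊤`.
  have h1 := hc (fun _ => 1) measurable_const
  simp only [lintegral_one, measure_univ, one_mul] at h1
  have hc0 : c ≠ 0 := by
    rintro rfl
    simp at h1
  have hct : c ≠ ⊤ := by
    rintro rfl
    rw [ENNReal.top_mul'] at h1
    split_ifs at h1 <;> simp at h1
  refine ⟨c.toReal, ENNReal.toReal_pos hc0 hct, fun Φ hΦ => ?_⟩
  have hw : Measurable fun z : Fin n → ℂ => Φ (Finset.univ.val.map z) *
      ENNReal.ofReal (sphericalWeight n z) := hΦ.mul measurable_sphericalWeight.ennreal_ofReal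
  rw [hc Φ hΦ, ← lintegral_const_mul _ hw]
  refine lintegral_congr fun z => ?_
  rw [ENNReal.ofReal_mul ENNReal.toReal_nonneg, ENNReal.ofReal_toReal hct]
  ring

theorem measurable_roots_inv_mul (h₁ : Measurable G₁) (h₂ : Measurable G₂)
    {Φ : Multiset ℂ → ℝ≥0∞}
    (hΦ : Measurable fun z : Fin n → ℂ => Φ (Finset.univ.val.map z)) :
    Measurable fun ω => Φ ((G₁ ω)⁻¹ * G₂ ω).charpoly.roots := by
  have h := (measurable_roots_charpoly hΦ).comp
    ((measurable_inv_mul (n := n)).comp (h₁.prodMk h₂))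
  simpa only [Function.comp_def] using h

/-- The test function that detects a repeated point is killed by the Vandermonde factor of the
density. -/
theorem ae_nodup_roots (hn : 1 ≤ n)
    (hG₁ : IsComplexGaussianMatrix P G₁) (hG₂ : IsComplexGaussianMatrix P G₂)
    (hindep : IndepFun G₁ G₂ P) : ∀ᵐ ω ∂P, ((G₁ ω)⁻¹ * G₂ ω).charpoly.roots.Nodup := by
  classical
  obtain ⟨c, -, hc⟩ := exists_lintegral_roots_eq_sphericalWeight hn hG₁ hG₂ hindep
  let Φ : Multiset ℂ → ℝ≥0∞ := fun s => if s.Nodup then 0 else 1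
  have hmap : ∀ z : Fin n → ℂ, (Finset.univ.val.map z).Nodup ↔ Function.Injective z := by
    intro z
    rw [Multiset.nodup_map_iff_inj_on Finset.univ.nodup]
    simp [Function.Injective]
  have hΦ : Measurable fun z : Fin n → ℂ => Φ (Finset.univ.val.map z) := by
    simp only [Φ, hmap]
    exact Measurable.ite measurableSet_injective measurable_const measurable_const
  have h := hc Φ hΦ
  have h0 : ∀ z : Fin n → ℂ, Φ (Finset.univ.val.map z) *
      ENNReal.ofReal (c * sphericalWeight n z) = 0 := by
    intro z
    by_cases hz : Function.Injective z
    · simp only [Φ]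
      rw [if_pos ((hmap z).2 hz), zero_mul]
    · simp [sphericalWeight_eq_zero hz]
  simp only [h0, lintegral_zero] at h
  have hm₁ := (map_complexGaussianMatrix hn hG₁).1
  have hm₂ := (map_complexGaussianMatrix hn hG₂).1
  have h2 := (lintegral_eq_zero_iff (measurable_roots_inv_mul hm₁ hm₂ hΦ)).1 h
  filter_upwards [h2] with ω hω
  by_contra hd
  simp [Φ, hd] at hω

theorem isSimplePointProcess_pencilZeros (hn : 1 ≤ n)
    (hG₁ : IsComplexGaussianMatrix P G₁) (hG₂ : IsComplexGaussianMatrix P G₂)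
    (hindep : IndepFun G₁ G₂ P) :
    IsSimplePointProcess P fun ω => pencilZeros (G₁ ω) (G₂ ω) where
  measurable := measurable_pencilZeros (map_complexGaussianMatrix hn hG₁).1
    (map_complexGaussianMatrix hn hG₂).1
  simple := by
    filter_upwards [ae_nodup_roots hn hG₁ hG₂ hindep, ae_pencilZeros_eq (G₂ := G₂) hn hG₁]
      with ω h1 h2
    obtain ⟨t, ht, hs⟩ := countingMeasure_eq_sum_of_nodup h1
    exact ⟨t, fun C _ => ht.subset Set.inter_subset_left, h2.trans hs⟩

theorem exists_exchangeableLaw_eq (hn : 1 ≤ n)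
    (hG₁ : IsComplexGaussianMatrix P G₁) (hG₂ : IsComplexGaussianMatrix P G₂)
    (hindep : IndepFun G₁ G₂ P) : ∃ c : ℝ, 0 < c ∧ ∀ Z : Ω → Fin n → ℂ,
      IsEnumeration P (fun ω => pencilZeros (G₁ ω) (G₂ ω)) Z →
        exchangeableLaw P Z =
          (volume : Measure (Fin n → ℂ)).withDensity
            fun z => ENNReal.ofReal (c * sphericalWeight n z) := by
  classical
  obtain ⟨c, hc0, hc⟩ := exists_lintegral_roots_eq_sphericalWeight hn hG₁ hG₂ hindep
  refine ⟨c, hc0, fun Z hZ => Measure.ext fun S hS => ?_⟩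
  have hcomp : ∀ σ : Equiv.Perm (Fin n), Measurable fun z : Fin n → ℂ => z ∘ σ := fun σ =>
    measurable_pi_iff.2 fun i => measurable_pi_apply (σ i)
  -- The average of the indicator of `S` over all orderings is symmetric, so it is a function of the
  -- multiset of eigenvalues, to which the integral formula applies.
  let g : (Fin n → ℂ) → ℝ≥0∞ := fun z =>
    (n.factorial : ℝ≥0∞)⁻¹ * ∑ σ : Equiv.Perm (Fin n), S.indicator 1 (z ∘ σ)
  have hterm : ∀ σ : Equiv.Perm (Fin n), Measurable fun z : Fin n → ℂ =>
      S.indicator (1 : (Fin n → ℂ) → ℝ≥0∞) (z ∘ σ) := fun σ =>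
    (measurable_one.indicator hS).comp (hcomp σ)
  have hg : Measurable g := (Finset.measurable_sum _ fun σ _ => hterm σ).const_mul _
  have hgs : ∀ (z : Fin n → ℂ) (τ : Equiv.Perm (Fin n)), g (z ∘ τ) = g z := by
    intro z τ
    simp only [g]
    congr 1
    exact Equiv.sum_comp (Equiv.mulLeft τ) fun σ : Equiv.Perm (Fin n) =>
      S.indicator (1 : (Fin n → ℂ) → ℝ≥0∞) (z ∘ σ)
  let Φ : Multiset ℂ → ℝ≥0∞ := fun s =>
    if h : ∃ z : Fin n → ℂ, Finset.univ.val.map z = s then g h.choose else 0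
  have hΦ : ∀ z : Fin n → ℂ, Φ (Finset.univ.val.map z) = g z := by
    intro z
    have h : ∃ w : Fin n → ℂ, Finset.univ.val.map w = Finset.univ.val.map z := ⟨z, rfl⟩
    simp only [Φ]
    rw [dif_pos h]
    obtain ⟨τ, hτ⟩ := exists_perm_of_map_univ_eq h.choose_spec
    rw [hτ, hgs]
  have h1 := hc Φ (by simpa only [hΦ] using hg)
  simp only [hΦ] at h1
  have h2 : ∫⁻ ω, Φ ((G₁ ω)⁻¹ * G₂ ω).charpoly.roots ∂P = ∫⁻ ω, g (Z ω) ∂P := by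
    refine lintegral_congr_ae ?_
    filter_upwards [hZ.ae_map_eq_roots hn hG₁] with ω hω
    rw [← hω, hΦ]
  rw [h2] at h1
  have hw : Measurable fun z : Fin n → ℂ => ENNReal.ofReal (c * sphericalWeight n z) :=
    (measurable_sphericalWeight.const_mul c).ennreal_ofReal
  have h3 : ∫⁻ ω, g (Z ω) ∂P = exchangeableLaw P Z S := by
    have hZσ : ∀ σ : Equiv.Perm (Fin n), Measurable fun ω => Z ω ∘ σ := fun σ =>
      (hcomp σ).comp hZ.measurable
    have hm : ∀ σ : Equiv.Perm (Fin n), Measurable fun ω =>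
        S.indicator (1 : (Fin n → ℂ) → ℝ≥0∞) (Z ω ∘ σ) := fun σ => (hterm σ).comp hZ.measurable
    simp only [g, exchangeableLaw]
    rw [lintegral_const_mul _ (Finset.measurable_sum _ fun σ _ => hm σ),
      lintegral_finsetSum _ fun σ _ => hm σ, Measure.smul_apply, Measure.coe_finsetSum,
      Finset.sum_apply, smul_eq_mul]
    congr 1
    refine Finset.sum_congr rfl fun σ _ => ?_
    rw [← lintegral_indicator_one hS, lintegral_map (measurable_one.indicator hS) (hZσ σ)]
  have h4 : ∫⁻ z : Fin n → ℂ, g z * ENNReal.ofReal (c * sphericalWeight n z)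
      = ∫⁻ z in S, ENNReal.ofReal (c * sphericalWeight n z) := by
    have hS1 : ∀ z : Fin n → ℂ, g z * ENNReal.ofReal (c * sphericalWeight n z)
        = (n.factorial : ℝ≥0∞)⁻¹ * ∑ σ : Equiv.Perm (Fin n),
          S.indicator (fun z => ENNReal.ofReal (c * sphericalWeight n z)) (z ∘ σ) := by
      intro z
      simp only [g]
      rw [mul_assoc, Finset.sum_mul]
      congr 1
      refine Finset.sum_congr rfl fun σ _ => ?_
      by_cases h : z ∘ σ ∈ S <;> simp [h, sphericalWeight_comp_perm]
    have hm : ∀ σ : Equiv.Perm (Fin n), Measurable fun z : Fin n → ℂ =>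
        S.indicator (fun z => ENNReal.ofReal (c * sphericalWeight n z)) (z ∘ σ) := fun σ =>
      (hw.indicator hS).comp (hcomp σ)
    simp only [hS1]
    rw [lintegral_const_mul _ (Finset.measurable_sum _ fun σ _ => hm σ),
      lintegral_finsetSum _ fun σ _ => hm σ]
    -- The weight and Lebesgue measure are symmetric, so all `n!` orderings contribute equally and
    -- cancel the normalization.
    have h5 : ∀ σ : Equiv.Perm (Fin n), ∫⁻ z : Fin n → ℂ,
        S.indicator (fun z => ENNReal.ofReal (c * sphericalWeight n z)) (z ∘ σ)
        = ∫⁻ z in S, ENNReal.ofReal (c * sphericalWeight n z) := fun σ => by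
      rw [← lintegral_indicator hS]
      exact lintegral_comp_perm (f := S.indicator fun z => ENNReal.ofReal (c * sphericalWeight n z)) σ
    simp only [h5, Finset.sum_const, Finset.card_univ, Fintype.card_perm, Fintype.card_fin,
      nsmul_eq_mul]
    rw [← mul_assoc, ENNReal.inv_mul_cancel (by exact_mod_cast n.factorial_ne_zero)
      (ENNReal.natCast_ne_top _), one_mul]
  rw [← h3, h1, h4, withDensity_apply _ hS]

end Random

end JointDensity

/-! ### Radial moments of the spherical measure. -/

section RadialMoments

open Filter Topology

theorem tendsto_inv_one_add_sq : Tendsto (fun y : ℝ => (1 + y ^ 2)⁻¹) atTop (𝓝 0) :=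
  tendsto_inv_atTop_zero.comp (tendsto_atTop_add_const_left _ _ (tendsto_pow_atTop two_ne_zero))

theorem pow_div_one_add_sq_pow_le {n j k : ℕ} (hj : j < n) {y : ℝ} :
    y ^ (2 * j) / (1 + y ^ 2) ^ (n + k) ≤ ((1 + y ^ 2)⁻¹) ^ (k + 1) := by
  have h1 : y ^ (2 * j) ≤ (1 + y ^ 2) ^ (n - 1) := by
    rw [pow_mul]
    calc (y ^ 2) ^ j ≤ (1 + y ^ 2) ^ j := by gcongr; linarith
      _ ≤ _ := pow_le_pow_right₀ (by nlinarith [sq_nonneg y]) (by omega)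
  rw [div_le_iff₀ (by positivity), inv_pow]
  have h2 : (1 + y ^ 2) ^ (n + k) = (1 + y ^ 2) ^ (k + 1) * (1 + y ^ 2) ^ (n - 1) := by
    rw [← pow_add]
    congr 1
    omega
  rw [h2, inv_mul_cancel_left₀ (by positivity)]
  exact h1

theorem tendsto_pow_div_one_add_sq_pow {n j : ℕ} (hj : j < n) :
    Tendsto (fun y : ℝ => y ^ (2 * j) / (1 + y ^ 2) ^ n) atTop (𝓝 0) := by
  refine squeeze_zero (fun y => div_nonneg (pow_mul y 2 j ▸ by positivity) (by positivity)) (fun y => ?_) tendsto_inv_one_add_sq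
  simpa using pow_div_one_add_sq_pow_le (k := 0) hj

theorem hasDerivAt_pow_div_one_add_sq_pow (n j : ℕ) (y : ℝ) :
    HasDerivAt (fun y : ℝ => y ^ (2 * j) / (1 + y ^ 2) ^ n)
      (2 * j * y ^ (2 * j - 1) / (1 + y ^ 2) ^ n
        - 2 * n * (y ^ (2 * j + 1) / (1 + y ^ 2) ^ (n + 1))) y := by
  have hpos : (1 + y ^ 2) ≠ 0 := by positivity
  have h1 : HasDerivAt (fun y : ℝ => 1 + y ^ 2) (2 * y) y := by
    simpa using (hasDerivAt_pow 2 y).const_add 1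
  have h2 := (hasDerivAt_pow (2 * j) y).fun_div (h1.fun_pow n) (pow_ne_zero n hpos)
  refine h2.congr_deriv ?_
  rcases n with _ | n
  · simp
  · simp only [Nat.add_sub_cancel]
    push_cast
    field_simp
    ring

theorem integrableOn_pow_div_one_add_sq_pow {n j : ℕ} (hj : j < n) :
    IntegrableOn (fun y : ℝ => y ^ (2 * j + 1) / (1 + y ^ 2) ^ (n + 1)) (Set.Ioi 0) := by
  -- The dominating function `2 y / (1 + y²)²` is the derivative of `-1 / (1 + y²)`.
  have h0 : IntegrableOn (fun y : ℝ => 2 * (y * ((1 + y ^ 2)⁻¹) ^ 2)) (Set.Ioi 0) := by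
    refine integrableOn_Ioi_deriv_of_nonneg' (g := fun y : ℝ => -(1 + y ^ 2)⁻¹) (l := -0)
      (fun y _ => ?_) (fun y hy => ?_) tendsto_inv_one_add_sq.neg
    · have h1 : HasDerivAt (fun y : ℝ => 1 + y ^ 2) (2 * y) y := by
        simpa using (hasDerivAt_pow 2 y).const_add 1
      refine (h1.inv (by positivity)).neg.congr_deriv ?_
      field_simp
    · have : 0 < y := hy
      positivity
  refine Integrable.mono' h0 ?_ ?_
  · refine Continuous.aestronglyMeasurable ?_
    exact (continuous_pow _).div (by fun_prop) fun y => by positivity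
  · filter_upwards [self_mem_ae_restrict measurableSet_Ioi] with y hy
    have hy : 0 < y := hy
    rw [Real.norm_of_nonneg (by positivity), pow_succ, mul_div_right_comm]
    have := pow_div_one_add_sq_pow_le (k := 1) (y := y) hj
    have h3 : 0 ≤ y * ((1 + y ^ 2)⁻¹) ^ 2 := by positivity
    calc _ ≤ ((1 + y ^ 2)⁻¹) ^ 2 * y := by gcongr
      _ ≤ _ := by linarith

/-- Write `I_j` for the integral. Integrating the derivative of `y^(2j+2) / (1 + y²)^n` over the
half-line gives `(j + 1) I_j = (n - j - 1) I_{j+1}`, which is the recurrence of inverse binomial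
coefficients. -/
theorem integral_pow_div_one_add_sq_pow {n j : ℕ} (hj : j < n) :
    ∫ y in Set.Ioi (0 : ℝ), y ^ (2 * j + 1) / (1 + y ^ 2) ^ (n + 1)
      = (2 * n * (n - 1).choose j : ℝ)⁻¹ := by
  have hn : (n : ℝ) ≠ 0 := by
    have : n ≠ 0 := by omega
    exact_mod_cast this
  induction j with
  | zero =>
    have h := integral_Ioi_of_hasDerivAt_of_tendsto' (a := 0) (m := 0)
      (fun y _ => hasDerivAt_pow_div_one_add_sq_pow n 0 y) (by
        simpa [IntegrableOn] using
          ((integrableOn_pow_div_one_add_sq_pow hj).const_mul (2 * (n : ℝ))).neg)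
      (tendsto_pow_div_one_add_sq_pow hj)
    simp only [Nat.cast_zero, mul_zero, zero_mul, zero_div, zero_sub] at h
    rw [integral_neg, integral_const_mul] at h
    simp only [Nat.choose_zero_right, Nat.cast_one, mul_one]
    refine eq_inv_of_mul_eq_one_left ?_
    simp at h ⊢
    linarith
  | succ j ih =>
    have ih := ih (by omega)
    have hI0 := integrableOn_pow_div_one_add_sq_pow (n := n) (j := j) (by omega)
    have hI1 := integrableOn_pow_div_one_add_sq_pow hj
    have hd : ∀ y : ℝ, HasDerivAt (fun y : ℝ => y ^ (2 * (j + 1)) / (1 + y ^ 2) ^ n)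
        (2 * (j + 1 : ℝ) * (y ^ (2 * j + 1) / (1 + y ^ 2) ^ (n + 1))
          - 2 * (n - (j + 1) : ℝ) * (y ^ (2 * (j + 1) + 1) / (1 + y ^ 2) ^ (n + 1))) y := by
      intro y
      refine (hasDerivAt_pow_div_one_add_sq_pow n (j + 1) y).congr_deriv ?_
      have hpos : (1 + y ^ 2) ≠ 0 := by positivity
      rw [show 2 * (j + 1) - 1 = 2 * j + 1 by omega]
      push_cast
      field_simp
      ring
    have h := integral_Ioi_of_hasDerivAt_of_tendsto' (a := 0) (m := 0) (fun y _ => hd y)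
      ((hI0.const_mul _).sub (hI1.const_mul _)) (tendsto_pow_div_one_add_sq_pow hj)
    rw [integral_sub (hI0.const_mul _) (hI1.const_mul _), integral_const_mul, integral_const_mul,
      ih] at h
    simp only [ne_eq, Nat.mul_eq_zero, OfNat.ofNat_ne_zero, Nat.add_eq_zero_iff, one_ne_zero,
      and_false, or_self, not_false_eq_true, zero_pow, zero_div, sub_zero] at h
    have hc := Nat.choose_succ_right_eq (n - 1) j
    have hc' : ((n - 1).choose (j + 1) : ℝ) * (j + 1) = (n - 1).choose j * (n - (j + 1)) := by
      have : ((n - 1 - j : ℕ) : ℝ) = n - (j + 1) := by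
        rw [Nat.sub_sub, Nat.cast_sub (by omega)]
        push_cast
        ring
      rw [← this]
      exact_mod_cast hc
    have hc0 : ((n - 1).choose j : ℝ) ≠ 0 := by
      have := Nat.choose_pos (n := n - 1) (k := j) (by omega)
      positivity
    have hc1 : ((n - 1).choose (j + 1) : ℝ) ≠ 0 := by
      have := Nat.choose_pos (n := n - 1) (k := j + 1) (by omega)
      positivity
    have hnj : (n - (j + 1) : ℝ) ≠ 0 := by
      have : ((j + 1 : ℕ) : ℝ) < n := by exact_mod_cast hj
      push_cast at this
      linarith
    generalize (∫ y in Set.Ioi (0 : ℝ), y ^ (2 * (j + 1) + 1) / (1 + y ^ 2) ^ (n + 1)) = I at h ⊢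
    refine eq_inv_of_mul_eq_one_left ?_
    field_simp at h
    have h2 : (n - (j + 1) : ℝ) * (I * (2 * n * (n - 1).choose (j + 1))) = (n - (j + 1) : ℝ) * 1 := by
      have h3 : ((n - 1).choose j : ℝ) * ((n - (j + 1) : ℝ) * (I * (2 * n * (n - 1).choose (j + 1))) - (n - (j + 1) : ℝ) * 1) = 0 := by
        linear_combination (-1 : ℝ) * ((n - 1).choose (j + 1) : ℝ) * h + hc'
      have := (mul_eq_zero.1 h3).resolve_left hc0
      linarith
    exact mul_left_cancel₀ hnj h2

end RadialMoments

/-! ### Orthogonality of the monomials. -/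

section PlanarMeasure

open Filter Topology ComplexConjugate

/-- The density `(n / π) (1 + |z|²)^(-n-1)`. -/
def planarDensity (n : ℕ) (z : ℂ) : ℝ := n / Real.pi / (1 + ‖z‖ ^ 2) ^ (n + 1)

/-- The spherical measure, as a measure on the plane. -/
def planarMeasure (n : ℕ) : Measure ℂ :=
  (volume : Measure ℂ).withDensity fun z => ENNReal.ofReal (planarDensity n z)

variable {n : ℕ}

theorem sphericalMeasure_eq_map (n : ℕ) :
    sphericalMeasure n = (planarMeasure n).map fun z : ℂ => (z : OnePoint ℂ) := rfl

theorem planarDensity_nonneg (z : ℂ) : 0 ≤ planarDensity n z := by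
  unfold planarDensity
  positivity

theorem continuous_planarDensity : Continuous (planarDensity n) := by
  unfold planarDensity
  exact continuous_const.div (by fun_prop) fun z => by positivity

theorem measurable_planarDensity : Measurable (planarDensity n) :=
  continuous_planarDensity.measurable

theorem integral_planarMeasure (g : ℂ → ℂ) :
    ∫ z, g z ∂planarMeasure n = ∫ z, planarDensity n z * g z := by
  rw [planarMeasure, integral_withDensity_eq_integral_toReal_smul
    measurable_planarDensity.ennreal_ofReal (ae_of_all _ fun _ => ENNReal.ofReal_lt_top)]
  simp [ENNReal.toReal_ofReal (planarDensity_nonneg _)]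

theorem integrable_planarMeasure_iff {g : ℂ → ℂ} :
    Integrable g (planarMeasure n) ↔ Integrable fun z => planarDensity n z * g z := by
  rw [planarMeasure, integrable_withDensity_iff_integrable_smul'
    measurable_planarDensity.ennreal_ofReal (ae_of_all _ fun _ => ENNReal.ofReal_lt_top)]
  simp [ENNReal.toReal_ofReal (planarDensity_nonneg _)]

theorem norm_pow_mul_planarDensity (j : ℕ) (z : ℂ) :
    planarDensity n z * ‖z‖ ^ (2 * j)
      = n / Real.pi * (‖z‖ ^ (2 * j) / (1 + ‖z‖ ^ 2) ^ (n + 1)) := by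
  rw [planarDensity]
  ring

theorem integrable_norm_pow_mul_planarDensity {j : ℕ} (hj : j < n) :
    Integrable fun z : ℂ => planarDensity n z * ‖z‖ ^ (2 * j) := by
  simp only [norm_pow_mul_planarDensity]
  refine Integrable.const_mul ?_ _
  have h := (integrable_fun_norm_addHaar (E := ℂ) volume
    (f := fun y : ℝ => y ^ (2 * j) / (1 + y ^ 2) ^ (n + 1))).2
  refine h ?_
  refine (integrableOn_pow_div_one_add_sq_pow hj).congr_fun (fun y _ => ?_) measurableSet_Ioi
  simp only [Complex.finrank_real_complex, smul_eq_mul]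
  ring

theorem integral_norm_pow_mul_planarDensity {j : ℕ} (hj : j < n) :
    ∫ z : ℂ, planarDensity n z * ‖z‖ ^ (2 * j) = ((n - 1).choose j : ℝ)⁻¹ := by
  simp only [norm_pow_mul_planarDensity]
  rw [integral_const_mul, integral_fun_norm_addHaar (E := ℂ) volume
    (fun y : ℝ => y ^ (2 * j) / (1 + y ^ 2) ^ (n + 1))]
  have h := integral_pow_div_one_add_sq_pow hj
  have h2 : ∀ y : ℝ, y ^ (Module.finrank ℝ ℂ - 1) • (y ^ (2 * j) / (1 + y ^ 2) ^ (n + 1))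
      = y ^ (2 * j + 1) / (1 + y ^ 2) ^ (n + 1) := by
    intro y
    simp only [Complex.finrank_real_complex, smul_eq_mul]
    ring
  simp only [h2]
  have hn : (n : ℝ) ≠ 0 := by
    have : n ≠ 0 := by omega
    exact_mod_cast this
  have hv : (volume : Measure ℂ).real (Metric.ball 0 1) = Real.pi := by
    simp [Measure.real, Complex.volume_ball]
  rw [h, hv, Complex.finrank_real_complex]
  have hpi := Real.pi_ne_zero
  simp only [nsmul_eq_mul, smul_eq_mul, mul_inv]
  push_cast
  field_simp

theorem integrable_pow_mul_conj_pow {i j : ℕ} (hi : i < n) (hj : j < n) :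
    Integrable (fun z : ℂ => z ^ i * conj z ^ j) (planarMeasure n) := by
  rw [integrable_planarMeasure_iff]
  refine Integrable.mono' ((integrable_norm_pow_mul_planarDensity hi).add
    (integrable_norm_pow_mul_planarDensity hj)) ?_ (ae_of_all _ fun z => ?_)
  · refine Continuous.aestronglyMeasurable ?_
    have := continuous_planarDensity (n := n)
    have hc := Complex.continuous_conj
    fun_prop
  · simp only [norm_mul, norm_pow, RCLike.norm_conj, Complex.norm_real, Pi.add_apply,
      Real.norm_of_nonneg (planarDensity_nonneg z)]
    rw [← mul_add]
    refine mul_le_mul_of_nonneg_left ?_ (planarDensity_nonneg z)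
    rw [mul_comm 2 i, mul_comm 2 j, pow_mul, pow_mul]
    nlinarith [sq_nonneg (‖z‖ ^ i - ‖z‖ ^ j), sq_nonneg (‖z‖ ^ i + ‖z‖ ^ j)]

theorem integral_planarMeasure_comp_rotation (a : Circle) (g : ℂ → ℂ) :
    ∫ z, g (a * z) ∂planarMeasure n = ∫ z, g z ∂planarMeasure n := by
  simp only [integral_planarMeasure]
  have h := (LinearIsometryEquiv.measurePreserving (rotation a)).integral_comp
    (rotation a).toHomeomorph.measurableEmbedding fun z => (planarDensity n z : ℂ) * g z
  rw [← h]
  refine integral_congr_ae (ae_of_all _ fun z => ?_)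
  simp [rotation_apply, planarDensity, Circle.norm_coe]

/-- The measure is rotation invariant. For `i ≠ j` the rotation by the angle `π / (i - j)` changes
the sign of the integrand, so the integral vanishes. -/
theorem integral_pow_mul_conj_pow {i j : ℕ} (hj : j < n) :
    ∫ z : ℂ, z ^ i * conj z ^ j ∂planarMeasure n
      = if i = j then ((n - 1).choose j : ℂ)⁻¹ else 0 := by
  split_ifs with hij
  · subst hij
    have h := integral_norm_pow_mul_planarDensity hj
    rw [integral_planarMeasure]
    have h2 : ∀ z : ℂ, (planarDensity n z : ℂ) * (z ^ i * conj z ^ i)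
        = ((planarDensity n z * ‖z‖ ^ (2 * i) : ℝ) : ℂ) := by
      intro z
      rw [← mul_pow, Complex.mul_conj, Complex.normSq_eq_norm_sq, pow_mul]
      push_cast
      ring
    simp only [h2]
    rw [integral_complex_ofReal, h]
    push_cast
    rfl
  · let d : ℝ := (i : ℝ) - j
    have hd : d ≠ 0 := sub_ne_zero.2 (by exact_mod_cast hij)
    let a : Circle := Circle.exp (Real.pi / d)
    have ha : (a : ℂ) ^ i * conj (a : ℂ) ^ j = -1 := by
      have h1 : (a : ℂ) = Complex.exp ((Real.pi / d : ℝ) * Complex.I) := Circle.coe_exp _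
      have h2 : conj (a : ℂ) = Complex.exp (-((Real.pi / d : ℝ) * Complex.I)) := by
        rw [h1, ← Complex.exp_conj]
        simp
      rw [h2, h1, ← Complex.exp_nat_mul, ← Complex.exp_nat_mul, ← Complex.exp_add,
        ← Complex.exp_pi_mul_I]
      congr 1
      have h3 : ((Real.pi / d * d : ℝ) : ℂ) = Real.pi := by
        rw [div_mul_cancel₀ _ hd]
      rw [← h3]
      simp only [d]
      push_cast
      ring
    have h := integral_planarMeasure_comp_rotation (n := n) a fun z => z ^ i * conj z ^ j
    have h4 : ∀ z : ℂ, (a * z) ^ i * conj (a * z) ^ j = -(z ^ i * conj z ^ j) := by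
      intro z
      rw [map_mul, mul_pow, mul_pow]
      linear_combination (z ^ i * conj z ^ j) * ha
    simp only [h4] at h
    rw [integral_neg] at h
    exact self_eq_neg.1 h.symm

end PlanarMeasure

/-! ### Square integrable entire functions are polynomials. -/

section EntireSquareIntegrable

open Filter Topology

theorem sq_lintegral_le {α : Type*} [MeasurableSpace α] (μ : Measure α) {f : α → ℝ≥0∞}
    (hf : AEMeasurable f μ) : (∫⁻ x, f x ∂μ) ^ 2 ≤ (∫⁻ x, f x ^ 2 ∂μ) * μ Set.univ := by
  have h := ENNReal.lintegral_mul_le_Lp_mul_Lq μ Real.HolderConjugate.two_two hf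
    (aemeasurable_const (b := (1 : ℝ≥0∞)))
  simp only [Pi.mul_apply, mul_one, ENNReal.one_rpow, lintegral_one] at h
  calc (∫⁻ x, f x ∂μ) ^ 2
      ≤ ((∫⁻ x, f x ^ (2 : ℝ) ∂μ) ^ (1 / 2 : ℝ) * (μ Set.univ) ^ (1 / 2 : ℝ)) ^ 2 := by gcongr
    _ = _ := by
      rw [mul_pow, ← ENNReal.rpow_natCast, ← ENNReal.rpow_natCast, ← ENNReal.rpow_mul,
        ← ENNReal.rpow_mul]
      simp

/-- Cauchy's formula on the circle of radius `r`, followed by Cauchy–Schwarz in the angle. -/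
theorem enorm_taylorCoeff_sq_le {f : ℂ → ℂ} (hf : Differentiable ℂ f) (k : ℕ) {r : ℝ}
    (hr : 0 < r) :
    ENNReal.ofReal (2 * Real.pi * r ^ (2 * k)) * ‖iteratedDeriv k f 0 / (k.factorial : ℂ)‖ₑ ^ 2
      ≤ ∫⁻ θ in Set.Ioo (-Real.pi) Real.pi, ‖f (circleMap 0 r θ)‖ₑ ^ 2 := by
  set a := iteratedDeriv k f 0 / (k.factorial : ℂ) with ha
  have hpi := Real.pi_pos
  have h1 := hf.differentiableOn.circleIntegral_one_div_sub_center_pow_smul (c := 0) hr k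
  let g : ℝ → ℂ := fun θ => deriv (circleMap 0 r) θ • ((1 / (circleMap 0 r θ - 0) ^ (k + 1)) •
    f (circleMap 0 r θ))
  have hgper : Function.Periodic g (2 * Real.pi) := by
    intro θ
    simp only [g, deriv_circleMap, periodic_circleMap _ _ θ]
  have h2 := hgper.intervalIntegral_add_eq 0 (-Real.pi)
  rw [zero_add, show -Real.pi + 2 * Real.pi = Real.pi by ring] at h2
  have h3 : ∫ θ in (-Real.pi)..Real.pi, g θ = 2 * Real.pi * Complex.I * a := by
    rw [← h2]
    refine h1.trans ?_
    rw [ha, smul_eq_mul]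
    ring
  have hnorm : ∀ θ, ‖g θ‖ₑ = ENNReal.ofReal (r ^ k)⁻¹ * ‖f (circleMap 0 r θ)‖ₑ := by
    intro θ
    have hc : ‖circleMap 0 r θ‖ = r := by simp [abs_of_pos hr]
    simp only [g, deriv_circleMap, sub_zero]
    rw [smul_smul, smul_eq_mul, enorm_mul]
    congr 1
    rw [← ofReal_norm]
    congr 1
    simp only [norm_mul, norm_div, norm_pow, norm_one, Complex.norm_I, hc]
    field_simp
    ring
  rw [intervalIntegral.integral_of_le (by linarith), ← restrict_Ioo_eq_restrict_Ioc] at h3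
  have h4 := enorm_integral_le_lintegral_enorm (μ := volume.restrict (Set.Ioo (-Real.pi) Real.pi)) g
  have hcont : Continuous fun θ => ‖f (circleMap 0 r θ)‖ₑ :=
    (hf.continuous.comp (continuous_circleMap 0 r)).enorm
  simp only [h3, hnorm] at h4
  rw [lintegral_const_mul _ hcont.measurable] at h4
  have h5 := sq_lintegral_le (volume.restrict (Set.Ioo (-Real.pi) Real.pi)) hcont.aemeasurable
  rw [Measure.restrict_apply_univ, Real.volume_Ioo, sub_neg_eq_add, ← two_mul] at h5
  have h6 : ‖(2 * Real.pi * Complex.I * a : ℂ)‖ₑ = ENNReal.ofReal (2 * Real.pi) * ‖a‖ₑ := by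
    rw [enorm_mul, ← ofReal_norm]
    congr 2
    simp [abs_of_pos hpi]
  rw [h6] at h4
  set I := ∫⁻ θ in Set.Ioo (-Real.pi) Real.pi, ‖f (circleMap 0 r θ)‖ₑ ^ 2
  set J := ∫⁻ θ in Set.Ioo (-Real.pi) Real.pi, ‖f (circleMap 0 r θ)‖ₑ
  have hT0 : ENNReal.ofReal (2 * Real.pi) ≠ 0 := by
    have : 0 < 2 * Real.pi := by positivity
    simpa using this
  have hR : ENNReal.ofReal (r ^ k) * ENNReal.ofReal (r ^ k)⁻¹ = 1 := by
    rw [← ENNReal.ofReal_mul (by positivity), mul_inv_cancel₀ (by positivity), ENNReal.ofReal_one]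
  rw [← ENNReal.mul_le_mul_iff_left hT0 ENNReal.ofReal_ne_top]
  calc ENNReal.ofReal (2 * Real.pi * r ^ (2 * k)) * ‖a‖ₑ ^ 2 * ENNReal.ofReal (2 * Real.pi)
      = ENNReal.ofReal (r ^ k) ^ 2 * (ENNReal.ofReal (2 * Real.pi) * ‖a‖ₑ) ^ 2 := by
        rw [ENNReal.ofReal_mul (by positivity), mul_comm 2 k, pow_mul,
          ENNReal.ofReal_pow (by positivity)]
        ring
    _ ≤ ENNReal.ofReal (r ^ k) ^ 2 * (ENNReal.ofReal (r ^ k)⁻¹ * J) ^ 2 := by gcongr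
    _ = (ENNReal.ofReal (r ^ k) * ENNReal.ofReal (r ^ k)⁻¹) ^ 2 * J ^ 2 := by ring
    _ = J ^ 2 := by rw [hR, one_pow, one_mul]
    _ ≤ I * ENNReal.ofReal (2 * Real.pi) := h5

theorem lintegral_Ioi_const_mul_inv {C : ℝ} (hC : 0 < C) :
    ∫⁻ r in Set.Ioi (1 : ℝ), ENNReal.ofReal (C * r⁻¹) = ⊤ := by
  by_contra h
  refine not_integrableOn_Ioi_inv (a := 1) ?_
  have h1 : IntegrableOn (fun r : ℝ => C * r⁻¹) (Set.Ioi 1) := by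
    refine ⟨by fun_prop, ?_⟩
    rw [hasFiniteIntegral_iff_ofReal]
    · exact lt_top_iff_ne_top.2 h
    · filter_upwards [self_mem_ae_restrict measurableSet_Ioi] with r hr
      have : (0 : ℝ) < r := lt_trans one_pos hr
      simp only [Pi.zero_apply]
      positivity
  have h2 := h1.const_mul C⁻¹
  simpa [IntegrableOn, inv_mul_cancel_left₀ hC.ne'] using h2

/-- In polar coordinates a nonzero Taylor coefficient of order `k ≥ n` makes the radial integrand at
least a constant times `r · r^(2k) / r^(2n+2) ≥ 1 / r` for `r > 1`. The logarithmic divergence is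
borderline at `k = n`. -/
theorem iteratedDeriv_eq_zero_of_memLp {n : ℕ} (hn : 1 ≤ n) {f : ℂ → ℂ} (hf : Differentiable ℂ f)
    (hL : MemLp f 2 (planarMeasure n)) {k : ℕ} (hk : n ≤ k) : iteratedDeriv k f 0 = 0 := by
  set a := iteratedDeriv k f 0 / (k.factorial : ℂ) with ha
  have hpi := Real.pi_pos
  have hn0 : (0 : ℝ) < n := by exact_mod_cast hn
  suffices ha0 : a = 0 by
    have : (k.factorial : ℂ) ≠ 0 := by exact_mod_cast k.factorial_ne_zero
    exact (div_eq_zero_iff.1 ha0).resolve_right this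
  by_contra hne
  have hfin : ∫⁻ z, ‖f z‖ₑ ^ 2 ∂planarMeasure n < ⊤ := by
    have := lintegral_rpow_enorm_lt_top_of_eLpNorm_lt_top two_ne_zero ENNReal.ofNat_ne_top hL.2
    simpa using this
  have hfm : Measurable fun z => ‖f z‖ₑ ^ 2 := by
    have := hf.continuous
    exact (this.enorm.measurable).pow_const 2
  have hdm : Measurable fun z => ENNReal.ofReal (planarDensity n z) :=
    measurable_planarDensity.ennreal_ofReal
  rw [planarMeasure, lintegral_withDensity_eq_lintegral_mul _ hdm hfm] at hfin
  refine hfin.ne (top_unique ?_)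
  have hg : Measurable fun z => ENNReal.ofReal (planarDensity n z) * ‖f z‖ₑ ^ 2 := hdm.mul hfm
  have hpc : ∀ p : ℝ × ℝ, Complex.polarCoord.symm p = circleMap 0 p.1 p.2 := by
    intro p
    rw [Complex.polarCoord_symm_apply, circleMap, zero_add, Complex.exp_mul_I]
    simp
  have hcm : Measurable fun p : ℝ × ℝ => circleMap 0 p.1 p.2 := by
    unfold circleMap
    fun_prop
  have hdens : ∀ r θ : ℝ, 0 < r → planarDensity n (circleMap 0 r θ)
      = n / Real.pi / (1 + r ^ 2) ^ (n + 1) := by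
    intro r θ hr
    simp [planarDensity]
  calc ⊤ = (∫⁻ r in Set.Ioi (1 : ℝ), ENNReal.ofReal ((n / 2 ^ n : ℝ) * r⁻¹)) * ‖a‖ₑ ^ 2 := by
        rw [lintegral_Ioi_const_mul_inv (by positivity), ENNReal.top_mul]
        simpa using hne
    _ = ∫⁻ r in Set.Ioi (1 : ℝ), ENNReal.ofReal ((n / 2 ^ n : ℝ) * r⁻¹) * ‖a‖ₑ ^ 2 := by
        rw [lintegral_mul_const _ (by fun_prop)]
    _ ≤ ∫⁻ r in Set.Ioi (1 : ℝ), ∫⁻ θ in Set.Ioo (-Real.pi) Real.pi, ENNReal.ofReal r *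
          (ENNReal.ofReal (planarDensity n (circleMap 0 r θ)) * ‖f (circleMap 0 r θ)‖ₑ ^ 2) := by
        refine setLIntegral_mono' measurableSet_Ioi fun r hr => ?_
        have hr1 : (1 : ℝ) < r := hr
        have hr0 : 0 < r := one_pos.trans hr1
        simp only [hdens _ _ hr0]
        have hm : Measurable fun θ : ℝ => ‖f (circleMap 0 r θ)‖ₑ ^ 2 :=
          hfm.comp (continuous_circleMap 0 r).measurable
        rw [lintegral_const_mul _ (hm.const_mul _), lintegral_const_mul _ hm]
        refine le_trans ?_ (mul_le_mul_right (mul_le_mul_right (enorm_taylorCoeff_sq_le hf k hr0) _) _)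
        rw [← ha, ← mul_assoc, ← mul_assoc, ← ENNReal.ofReal_mul hr0.le,
          ← ENNReal.ofReal_mul (by positivity)]
        refine mul_le_mul_left (ENNReal.ofReal_le_ofReal ?_) _
        -- Since `1 + r² ≤ 2 r²` for `r > 1`, the constant is `(n / π) · 2π / 2^(n+1) = n / 2^n`.
        have h1 : (1 + r ^ 2) ^ (n + 1) ≤ (2 * r ^ 2) ^ (n + 1) := by
          gcongr
          nlinarith
        have h2 : r ^ (2 * n) ≤ r ^ (2 * k) := pow_le_pow_right₀ hr1.le (by omega)
        calc (n / 2 ^ n : ℝ) * r⁻¹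
            = r * (n / Real.pi / (2 * r ^ 2) ^ (n + 1)) * (2 * Real.pi * r ^ (2 * n)) := by
              field_simp
              ring
          _ ≤ r * (n / Real.pi / (1 + r ^ 2) ^ (n + 1)) * (2 * Real.pi * r ^ (2 * k)) := by
              gcongr
    _ ≤ ∫⁻ r in Set.Ioi (0 : ℝ), ∫⁻ θ in Set.Ioo (-Real.pi) Real.pi, ENNReal.ofReal r *
          (ENNReal.ofReal (planarDensity n (circleMap 0 r θ)) * ‖f (circleMap 0 r θ)‖ₑ ^ 2) :=
        lintegral_mono_set (Set.Ioi_subset_Ioi zero_le_one)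
    _ = ∫⁻ p in Complex.polarCoord.target, ENNReal.ofReal p.1 •
          (ENNReal.ofReal (planarDensity n (Complex.polarCoord.symm p)) *
            ‖f (Complex.polarCoord.symm p)‖ₑ ^ 2) := by
        simp only [hpc, smul_eq_mul]
        rw [Complex.polarCoord_target, Measure.volume_eq_prod, ← Measure.prod_restrict]
        have hm : Measurable fun p : ℝ × ℝ => ENNReal.ofReal p.1 *
            (ENNReal.ofReal (planarDensity n (circleMap 0 p.1 p.2)) *
              ‖f (circleMap 0 p.1 p.2)‖ₑ ^ 2) :=
          measurable_fst.ennreal_ofReal.mul (hg.comp hcm)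
        rw [lintegral_prod _ hm.aemeasurable]
    _ = _ := Complex.lintegral_comp_polarCoord_symm
          fun z => ENNReal.ofReal (planarDensity n z) * ‖f z‖ₑ ^ 2

/-- Entire functions that are square integrable for the spherical measure are polynomials. -/
theorem exists_eq_sum_of_memLp {n : ℕ} (hn : 1 ≤ n) {f : ℂ → ℂ} (hf : Differentiable ℂ f)
    (hL : MemLp f 2 (planarMeasure n)) : ∃ a : Fin n → ℂ, ∀ z, f z = ∑ j, a j * z ^ (j : ℕ) := by
  refine ⟨fun j => ((j : ℕ).factorial : ℂ)⁻¹ * iteratedDeriv j f 0, fun z => ?_⟩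
  have h := Complex.taylorSeries_eq_of_entire' 0 z hf
  rw [← h, tsum_eq_sum (s := Finset.range n)]
  · rw [Finset.sum_range]
    simp only [sub_zero]
  · intro k hk
    rw [iteratedDeriv_eq_zero_of_memLp hn hf hL (by simpa using hk)]
    simp

end EntireSquareIntegrable

/-! ### The Hilbert space and its reproducing kernel. -/

section ReproducingKernel

open ComplexConjugate

variable {n : ℕ}

theorem measurableEmbedding_coe_onePoint : MeasurableEmbedding fun z : ℂ => (z : OnePoint ℂ) :=
  OnePoint.isOpenEmbedding_coe.measurableEmbedding

/-- The restriction of the spherical kernel to the plane. -/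
def planarKernel (n : ℕ) (z w : ℂ) : ℂ := (1 + z * conj w) ^ (n - 1)

theorem planarKernel_eq_sum (hn : 1 ≤ n) (z w : ℂ) :
    planarKernel n z w = ∑ j : Fin n, ((n - 1).choose j : ℂ) * conj w ^ (j : ℕ) * z ^ (j : ℕ) := by
  obtain ⟨m, rfl⟩ : ∃ m, n = m + 1 := ⟨n - 1, by omega⟩
  rw [planarKernel, add_comm, add_pow, Finset.sum_range]
  simp only [Nat.add_sub_cancel, one_pow, mul_one, mul_pow]
  exact Finset.sum_congr rfl fun j _ => by ring

theorem conj_planarKernel (z w : ℂ) : conj (planarKernel n z w) = planarKernel n w z := by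
  simp [planarKernel, mul_comm]

/-- In the binomial expansion of the kernel the coefficient of each monomial is the inverse of its
squared norm. -/
theorem planarKernel_reproducing (hn : 1 ≤ n) (a : Fin n → ℂ) (w : ℂ) :
    Integrable (fun z => (∑ j, a j * z ^ (j : ℕ)) * conj (planarKernel n z w)) (planarMeasure n) ∧
    ∫ z, (∑ j, a j * z ^ (j : ℕ)) * conj (planarKernel n z w) ∂planarMeasure n
      = ∑ j, a j * w ^ (j : ℕ) := by
  have h1 : ∀ z : ℂ, (∑ j, a j * z ^ (j : ℕ)) * conj (planarKernel n z w)
      = ∑ i : Fin n, ∑ j : Fin n, (a i * ((n - 1).choose j * w ^ (j : ℕ))) *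
        (z ^ (i : ℕ) * conj z ^ (j : ℕ)) := by
    intro z
    rw [planarKernel_eq_sum hn, map_sum, Finset.sum_mul_sum]
    refine Finset.sum_congr rfl fun i _ => Finset.sum_congr rfl fun j _ => ?_
    simp only [map_mul, map_pow, Complex.conj_conj, map_natCast]
    ring
  have hI : ∀ i j : Fin n, Integrable (fun z : ℂ => (a i * ((n - 1).choose j * w ^ (j : ℕ))) *
      (z ^ (i : ℕ) * conj z ^ (j : ℕ))) (planarMeasure n) := fun i j =>
    (integrable_pow_mul_conj_pow i.2 j.2).const_mul _
  simp only [h1]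
  refine ⟨integrable_finsetSum _ fun i _ => integrable_finsetSum _ fun j _ => hI i j, ?_⟩
  rw [integral_finsetSum _ fun i _ => integrable_finsetSum _ fun j _ => hI i j]
  refine Finset.sum_congr rfl fun i _ => ?_
  rw [integral_finsetSum _ fun j _ => hI i j, Finset.sum_eq_single i]
  · rw [integral_const_mul, integral_pow_mul_conj_pow i.2, if_pos rfl]
    have : ((n - 1).choose i : ℂ) ≠ 0 := by
      exact_mod_cast (Nat.choose_pos (Nat.le_pred_of_lt i.2)).ne'
    field_simp
  · intro j _ hj
    rw [integral_const_mul, integral_pow_mul_conj_pow j.2,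
      if_neg fun h => hj (Fin.ext h.symm), mul_zero]
  · simp

theorem memLp_pow (j : Fin n) : MemLp (fun z : ℂ => z ^ (j : ℕ)) 2 (planarMeasure n) := by
  rw [memLp_two_iff_integrable_sq_norm (by fun_prop)]
  refine (integrable_pow_mul_conj_pow j.2 j.2).norm.congr (ae_of_all _ fun z => ?_)
  simp [sq]

/-- The polynomial with coefficients `a`, as a function on the sphere vanishing at infinity. -/
def sphericalPoly (a : Fin n → ℂ) (z : OnePoint ℂ) : ℂ := z.elim 0 fun z => ∑ j, a j * z ^ (j : ℕ)

theorem memLp_sphericalPoly (a : Fin n → ℂ) : MemLp (sphericalPoly a) 2 (sphericalMeasure n) := by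
  rw [sphericalMeasure_eq_map, measurableEmbedding_coe_onePoint.memLp_map_measure_iff]
  have h : MemLp (fun z : ℂ => ∑ j, a j * z ^ (j : ℕ)) 2 (planarMeasure n) :=
    memLp_finsetSum _ fun j _ => (memLp_pow j).const_mul (a j)
  exact h

theorem mem_analyticL2_iff (hn : 1 ≤ n) {f : OnePoint ℂ → ℂ} :
    f ∈ analyticL2 (sphericalMeasure n) ↔ ∃ a : Fin n → ℂ, f = sphericalPoly a := by
  constructor
  · rintro ⟨h0, hd, hL⟩
    rw [sphericalMeasure_eq_map, measurableEmbedding_coe_onePoint.memLp_map_measure_iff] at hL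
    obtain ⟨a, ha⟩ := exists_eq_sum_of_memLp hn hd hL
    refine ⟨a, funext fun z => ?_⟩
    induction z using OnePoint.rec with
    | infty => exact h0
    | coe z => exact ha z
  · rintro ⟨a, rfl⟩
    refine ⟨rfl, ?_, memLp_sphericalPoly a⟩
    change Differentiable ℂ fun z : ℂ => ∑ j, a j * z ^ (j : ℕ)
    fun_prop

theorem sphericalKernel_eq_sphericalPoly (hn : 1 ≤ n) (w : OnePoint ℂ) :
    (fun z => sphericalKernel n z w)
      = sphericalPoly fun j : Fin n => w.elim 0 fun w => ((n - 1).choose j : ℂ) * conj w ^ (j : ℕ) := by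
  funext z
  induction z using OnePoint.rec with
  | infty => rfl
  | coe z =>
    induction w using OnePoint.rec with
    | infty => simp [sphericalKernel, sphericalPoly]
    | coe w => exact planarKernel_eq_sum hn z w

theorem isReproducingKernel_sphericalKernel (hn : 1 ≤ n) :
    IsReproducingKernel (sphericalMeasure n) (analyticL2 (sphericalMeasure n))
      (sphericalKernel n) where
  memLp f hf := hf.2.2
  closed := by
    let e : Fin n → OnePoint ℂ → ℂ := fun j => sphericalPoly (Pi.single j 1)
    have he : ∀ j, MemLp (e j) 2 (sphericalMeasure n) := fun j => memLp_sphericalPoly _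
    -- Closedness comes from finite dimension: the set is the span of the classes of `n` monomials.
    let V : Submodule ℂ (Lp ℂ 2 (sphericalMeasure n)) :=
      Submodule.span ℂ (Set.range fun j => (he j).toLp (e j))
    have hV : FiniteDimensional ℂ V := FiniteDimensional.span_of_finite ℂ (Set.finite_range _)
    have hsum : ∀ a : Fin n → ℂ,
        ((∑ j, a j • (he j).toLp (e j) : Lp ℂ 2 (sphericalMeasure n)) : OnePoint ℂ → ℂ)
          =ᵐ[sphericalMeasure n] sphericalPoly a := by
      intro a
      have h2 : sphericalPoly a = ∑ j, a j • e j := by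
        funext z
        simp only [Finset.sum_apply, Pi.smul_apply, smul_eq_mul, e]
        induction z using OnePoint.rec with
        | infty => simp [sphericalPoly]
        | coe z =>
          simp only [sphericalPoly, OnePoint.elim_some]
          refine Finset.sum_congr rfl fun j _ => ?_
          rw [Finset.sum_eq_single j (fun i _ hi => by simp [hi]) (by simp)]
          simp
      rw [h2]
      induction (Finset.univ : Finset (Fin n)) using Finset.induction_on with
      | empty => exact Lp.coeFn_zero _ _ _
      | insert i s hi ih =>
        rw [Finset.sum_insert hi, Finset.sum_insert hi]
        exact (Lp.coeFn_add _ _).trans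
          (((Lp.coeFn_smul _ _).trans ((he i).coeFn_toLp.const_smul (a i))).add ih)
    have hset : {g : Lp ℂ 2 (sphericalMeasure n) | ∃ f ∈ analyticL2 (sphericalMeasure n),
        g =ᵐ[sphericalMeasure n] f} = V := by
      ext g
      simp only [Set.mem_ofPred_eq, SetLike.mem_coe, V, Submodule.mem_span_range_iff_exists_fun]
      constructor
      · rintro ⟨f, hf, hg⟩
        obtain ⟨a, rfl⟩ := (mem_analyticL2_iff hn).1 hf
        exact ⟨a, Lp.ext ((hsum a).trans hg.symm)⟩
      · rintro ⟨a, rfl⟩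
        exact ⟨_, (mem_analyticL2_iff hn).2 ⟨a, rfl⟩, hsum a⟩
    rw [hset]
    exact V.closed_of_finiteDimensional
  kernel_mem w := (mem_analyticL2_iff hn).2 ⟨_, sphericalKernel_eq_sphericalPoly hn w⟩
  reproducing f hf w := by
    obtain ⟨a, rfl⟩ := (mem_analyticL2_iff hn).1 hf
    rw [sphericalMeasure_eq_map, measurableEmbedding_coe_onePoint.integral_map]
    induction w using OnePoint.rec with
    -- At infinity the identity reads `0 = 0`, because functions and kernel were both given the
    -- value `0` there.
    | infty => simp [sphericalPoly, sphericalKernel]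
    | coe w => exact (planarKernel_reproducing hn a w).2.symm

end ReproducingKernel

/-! ### Kernel determinants: positivity, rank and integration of one variable. -/

section KernelDeterminants

open Matrix ComplexConjugate

variable {n k : ℕ}

/-- The matrix of values of the kernel at the points `x`. -/
def kernelMatrix (n : ℕ) (x : Fin k → ℂ) : Matrix (Fin k) (Fin k) ℂ :=
  of fun i j => planarKernel n (x i) (x j)

/-- The matrix of normalized monomials at the points `x`. -/
def monomialMatrix (n : ℕ) (x : Fin k → ℂ) : Matrix (Fin k) (Fin n) ℂ :=
  of fun i j => ((Real.sqrt ((n - 1).choose j) : ℝ) : ℂ) * x i ^ (j : ℕ)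

/-- The determinant of the kernel, as a density. -/
def kernelDensity (n : ℕ) (x : Fin k → ℂ) : ℝ≥0∞ := ENNReal.ofReal (kernelMatrix n x).det.re

theorem kernelMatrix_eq_mul (hn : 1 ≤ n) (x : Fin k → ℂ) :
    kernelMatrix n x = monomialMatrix n x * (monomialMatrix n x)ᴴ := by
  ext i j
  rw [kernelMatrix, of_apply, planarKernel_eq_sum hn, Matrix.mul_apply]
  refine Finset.sum_congr rfl fun l _ => ?_
  have h : ((Real.sqrt ((n - 1).choose l) : ℝ) : ℂ) * ((Real.sqrt ((n - 1).choose l) : ℝ) : ℂ)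
      = ((n - 1).choose l : ℂ) := by
    rw [← Complex.ofReal_mul, Real.mul_self_sqrt (by positivity)]
    simp
  simp only [monomialMatrix, conjTranspose_apply, of_apply, star_mul', star_pow,
    Complex.star_def, Complex.conj_ofReal]
  rw [← h]
  ring

/-- The kernel matrix is `A Aᴴ`, hence positive semidefinite, so taking `re` and `ENNReal.ofReal`
loses nothing. -/
theorem det_kernelMatrix_nonneg (hn : 1 ≤ n) (x : Fin k → ℂ) :
    0 ≤ (kernelMatrix n x).det.re ∧ (((kernelMatrix n x).det.re : ℝ) : ℂ) = (kernelMatrix n x).det := by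
  open scoped ComplexOrder in
  have h : 0 ≤ (kernelMatrix n x).det := by
    rw [kernelMatrix_eq_mul hn]
    exact (posSemidef_self_mul_conjTranspose _).det_nonneg
  have h2 := Complex.nonneg_iff.1 h
  exact ⟨h2.1, Complex.ext (by simp) (by simpa using h2.2)⟩

/-- The kernel matrix factors through an `n`-dimensional space, so its rank is at most `n`. -/
theorem det_kernelMatrix_eq_zero (hn : 1 ≤ n) (hk : n < k) (x : Fin k → ℂ) :
    (kernelMatrix n x).det = 0 := by
  by_contra h
  have h1 := rank_of_isUnit _ ((isUnit_iff_isUnit_det _).2 (isUnit_iff_ne_zero.2 h))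
  have h2 : (kernelMatrix n x).rank ≤ n := by
    rw [kernelMatrix_eq_mul hn]
    refine (rank_mul_le_left _ _).trans ((rank_le_card_width _).trans ?_)
    simp
  rw [h1, Fintype.card_fin] at h2
  omega

/-- For `n` points the matrix of normalized monomials is square: the Vandermonde matrix times a
diagonal one. -/
theorem det_kernelMatrix_self (hn : 1 ≤ n) (x : Fin n → ℂ) :
    (kernelMatrix n x).det.re
      = (∏ j : Fin n, ((n - 1).choose j : ℝ)) * ‖(vandermonde x).det‖ ^ 2 := by
  have h : monomialMatrix n x = vandermonde x *
      diagonal fun j : Fin n => ((Real.sqrt ((n - 1).choose j) : ℝ) : ℂ) := by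
    ext i j
    simp [monomialMatrix, vandermonde_apply, mul_comm]
  rw [kernelMatrix_eq_mul hn, det_mul, det_conjTranspose, Complex.star_def, Complex.mul_conj,
    Complex.ofReal_re, Complex.normSq_eq_norm_sq, h, det_mul, det_diagonal, norm_mul, mul_pow,
    mul_comm, norm_prod, ← Finset.prod_pow]
  congr 1
  refine Finset.prod_congr rfl fun j _ => ?_
  rw [Complex.norm_real, Real.norm_of_nonneg (Real.sqrt_nonneg _), Real.sq_sqrt (by positivity)]

theorem kernelDensity_comp_perm (x : Fin k → ℂ) (σ : Equiv.Perm (Fin k)) :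
    kernelDensity n (x ∘ σ) = kernelDensity n x := by
  have h : kernelMatrix n (x ∘ σ) = (kernelMatrix n x).submatrix σ σ := rfl
  rw [kernelDensity, kernelDensity, h, det_submatrix_equiv_self]

theorem measurable_kernelDensity : Measurable fun x : Fin k → ℂ => kernelDensity n x := by
  have hc := Complex.continuous_conj
  have h : Continuous fun x : Fin k → ℂ => (kernelMatrix n x).det.re := by
    unfold kernelMatrix planarKernel
    refine Complex.continuous_re.comp (Continuous.matrix_det ?_)
    refine continuous_matrix fun i j => ?_
    simp only [of_apply]
    fun_prop
  exact h.measurable.ennreal_ofReal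

theorem kernelMatrix_cons (y : ℂ) (x : Fin k → ℂ) :
    kernelMatrix n (Fin.cons y x : Fin (k + 1) → ℂ)
      = border (planarKernel n y y) (fun j => planarKernel n y (x j))
        (fun i => planarKernel n (x i) y) (kernelMatrix n x) := by
  refine Matrix.ext fun i j => ?_
  refine Fin.cases ?_ (fun i => ?_) i <;> refine Fin.cases ?_ (fun j => ?_) j <;>
    simp [kernelMatrix, border]

theorem planarKernel_mul_planarKernel (hn : 1 ≤ n) (v w : ℂ) :
    Integrable (fun y => planarKernel n y v * planarKernel n w y) (planarMeasure n) ∧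
      ∫ y, planarKernel n y v * planarKernel n w y ∂planarMeasure n = planarKernel n w v := by
  have h := planarKernel_reproducing hn (fun j : Fin n => ((n - 1).choose j : ℂ) * conj v ^ (j : ℕ)) w
  simp only [← planarKernel_eq_sum hn, conj_planarKernel] at h
  exact h

theorem integral_planarKernel_self (hn : 1 ≤ n) :
    Integrable (fun y => planarKernel n y y) (planarMeasure n) ∧
      ∫ y, planarKernel n y y ∂planarMeasure n = n := by
  have h : ∀ y : ℂ, planarKernel n y y
      = ∑ j : Fin n, ((n - 1).choose j : ℂ) * (y ^ (j : ℕ) * conj y ^ (j : ℕ)) := by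
    intro y
    rw [planarKernel_eq_sum hn]
    exact Finset.sum_congr rfl fun j _ => by ring
  have hI : ∀ j : Fin n, Integrable (fun y : ℂ => ((n - 1).choose j : ℂ) *
      (y ^ (j : ℕ) * conj y ^ (j : ℕ))) (planarMeasure n) := fun j =>
    (integrable_pow_mul_conj_pow j.2 j.2).const_mul _
  simp only [h]
  refine ⟨integrable_finsetSum _ fun j _ => hI j, ?_⟩
  rw [integral_finsetSum _ fun j _ => hI j]
  have h2 : ∀ j : Fin n, ∫ y : ℂ, ((n - 1).choose j : ℂ) * (y ^ (j : ℕ) * conj y ^ (j : ℕ))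
      ∂planarMeasure n = 1 := by
    intro j
    rw [integral_const_mul, integral_pow_mul_conj_pow j.2, if_pos rfl, mul_inv_cancel₀]
    exact_mod_cast (Nat.choose_pos (Nat.le_pred_of_lt j.2)).ne'
  simp [h2]

/-- Expand along the border of the new point `y`. The corner integrates to `n det D`. By the
reproducing property `K(x_j, y) K(y, x_i)` integrates to `D j i`, and summing against `adjugate D`
gives `det D` for each of the `k` rows. -/
theorem integral_det_kernelMatrix_cons (hn : 1 ≤ n) (x : Fin k → ℂ) :
    Integrable (fun y => (kernelMatrix n (Fin.cons y x : Fin (k + 1) → ℂ)).det) (planarMeasure n) ∧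
      ∫ y, (kernelMatrix n (Fin.cons y x : Fin (k + 1) → ℂ)).det ∂planarMeasure n
        = (n - k) * (kernelMatrix n x).det := by
  set D := kernelMatrix n x with hD
  have h : ∀ y, (kernelMatrix n (Fin.cons y x : Fin (k + 1) → ℂ)).det
      = planarKernel n y y * D.det - ∑ i, ∑ j, D.adjugate i j *
        (planarKernel n y (x i) * planarKernel n (x j) y) := by
    intro y
    rw [kernelMatrix_cons, det_border]
    congr 1
    simp only [dotProduct, mulVec, Finset.mul_sum]
    exact Finset.sum_congr rfl fun i _ => Finset.sum_congr rfl fun j _ => by ring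
  simp only [h]
  have h1 := integral_planarKernel_self hn
  have h2 := fun i j => planarKernel_mul_planarKernel hn (x i) (x j)
  have hI : ∀ i j, Integrable (fun y => D.adjugate i j *
      (planarKernel n y (x i) * planarKernel n (x j) y)) (planarMeasure n) := fun i j =>
    (h2 i j).1.const_mul _
  have hII : Integrable (fun y => ∑ i, ∑ j, D.adjugate i j *
      (planarKernel n y (x i) * planarKernel n (x j) y)) (planarMeasure n) :=
    integrable_finsetSum _ fun i _ => integrable_finsetSum _ fun j _ => hI i j
  refine ⟨(h1.1.mul_const _).sub hII, ?_⟩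
  rw [integral_sub (h1.1.mul_const _) hII, integral_mul_const, h1.2,
    integral_finsetSum _ fun i _ => integrable_finsetSum _ fun j _ => hI i j]
  have h3 : ∀ i, ∫ y, ∑ j, D.adjugate i j * (planarKernel n y (x i) * planarKernel n (x j) y)
      ∂planarMeasure n = D.det := by
    intro i
    rw [integral_finsetSum _ fun j _ => hI i j]
    simp only [integral_const_mul, (h2 _ _).2]
    have h4 := congrFun (congrFun (adjugate_mul D) i) i
    rw [Matrix.mul_apply] at h4
    simpa [hD, kernelMatrix] using h4
  simp only [h3, Finset.sum_const, Finset.card_univ, Fintype.card_fin, nsmul_eq_mul]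
  ring

theorem lintegral_kernelDensity_cons (hn : 1 ≤ n) (hk : k ≤ n) (x : Fin k → ℂ) :
    ∫⁻ y, kernelDensity n (Fin.cons y x : Fin (k + 1) → ℂ) ∂planarMeasure n
      = ((n - k : ℕ) : ℝ≥0∞) * kernelDensity n x := by
  obtain ⟨hI, h⟩ := integral_det_kernelMatrix_cons hn x
  have hI' : Integrable (fun y => (kernelMatrix n (Fin.cons y x : Fin (k + 1) → ℂ)).det.re)
      (planarMeasure n) := hI.re
  simp only [kernelDensity]
  rw [← ofReal_integral_eq_lintegral_ofReal hI'
    (ae_of_all _ fun y => (det_kernelMatrix_nonneg hn _).1)]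
  have h2 : ∫ y, (kernelMatrix n (Fin.cons y x : Fin (k + 1) → ℂ)).det.re ∂planarMeasure n
      = ((n - k : ℕ) : ℝ) * (kernelMatrix n x).det.re := by
    have h3 := integral_re hI
    rw [h] at h3
    refine h3.trans ?_
    have h4 : ((n : ℂ) - k) = (((n - k : ℕ) : ℝ) : ℂ) := by
      rw [Nat.cast_sub hk]
      push_cast
      rfl
    rw [h4]
    exact Complex.re_ofReal_mul _ _
  refine (congrArg ENNReal.ofReal h2).trans ?_
  rw [ENNReal.ofReal_mul (by positivity), ENNReal.ofReal_natCast]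

end KernelDeterminants

/-! ### Joint intensities in the plane. -/

section Intensities

open Matrix

variable {n k : ℕ}

instance isFiniteMeasure_planarMeasure : IsFiniteMeasure (planarMeasure n) := by
  rcases Nat.eq_zero_or_pos n with rfl | hn
  · have : planarMeasure 0 = 0 := by simp [planarMeasure, planarDensity]
    rw [this]
    infer_instance
  · have h : Integrable fun z : ℂ => planarDensity n z := by
      simpa using integrable_norm_pow_mul_planarDensity (j := 0) hn
    exact isFiniteMeasure_withDensity_ofReal h.2

theorem lintegral_pi_comp_perm {E : Type*} [MeasurableSpace E] (μ : Measure E) [SigmaFinite μ]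
    {f : (Fin k → E) → ℝ≥0∞} (σ : Equiv.Perm (Fin k)) :
    ∫⁻ x, f (x ∘ σ) ∂Measure.pi (fun _ => μ) = ∫⁻ x, f x ∂Measure.pi fun _ => μ :=
  (measurePreserving_arrowCongr' (fun _ => μ) (fun _ => μ) σ.symm (MeasurableEquiv.refl E)
    fun _ => MeasurePreserving.id μ).lintegral_comp_emb (MeasurableEquiv.measurableEmbedding _) f

theorem lintegral_pi_insertNth {E : Type*} [MeasurableSpace E] (μ : Measure E) [SigmaFinite μ]
    (p : Fin (k + 1)) {f : (Fin (k + 1) → E) → ℝ≥0∞} (hf : Measurable f) :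
    ∫⁻ x, f x ∂Measure.pi (fun _ => μ)
      = ∫⁻ x : Fin k → E, ∫⁻ y, f (p.insertNth y x) ∂μ ∂Measure.pi fun _ => μ := by
  have h := (measurePreserving_piFinSuccAbove (fun _ : Fin (k + 1) => μ) p).symm
  have h2 := h.lintegral_comp_emb (MeasurableEquiv.measurableEmbedding _) f
  have hm : Measurable fun q : E × (Fin k → E) =>
      f ((MeasurableEquiv.piFinSuccAbove (fun _ => E) p).symm q) :=
    hf.comp (MeasurableEquiv.measurable _)
  rw [← h2, lintegral_prod_symm _ hm.aemeasurable]
  rfl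

theorem kernelDensity_insertNth (p : Fin (k + 1)) (y : ℂ) (x : Fin k → ℂ) :
    kernelDensity n (p.insertNth y x : Fin (k + 1) → ℂ)
      = kernelDensity n (Fin.cons y x : Fin (k + 1) → ℂ) := by
  rw [← Fin.insertNth_comp_cycleRange_symm p, kernelDensity_comp_perm]

/-- The coordinates outside the range of `τ` are integrated out one at a time. Symmetry of the
density lets a missing coordinate be moved to the front, and passing from `N + 1` to `N` points
costs the factor `n - N`. -/
theorem lintegral_comp_injective_mul_kernelDensity (hn : 1 ≤ n) {g : (Fin k → ℂ) → ℝ≥0∞}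
    (hg : Measurable g) {N : ℕ} (hN : N ≤ n) {τ : Fin k → Fin N} (hτ : Function.Injective τ) :
    ∫⁻ z : Fin N → ℂ, g (z ∘ τ) * kernelDensity n z ∂Measure.pi (fun _ => planarMeasure n)
      = ((n - k).descFactorial (N - k) : ℝ≥0∞) *
        ∫⁻ x, g x * kernelDensity n x ∂Measure.pi fun _ => planarMeasure n := by
  have hkN : k ≤ N := by simpa using Fintype.card_le_of_injective τ hτ
  induction N, hkN using Nat.le_induction with
  | base =>
    let σ : Equiv.Perm (Fin k) := Equiv.ofBijective τ (Finite.injective_iff_bijective.1 hτ)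
    have h := lintegral_pi_comp_perm (planarMeasure n)
      (f := fun x : Fin k → ℂ => g x * kernelDensity n x) σ
    simp only [kernelDensity_comp_perm] at h
    rw [Nat.sub_self, Nat.descFactorial_zero, Nat.cast_one, one_mul, ← h]
    rfl
  | succ N hkN ih =>
    have hns : ¬ Function.Surjective τ := by
      intro hs
      have := Fintype.card_le_of_surjective τ hs
      simp only [Fintype.card_fin] at this
      omega
    simp only [Function.Surjective, not_forall, not_exists] at hns
    obtain ⟨p, hp⟩ := hns
    choose τ' hτ' using fun i => Fin.exists_succAbove_eq (hp i)
    have hinj : Function.Injective τ' := fun i j h => hτ (by rw [← hτ' i, ← hτ' j, h])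
    have hcomp : Measurable fun z : Fin (N + 1) → ℂ => z ∘ τ :=
      measurable_pi_iff.2 fun i => measurable_pi_apply (τ i)
    have hm : Measurable fun z : Fin (N + 1) → ℂ => g (z ∘ τ) * kernelDensity n z :=
      (hg.comp hcomp).mul measurable_kernelDensity
    have hins : ∀ (y : ℂ) (x : Fin N → ℂ), (p.insertNth y x : Fin (N + 1) → ℂ) ∘ τ = x ∘ τ' := by
      intro y x
      funext i
      rw [Function.comp_apply, ← hτ' i, Fin.insertNth_apply_succAbove, Function.comp_apply]
    have hcons : ∀ x : Fin N → ℂ, Measurable fun y : ℂ =>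
        kernelDensity n (Fin.cons y x : Fin (N + 1) → ℂ) := fun x =>
      measurable_kernelDensity.comp (measurable_pi_iff.2 fun i =>
        Fin.cases measurable_id (fun i => measurable_const) i)
    have hcomp' : Measurable fun z : Fin N → ℂ => z ∘ τ' :=
      measurable_pi_iff.2 fun i => measurable_pi_apply (τ' i)
    have hm' : Measurable fun z : Fin N → ℂ => g (z ∘ τ') * kernelDensity n z :=
      (hg.comp hcomp').mul measurable_kernelDensity
    rw [lintegral_pi_insertNth _ p hm]
    simp only [hins, kernelDensity_insertNth]
    have hstep : ∀ x : Fin N → ℂ, ∫⁻ y, g (x ∘ τ') *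
        kernelDensity n (Fin.cons y x : Fin (N + 1) → ℂ) ∂planarMeasure n
        = ((n - N : ℕ) : ℝ≥0∞) * (g (x ∘ τ') * kernelDensity n x) := by
      intro x
      rw [lintegral_const_mul _ (hcons x), lintegral_kernelDensity_cons hn (by omega)]
      ring
    simp only [hstep]
    rw [lintegral_const_mul _ hm', ih (by omega) hinj, ← mul_assoc, Nat.sub_add_comm hkN,
      Nat.descFactorial_succ, show n - k - (N - k) = n - N by omega, Nat.cast_mul]

theorem sphericalWeight_mul_const (hn : 1 ≤ n) : ∃ C : ℝ, 0 < C ∧ ∀ z : Fin n → ℂ,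
    sphericalWeight n z = C * ((kernelMatrix n z).det.re * ∏ i, planarDensity n (z i)) := by
  have hb : 0 < ∏ j : Fin n, ((n - 1).choose j : ℝ) := Finset.prod_pos fun j _ => by
    exact_mod_cast Nat.choose_pos (Nat.le_pred_of_lt j.2)
  have hn0 : (0 : ℝ) < n := by exact_mod_cast hn
  have hd : 0 < ((n : ℝ) / Real.pi) ^ n := pow_pos (div_pos hn0 Real.pi_pos) n
  refine ⟨((∏ j : Fin n, ((n - 1).choose j : ℝ)) * ((n : ℝ) / Real.pi) ^ n)⁻¹,
    by positivity, fun z => ?_⟩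
  have hp : ∏ i, planarDensity n (z i)
      = ((n : ℝ) / Real.pi) ^ n * ∏ k, ((1 + ‖z k‖ ^ 2) ^ (n + 1))⁻¹ := by
    simp only [planarDensity, div_eq_mul_inv _ ((1 + ‖_‖ ^ 2 : ℝ) ^ (n + 1)),
      Finset.prod_mul_distrib, Finset.prod_const, Finset.card_univ, Fintype.card_fin]
  rw [sphericalWeight_eq_vandermonde, det_kernelMatrix_self hn, hp]
  field_simp

theorem lintegral_pi_planarMeasure {f : (Fin k → ℂ) → ℝ≥0∞} (hf : Measurable f) :
    ∫⁻ z, f z ∂Measure.pi (fun _ => planarMeasure n)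
      = ∫⁻ z, ENNReal.ofReal (∏ i, planarDensity n (z i)) * f z := by
  have hd : Measurable fun z : ℂ => ENNReal.ofReal (planarDensity n z) :=
    measurable_planarDensity.ennreal_ofReal
  have : SigmaFinite ((volume : Measure ℂ).withDensity fun z => ENNReal.ofReal (planarDensity n z)) :=
    inferInstanceAs (SigmaFinite (planarMeasure n))
  have h := pi_withDensity (n := k) hd
  have h2 : Measure.pi (fun _ : Fin k => planarMeasure n)
      = (volume : Measure (Fin k → ℂ)).withDensity fun z =>
        ENNReal.ofReal (∏ i, planarDensity n (z i)) := by
    refine h.trans ?_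
    congr 1
    funext z
    rw [ENNReal.ofReal_prod_of_nonneg fun i _ => planarDensity_nonneg _]
  have hp : Measurable fun z : Fin k → ℂ => ENNReal.ofReal (∏ i, planarDensity n (z i)) := by
    have := continuous_planarDensity (n := n)
    have hc : Continuous fun z : Fin k → ℂ => ∏ i, planarDensity n (z i) := by fun_prop
    exact hc.measurable.ennreal_ofReal
  rw [h2]
  exact lintegral_withDensity_eq_lintegral_mul _ hp hf

section Random

variable {Ω : Type*} [MeasurableSpace Ω] {P : Measure Ω} [IsProbabilityMeasure P]
  {G₁ G₂ : Ω → Matrix (Fin n) (Fin n) ℂ}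

theorem lintegral_roots_eq_kernelDensity (hn : 1 ≤ n)
    (hG₁ : IsComplexGaussianMatrix P G₁) (hG₂ : IsComplexGaussianMatrix P G₂)
    (hindep : IndepFun G₁ G₂ P) : ∃ c : ℝ≥0∞, ∀ Φ : Multiset ℂ → ℝ≥0∞,
      Measurable (fun z : Fin n → ℂ => Φ (Finset.univ.val.map z)) →
        ∫⁻ ω, Φ ((G₁ ω)⁻¹ * G₂ ω).charpoly.roots ∂P
          = c * ∫⁻ z : Fin n → ℂ, Φ (Finset.univ.val.map z) * kernelDensity n z
            ∂Measure.pi fun _ => planarMeasure n := by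
  obtain ⟨c, hc⟩ := lintegral_roots_inv_mul_gaussian hn hG₁ hG₂ hindep
  obtain ⟨C, hC, hw⟩ := sphericalWeight_mul_const hn
  refine ⟨c * ENNReal.ofReal C, fun Φ hΦ => ?_⟩
  have hm : Measurable fun z : Fin n → ℂ => Φ (Finset.univ.val.map z) * kernelDensity n z :=
    hΦ.mul measurable_kernelDensity
  rw [hc Φ hΦ, lintegral_pi_planarMeasure hm, mul_assoc, ← lintegral_const_mul' _ _
    ENNReal.ofReal_ne_top]
  congr 1
  refine lintegral_congr fun z => ?_
  rw [hw, ENNReal.ofReal_mul hC.le, ENNReal.ofReal_mul (det_kernelMatrix_nonneg hn z).1,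
    kernelDensity]
  ring

theorem lintegral_roots_prod_sum_indicator (hn : 1 ≤ n)
    (hG₁ : IsComplexGaussianMatrix P G₁) (hG₂ : IsComplexGaussianMatrix P G₂)
    (hindep : IndepFun G₁ G₂ P) {A : Fin k → Set ℂ} (hA : ∀ i, MeasurableSet (A i))
    (hd : Pairwise fun i j => Disjoint (A i) (A j)) :
    ∫⁻ ω, ∏ i, (((G₁ ω)⁻¹ * G₂ ω).charpoly.roots.map ((A i).indicator 1)).sum ∂P
      = ∫⁻ x in Set.univ.pi A, kernelDensity n x ∂Measure.pi fun _ => planarMeasure n := by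
  classical
  obtain ⟨c, hc⟩ := lintegral_roots_eq_kernelDensity hn hG₁ hG₂ hindep
  -- Total mass one, with all `n` coordinates integrated out (the case `k = 0`), determines the
  -- normalization.
  have hnorm : c * (n.factorial : ℝ≥0∞) = 1 := by
    have h1 := hc (fun _ => 1) measurable_const
    have h2 := lintegral_comp_injective_mul_kernelDensity hn (k := 0) (g := fun _ => 1)
      measurable_const le_rfl (τ := Fin.elim0) (fun i => i.elim0)
    simp only [lintegral_one, measure_univ] at h1
    have h3 : ∀ x : Fin 0 → ℂ, kernelDensity n x = 1 := fun x => by simp [kernelDensity]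
    have h4 : ∫⁻ x : Fin 0 → ℂ, 1 * kernelDensity n x ∂Measure.pi (fun _ => planarMeasure n) = 1 := by
      rw [Measure.pi_of_empty _ default]
      simp [h3]
    rw [h4, Nat.sub_zero, Nat.descFactorial_self, mul_one] at h2
    rw [h1, h2]
  have hU : MeasurableSet (Set.univ.pi A) := MeasurableSet.univ_pi hA
  let g : (Fin k → ℂ) → ℝ≥0∞ := fun x => ∏ i, (A i).indicator 1 (x i)
  have hgU : g = (Set.univ.pi A).indicator 1 := by
    funext x
    by_cases hx : x ∈ Set.univ.pi A
    · rw [Set.indicator_of_mem hx]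
      exact Finset.prod_eq_one fun i _ => Set.indicator_of_mem (hx i trivial) _
    · rw [Set.indicator_of_notMem hx]
      simp only [Set.mem_pi, Set.mem_univ, true_implies, not_forall] at hx
      obtain ⟨i, hi⟩ := hx
      exact Finset.prod_eq_zero (Finset.mem_univ i) (Set.indicator_of_notMem hi _)
  have hg : Measurable g := by
    rw [hgU]
    exact measurable_one.indicator hU
  have hgI : ∫⁻ x, g x * kernelDensity n x ∂Measure.pi (fun _ => planarMeasure n)
      = ∫⁻ x in Set.univ.pi A, kernelDensity n x ∂Measure.pi fun _ => planarMeasure n := by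
    rw [← lintegral_indicator hU, hgU]
    refine lintegral_congr fun x => ?_
    by_cases hx : x ∈ Set.univ.pi A <;> simp [hx]
  -- The product of counts expands into a sum over `τ`, which assigns to each set the index of a
  -- point in it.
  have hexp : ∀ z : Fin n → ℂ, ∏ i, ((Finset.univ.val.map z).map ((A i).indicator 1)).sum
      = ∑ τ : Fin k → Fin n, g (z ∘ τ) := by
    intro z
    have h1 : ∀ i, ((Finset.univ.val.map z).map ((A i).indicator 1)).sum
        = ∑ j, (A i).indicator (1 : ℂ → ℝ≥0∞) (z j) := by
      intro i
      rw [Multiset.map_map]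
      rfl
    simp only [h1]
    rw [Finset.prod_univ_sum, Fintype.piFinset_univ]
    rfl
  -- A point cannot lie in two disjoint sets, so only injective `τ` survive. Each contributes `(n -
  -- k)!` times the same integral, and there are `n! / (n - k)!` of them when `k ≤ n`.
  have hzero : ∀ (z : Fin n → ℂ) (τ : Fin k → Fin n), ¬ Function.Injective τ → g (z ∘ τ) = 0 := by
    intro z τ hτ
    simp only [Function.Injective, not_forall] at hτ
    obtain ⟨i, j, hij, hne⟩ := hτ
    rw [hgU]
    refine Set.indicator_of_notMem (fun hm => ?_) _
    have hi : z (τ i) ∈ A i := hm i trivial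
    have hj : z (τ j) ∈ A j := hm j trivial
    rw [← hij] at hj
    exact (hd hne).ne_of_mem hi hj rfl
  have hcomp : ∀ τ : Fin k → Fin n, Measurable fun z : Fin n → ℂ => g (z ∘ τ) := fun τ =>
    hg.comp (measurable_pi_iff.2 fun i => measurable_pi_apply (τ i))
  have hcompm : ∀ τ : Fin k → Fin n, Measurable fun z : Fin n → ℂ =>
      g (z ∘ τ) * kernelDensity n z := fun τ => (hcomp τ).mul measurable_kernelDensity
  have hΦ : Measurable fun z : Fin n → ℂ =>
      ∏ i, ((Finset.univ.val.map z).map ((A i).indicator (1 : ℂ → ℝ≥0∞))).sum := by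
    simp only [hexp]
    exact Finset.measurable_sum _ fun τ _ => hcomp τ
  rw [hc (fun s => ∏ i, (s.map ((A i).indicator 1)).sum) hΦ]
  simp only [hexp, Finset.sum_mul]
  rw [lintegral_finsetSum _ fun τ _ => hcompm τ, ← hgI]
  have hτ : ∀ τ : Fin k → Fin n, ∫⁻ z : Fin n → ℂ, g (z ∘ τ) * kernelDensity n z
      ∂Measure.pi (fun _ => planarMeasure n) = if Function.Injective τ then
        ((n - k).factorial : ℝ≥0∞) *
          ∫⁻ x, g x * kernelDensity n x ∂Measure.pi (fun _ => planarMeasure n) else 0 := by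
    intro τ
    split_ifs with h
    · rw [lintegral_comp_injective_mul_kernelDensity hn hg le_rfl h, Nat.descFactorial_self]
    · simp [hzero _ τ h]
  simp only [hτ]
  rw [← Finset.sum_filter, Finset.sum_const, nsmul_eq_mul]
  have hcard : (Finset.univ.filter fun τ : Fin k → Fin n => Function.Injective τ).card
      = n.descFactorial k := by
    rw [← Fintype.card_subtype, ← Fintype.card_congr (Equiv.subtypeInjectiveEquivEmbedding _ _).symm,
      Fintype.card_embedding_eq, Fintype.card_fin, Fintype.card_fin]
  rw [hcard]
  rcases le_or_gt k n with hkn | hkn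
  · have hf : ((n - k).factorial : ℝ≥0∞) * (n.descFactorial k : ℝ≥0∞) = n.factorial := by
      exact_mod_cast Nat.factorial_mul_descFactorial hkn
    calc _ = (c * (((n - k).factorial : ℝ≥0∞) * (n.descFactorial k : ℝ≥0∞))) *
          ∫⁻ x, g x * kernelDensity n x ∂Measure.pi (fun _ => planarMeasure n) := by ring
      _ = _ := by rw [hf, hnorm, one_mul]
  -- With more sets than points the kernel determinant vanishes by its rank, and both sides are
  -- zero.
  · have h0 : ∀ x : Fin k → ℂ, kernelDensity n x = 0 := fun x => by
      simp [kernelDensity, det_kernelMatrix_eq_zero hn hkn]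
    simp [h0]

end Random

end Intensities

/-! ### Transfer of the intensities to the sphere. -/

section SphericalIntensities

open ComplexConjugate

variable {n k : ℕ}

theorem measurable_onePoint_elim {f : ℂ → ℂ} (hf : Measurable f) :
    Measurable fun z : OnePoint ℂ => z.elim 0 f := by
  have h : (fun z : OnePoint ℂ => z.elim 0 f)
      = Function.extend (fun z : ℂ => (z : OnePoint ℂ)) f 0 := by
    funext z
    induction z using OnePoint.rec with
    | infty =>
      rw [Function.extend_apply' _ _ _ (by simp)]
      rfl
    | coe z => exact (OnePoint.coe_injective.extend_apply f 0 z).symm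
  rw [h]
  exact measurableEmbedding_coe_onePoint.measurable_extend hf measurable_zero

/-- Each summand is a product of functions of one variable, which makes joint measurability on the
sphere visible. -/
theorem sphericalKernel_eq_sum (hn : 1 ≤ n) (z w : OnePoint ℂ) :
    sphericalKernel n z w = ∑ j : Fin n, ((n - 1).choose j : ℂ) *
      conj (w.elim 0 fun w => w ^ (j : ℕ)) * z.elim 0 fun z => z ^ (j : ℕ) := by
  induction z using OnePoint.rec with
  | infty => simp [sphericalKernel]
  | coe z =>
    induction w using OnePoint.rec with
    | infty => simp [sphericalKernel]
    | coe w =>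
      refine (planarKernel_eq_sum hn z w).trans ?_
      simp

theorem measurable_sphericalDensity (hn : 1 ≤ n) : Measurable fun x : Fin k → OnePoint ℂ =>
    ENNReal.ofReal (Matrix.of fun i j => sphericalKernel n (x i) (x j)).det.re := by
  have he : ∀ (j : Fin n) (i : Fin k), Measurable fun x : Fin k → OnePoint ℂ =>
      (x i).elim 0 fun z : ℂ => z ^ (j : ℕ) := fun j i =>
    (measurable_onePoint_elim (f := fun z : ℂ => z ^ (j : ℕ)) (by fun_prop)).comp
      (measurable_pi_apply i)
  have hK : ∀ i j : Fin k, Measurable fun x : Fin k → OnePoint ℂ =>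
      sphericalKernel n (x i) (x j) := by
    intro i j
    simp only [sphericalKernel_eq_sum hn]
    refine Finset.measurable_sum _ fun l _ => ?_
    exact (((Complex.continuous_conj.measurable.comp (he l j)).const_mul _).mul (he l i))
  have hdet : Measurable fun x : Fin k → OnePoint ℂ =>
      (Matrix.of fun i j => sphericalKernel n (x i) (x j)).det := by
    simp only [Matrix.det_apply, Matrix.of_apply]
    exact Finset.measurable_sum _ fun σ _ =>
      (Finset.measurable_prod _ fun i _ => hK _ _).const_smul _
  exact (Complex.measurable_re.comp hdet).ennreal_ofReal

theorem setLIntegral_sphericalMeasure (hn : 1 ≤ n) {B : Fin k → Set (OnePoint ℂ)}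
    (hB : ∀ i, MeasurableSet (B i)) :
    ∫⁻ x in Set.univ.pi B, ENNReal.ofReal
        (Matrix.of fun i j => sphericalKernel n (x i) (x j)).det.re
        ∂(Measure.pi fun _ => sphericalMeasure n)
      = ∫⁻ x in Set.univ.pi fun i => (fun z : ℂ => (z : OnePoint ℂ)) ⁻¹' B i, kernelDensity n x
        ∂Measure.pi fun _ => planarMeasure n := by
  have hmap : Measure.pi (fun _ : Fin k => sphericalMeasure n)
      = (Measure.pi fun _ : Fin k => planarMeasure n).map fun x i => (x i : OnePoint ℂ) := by
    have : IsFiniteMeasure ((planarMeasure n).map fun z : ℂ => (z : OnePoint ℂ)) := inferInstance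
    exact (Measure.pi_map_pi (μ := fun _ : Fin k => planarMeasure n)
      (f := fun _ (z : ℂ) => (z : OnePoint ℂ))
      fun _ => measurable_coe_onePoint.aemeasurable).symm
  have hm : Measurable fun (x : Fin k → ℂ) i => (x i : OnePoint ℂ) :=
    measurable_pi_iff.2 fun i => measurable_coe_onePoint.comp (measurable_pi_apply i)
  rw [hmap, setLIntegral_map (MeasurableSet.univ_pi hB) (measurable_sphericalDensity hn) hm]
  rfl

section Random

variable {Ω : Type*} [MeasurableSpace Ω] {P : Measure Ω} [IsProbabilityMeasure P]
  {G₁ G₂ : Ω → Matrix (Fin n) (Fin n) ℂ}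

theorem isJointIntensity_pencilZeros (hn : 1 ≤ n)
    (hG₁ : IsComplexGaussianMatrix P G₁) (hG₂ : IsComplexGaussianMatrix P G₂)
    (hindep : IndepFun G₁ G₂ P) (k : ℕ) :
    IsJointIntensity P (fun ω => pencilZeros (G₁ ω) (G₂ ω)) (sphericalMeasure n) k fun x =>
      ENNReal.ofReal (Matrix.of fun i j => sphericalKernel n (x i) (x j)).det.re := by
  intro B hB hd
  rw [setLIntegral_sphericalMeasure hn hB, ← lintegral_roots_prod_sum_indicator hn hG₁ hG₂ hindep
    (fun i => measurable_coe_onePoint (hB i)) fun i j hij => (hd hij).preimage _]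
  refine lintegral_congr_ae ?_
  filter_upwards [ae_pencilZeros_eq (G₂ := G₂) hn hG₁] with ω hω
  simp only [hω]
  exact Finset.prod_congr rfl fun i _ => countingMeasure_apply _ (hB i)

theorem isDeterminantalPointProcess_pencilZeros (hn : 1 ≤ n)
    (hG₁ : IsComplexGaussianMatrix P G₁) (hG₂ : IsComplexGaussianMatrix P G₂)
    (hindep : IndepFun G₁ G₂ P) :
    IsDeterminantalPointProcess P (fun ω => pencilZeros (G₁ ω) (G₂ ω))
      (sphericalMeasure n) (sphericalKernel n) (analyticL2 (sphericalMeasure n)) where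
  sigmaFinite := by
    have : IsFiniteMeasure ((planarMeasure n).map fun z : ℂ => (z : OnePoint ℂ)) := inferInstance
    rw [sphericalMeasure_eq_map]
    infer_instance
  pointProcess := isSimplePointProcess_pencilZeros hn hG₁ hG₂ hindep
  kernel := isReproducingKernel_sphericalKernel hn
  intensities := isJointIntensity_pencilZeros hn hG₁ hG₂ hindep

end Random

end SphericalIntensities

end

theorem theorem2p1 {Ω : Type*} [MeasurableSpace Ω] (P : Measure Ω) [IsProbabilityMeasure P]
    (n : ℕ) (hn : 1 ≤ n) (G₁ G₂ : Ω → Matrix (Fin n) (Fin n) ℂ)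
    (hG₁ : IsComplexGaussianMatrix P G₁) (hG₂ : IsComplexGaussianMatrix P G₂)
    (hindep : IndepFun G₁ G₂ P) :
    -- the zeros are the eigenvalues of `G₁⁻¹ G₂`, with multiplicity
    (∀ᵐ ω ∂P, IsUnit (G₁ ω).det ∧
      pencilZeros (G₁ ω) (G₂ ω) =
        (((G₁ ω)⁻¹ * G₂ ω).charpoly.roots.map fun z : ℂ => Measure.dirac (z : OnePoint ℂ)).sum) ∧
    -- they form a determinantal process whose Hilbert space consists of the analytic functions
    IsDeterminantalPointProcess P (fun ω => pencilZeros (G₁ ω) (G₂ ω))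
      (sphericalMeasure n) (sphericalKernel n) (analyticL2 (sphericalMeasure n)) ∧
    -- joint density of the points, in exchangeable random order
    (∃ Z : Ω → Fin n → ℂ, IsEnumeration P (fun ω => pencilZeros (G₁ ω) (G₂ ω)) Z) ∧
    ∃ c : ℝ, 0 < c ∧ ∀ Z : Ω → Fin n → ℂ,
      IsEnumeration P (fun ω => pencilZeros (G₁ ω) (G₂ ω)) Z →
        exchangeableLaw P Z =
          (volume : Measure (Fin n → ℂ)).withDensity
            fun z => ENNReal.ofReal (c * sphericalWeight n z) := by
  refine ⟨?_, isDeterminantalPointProcess_pencilZeros hn hG₁ hG₂ hindep,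
    exists_isEnumeration_pencilZeros hn hG₁ hG₂, exists_exchangeableLaw_eq hn hG₁ hG₂ hindep⟩
  filter_upwards [ae_det_gaussian_ne_zero hn hG₁] with ω hω
  exact ⟨isUnit_iff_ne_zero.2 hω, pencilZeros_eq_countingMeasure hω _⟩
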